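/- Write $\dot{\mathbb R}=\mathbb R\setminus\{0\}$. For an open interval $I$ let $\mathrm{AC}(I)$ be the functions $f$ with $f(y)-f(x)=\int_x^y g$ ($x,y\in I$) for some $g\in L^1_{\rm loc}(I)$; $f\in\mathrm{AC}(\dot{\mathbb R})$ means that both restrictions to $(-\infty,0)$ and $(0,\infty)$ are in $\mathrm{AC}$. For $T\in(0,\infty]$ let $\mathrm{AC}_{1,2}$ be the functions $\Psi:(0,T)\times\dot{\mathbb R}\to\mathbb C$ with $\Psi(\cdot,x)\in\mathrm{AC}((0,T))$ for all $x\in\dot{\mathbb R}$ and $\Psi(t,\cdot),\Psi_x(t,\cdot)\in\mathrm{AC}(\dot{\mathbb R})$ for all $t\in(0,T)$. Let $V:(0,T)\times\dot{\mathbb R}\to\mathbb C$ and $M,N\in\mathbb C^{2\times2}$. For $F:\dot{\mathbb R}\to\mathbb C$, a solution of the Cauchy problem with initial condition $F$ is a $\Psi\in\mathrm{AC}_{1,2}$ such that $$i\Psi_t=-\Psi_{xx}+V\Psi\ \text{ for a.e. }(t,x)\in(0,T)\times\dot{\mathbb R},\qquad \lim_{t\to0^+}\Psi(t,x)=F(x)\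 (x\in\dot{\mathbb R}),$$ $$M\binom{\Psi(t,0^+)}{\Psi(t,0^-)}=N\binom{\Psi_x(t,0^+)}{-\Psi_x(t,0^-)}\quad (t\in(0,T)),$$ where the last (transmission) condition includes the existence of the one-sided limits of $\Psi$ if $(M,N)\ne(0,0)$ and of those of $\Psi_x$ if $N\neq0$, and is void if $M=N=0$. For $\alpha\in(0,\frac\pi2)$ let $S_\alpha=\{z\in\mathbb C\setminus\{0\}:\operatorname{Arg}z\in[0,\alpha]\cup[\pi,\pi+\alpha]\}$. Assume that $G:(0,T)\times\dot{\mathbb R}\times\dot{\mathbb R}\to\mathbb C$ has, for some such $\alpha$, a continuation to $(0,T)\times\dot{\mathbb R}\times S_\alpha$ such that each $G(t,x,\cdot)$ is continuous on $S_\alpha$ and holomorphic in its interior, and (i) for every $z\in S_\alpha$, $G(\cdot,\cdot,z)\in\mathrm{AC}_{1,2}$ satisfies $iG_t=-G_{xx}+VG$ a.e. on $(0,T)\times\dot{\mathbb R}$, and for every $y\in\dot{\mathbb R}$ and $t\in(0,T)$ the function $G(t,\cdot,y)$ satisfies the transmission condition; (ii) for every $x\in\dot{\mathbb R}$ there is $x_0>|x|$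 with $\lim_{t\to0^+}\int_{-x_0}^{x_0}G(t,x,y)\varphi(y)\,dy=\varphi(x)$ for all $\varphi\in C^\infty([-x_0,x_0])$; (iii) there are $a\in\mathrm{AC}((0,T))$ with $a>0$ and $\lim_{t\to0^+}a(t)=\infty$, $p\in(0,2)$, and continuous $A_j,B_j:(0,T)\times\dot{\mathbb R}\to[0,\infty)$, $j=0,1,2$, such that $\widetilde G(t,x,z)=e^{-ia(t)(z-x)^2}G(t,x,z)$ satisfies, for all $t\in(0,T)$, $x\in\dot{\mathbb R}$, $z\in S_\alpha$, the bounds $|\widetilde G|\le A_0e^{B_0|z|^p}$, $|\widetilde G_x|\le A_1e^{B_1|z|^p}$ and (where the derivatives exist) $|\widetilde G_{xx}|,|\widetilde G_t|\le A_2e^{B_2|z|^p}$, with $A_j=A_j(t,x)$, $B_j=B_j(t,x)$; for every $x\in\dot{\mathbb R}$, $A_0(t,x)/\sqrt{a(t)}$ and $B_0(t,x)$ are bounded as $t\to0^+$; and for every $t\in(0,T)$, if $M\ne0$ and $N=0$, then $A_0(t,\cdot),B_0(t,\cdot)$ are bounded as $x\to0^\pm$, while if $N\neq0$, then $A_0(t,\cdot),A_1(t,\cdot),B_0(t,\cdot),B_1(t,\cdot)$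 are bounded as $x\to0^\pm$. Let $q\in(0,2)$, and let $\mathcal A_q(\mathbb C)$ be the space of entire functions $F$ with $|F(z)|\le Ae^{B|z|^q}$ on $\mathbb C$ for some $A,B\ge0$, where $F_n\to F$ in $\mathcal A_q(\mathbb C)$ means that $\sup_{z\in\mathbb C}|F_n(z)-F(z)|e^{-B|z|^q}\to0$ for some $B\ge0$. For $F\in\mathcal A_q(\mathbb C)$ put $$\Psi(t,x;F)=\lim_{\varepsilon\to0^+}\int_{\mathbb R}e^{-\varepsilon y^2}G(t,x,y)F(y)\,dy,\qquad t\in(0,T),\ x\in\dot{\mathbb R}.$$ **Theorem.** Let $\mathcal U\subsetneq\mathcal O\subseteq\mathbb C$, let $\varphi_\kappa\in\mathcal A_q(\mathbb C)$ for $\kappa\in\mathcal O$, and let $F_n=\sum_{l=0}^nC_l(n)\varphi_{\kappa_l(n)}$ with $C_l(n)\in\mathbb C$ and $\kappa_l(n)\in\mathcal U$. Suppose that $F_n\to\varphi_\kappa$ in $\mathcal A_q(\mathbb C)$ for some $\kappa\in\mathcal O\setminus\mathcal U$. Then $\Psi(\cdot,\cdot;F_n)$, $n\in\mathbb N_0$,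 and $\Psi(\cdot,\cdot;\varphi_{\kappa'})$, $\kappa'\in\mathcal O$, are well defined (the integrals converge absolutely for every $\varepsilon>0$ and the limits exist) and are solutions of the Cauchy problem with initial condition $F_n$ and $\varphi_{\kappa'}$, respectively; for all $n$, $t\in(0,T)$ and $x\in\dot{\mathbb R}$ $$\Psi(t,x;F_n)=\sum_{l=0}^nC_l(n)\Psi(t,x;\varphi_{\kappa_l(n)});$$ and for every $t\in(0,T)$ $$\lim_{n\to\infty}\Psi(t,x;F_n)=\lim_{n\to\infty}\sum_{l=0}^nC_l(n)\Psi(t,x;\varphi_{\kappa_l(n)})=\Psi(t,x;\varphi_\kappa)$$ uniformly for $x$ in compact subsets of $\dot{\mathbb R}$. In particular, for every $t\in(0,T)$ the sequence $(\Psi(t,\cdot;F_n))_n$ admits a supershift on $\dot{\mathbb R}$ with respect to the functions $\Psi(t,\cdot;\varphi_{\kappa'})$, $\kappa'\in\mathcal O$: each of its members is a linear combination, with terms $l=0,\dots,n$, of such functions with parameters in $\mathcal U$, and it converges, uniformly on compact subsets of $\dot{\mathbb R}$, to one with parameter in $\mathcal O\setminus\mathcal U$. -/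

import Mathlib

open Filter Topology MeasureTheory Set
open scoped Matrix ContDiff

namespace Supershift

noncomputable section

/-- The open time interval `(0, T)`, where `T ∈ (0, ∞]`. -/
def timeInterval (T : EReal) : Set ℝ := {t : ℝ | 0 < t ∧ (t : EReal) < T}

/-- The closed double sector `{z ≠ 0 | Arg z ∈ [0, α] ∪ [π, π + α]}`; the part with
`Arg z ∈ [π, π + α]` is described as `Arg (-z) ∈ [0, α]`. -/
def doubleSector (α : ℝ) : Set ℂ :=
  {z : ℂ | z ≠ 0 ∧ (Complex.arg z ∈ Icc 0 α ∨ Complex.arg (-z) ∈ Icc 0 α)}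

/-- `f ∈ AC(I)` for an open interval `I`: `f` is the integral of a locally integrable function. -/
def IsAC {E : Type*} [NormedAddCommGroup E] [NormedSpace ℝ E] (I : Set ℝ) (f : ℝ → E) : Prop :=
  ∃ g : ℝ → E, LocallyIntegrableOn g I volume ∧
    ∀ x ∈ I, ∀ y ∈ I, f y - f x = ∫ s in x..y, g s

/-- `f ∈ AC(ℝ \ {0})`. -/
def IsACPunctured (f : ℝ → ℂ) : Prop := IsAC (Iio 0) f ∧ IsAC (Ioi 0) f

/-- `Ψ ∈ AC_{1,2}((0,T) × (ℝ \ {0}))`. That `Ψ_x(t, ·)` is absolutely continuous includes that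
it exists at every point of `ℝ \ {0}`. -/
def IsAC12 (T : EReal) (Ψ : ℝ → ℝ → ℂ) : Prop :=
  (∀ x : ℝ, x ≠ 0 → IsAC (timeInterval T) (fun t => Ψ t x)) ∧
  ∀ t ∈ timeInterval T, IsACPunctured (Ψ t) ∧
    (∀ x : ℝ, x ≠ 0 → DifferentiableAt ℝ (Ψ t) x) ∧ IsACPunctured (deriv (Ψ t))

/-- `i ∂_t Ψ = (-∂_x² + V) Ψ` for almost every `t ∈ (0,T)`, `x ∈ ℝ \ {0}`. -/
def SolvesSchroedinger (T : EReal) (V : ℝ → ℝ → ℂ) (Ψ : ℝ → ℝ → ℂ) : Prop :=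
  ∀ᵐ p : ℝ × ℝ, p.1 ∈ timeInterval T → p.2 ≠ 0 →
    Complex.I * deriv (fun t => Ψ t p.2) p.1 =
      -deriv (deriv (Ψ p.1)) p.2 + V p.1 p.2 * Ψ p.1 p.2

/-- The transmission condition `M (u(0⁺), u(0⁻))ᵀ = N (u'(0⁺), -u'(0⁻))ᵀ`. It includes the existence
of the one-sided limits that occur in it: the limits of `u'` only if `N ≠ 0`, and no limit at all
if `M = N = 0`, where the condition is void. -/
def SatisfiesTransmission (M N : Matrix (Fin 2) (Fin 2) ℂ) (u : ℝ → ℂ) : Prop :=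
  (N = 0 → M ≠ 0 → ∃ up um : ℂ,
    Tendsto u (𝓝[>] 0) (𝓝 up) ∧ Tendsto u (𝓝[<] 0) (𝓝 um) ∧ M *ᵥ ![up, um] = 0) ∧
  (N ≠ 0 → ∃ up um dp dm : ℂ,
    Tendsto u (𝓝[>] 0) (𝓝 up) ∧ Tendsto u (𝓝[<] 0) (𝓝 um) ∧
    Tendsto (deriv u) (𝓝[>] 0) (𝓝 dp) ∧ Tendsto (deriv u) (𝓝[<] 0) (𝓝 dm) ∧
    M *ᵥ ![up, um] = N *ᵥ ![dp, -dm])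

/-- `Ψ` is a solution of the Cauchy problem with potential `V`, transmission matrices `M`, `N` and
initial condition `F`. -/
def IsCauchySolution (T : EReal) (V : ℝ → ℝ → ℂ) (M N : Matrix (Fin 2) (Fin 2) ℂ)
    (F : ℝ → ℂ) (Ψ : ℝ → ℝ → ℂ) : Prop :=
  IsAC12 T Ψ ∧ SolvesSchroedinger T V Ψ ∧
  (∀ t ∈ timeInterval T, SatisfiesTransmission M N (Ψ t)) ∧
  ∀ x : ℝ, x ≠ 0 → Tendsto (fun t => Ψ t x) (𝓝[>] 0) (𝓝 (F x))

/-- The factor `G̃` in the decomposition `G(t,x,z) = exp(i a(t) (z - x)²) G̃(t,x,z)`. -/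
def reducedKernel (a : ℝ → ℝ) (G : ℝ → ℝ → ℂ → ℂ) (t x : ℝ) (z : ℂ) : ℂ :=
  Complex.exp (-(Complex.I * (a t : ℂ) * (z - (x : ℂ)) ^ 2)) * G t x z

/-- The growth condition on `G` (third part of the assumptions on a Green's function). The second
order estimates are required at the points where the respective derivative exists (`deriv` is zero
elsewhere). -/
def HasGrowthBounds (T : EReal) (M N : Matrix (Fin 2) (Fin 2) ℂ) (α : ℝ)
    (G : ℝ → ℝ → ℂ → ℂ) : Prop :=
  ∃ a : ℝ → ℝ, IsAC (timeInterval T) a ∧ (∀ t ∈ timeInterval T, 0 < a t) ∧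
    Tendsto a (𝓝[>] 0) atTop ∧
  ∃ p : ℝ, 0 < p ∧ p < 2 ∧
  ∃ A B : Fin 3 → ℝ → ℝ → ℝ,
    (∀ j, ContinuousOn (Function.uncurry (A j)) (timeInterval T ×ˢ {0}ᶜ)) ∧
    (∀ j, ContinuousOn (Function.uncurry (B j)) (timeInterval T ×ˢ {0}ᶜ)) ∧
    (∀ j, ∀ t ∈ timeInterval T, ∀ x : ℝ, x ≠ 0 → 0 ≤ A j t x ∧ 0 ≤ B j t x) ∧
    (∀ t ∈ timeInterval T, ∀ x : ℝ, x ≠ 0 → ∀ z ∈ doubleSector α,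
      ‖reducedKernel a G t x z‖ ≤ A 0 t x * Real.exp (B 0 t x * ‖z‖ ^ p) ∧
      ‖deriv (fun x' => reducedKernel a G t x' z) x‖
        ≤ A 1 t x * Real.exp (B 1 t x * ‖z‖ ^ p) ∧
      ‖deriv (deriv (fun x' => reducedKernel a G t x' z)) x‖
        ≤ A 2 t x * Real.exp (B 2 t x * ‖z‖ ^ p) ∧
      ‖deriv (fun t' => reducedKernel a G t' x z) t‖
        ≤ A 2 t x * Real.exp (B 2 t x * ‖z‖ ^ p)) ∧
    (∀ x : ℝ, x ≠ 0 → ∃ K : ℝ, ∀ᶠ t in 𝓝[>] (0 : ℝ), A 0 t x / √(a t) ≤ K ∧ B 0 t x ≤ K) ∧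
    (∀ t ∈ timeInterval T,
      (M ≠ 0 → N = 0 → ∃ K : ℝ, ∀ᶠ x in 𝓝[≠] (0 : ℝ), A 0 t x ≤ K ∧ B 0 t x ≤ K) ∧
      (N ≠ 0 → ∃ K : ℝ, ∀ᶠ x in 𝓝[≠] (0 : ℝ),
        A 0 t x ≤ K ∧ A 1 t x ≤ K ∧ B 0 t x ≤ K ∧ B 1 t x ≤ K))

/-- The assumptions on the Green's function `G : (0,T) × (ℝ \ {0}) × (ℝ \ {0}) → ℂ` for the
potential `V` and the transmission matrices `M`, `N`: it has a continuation `Gc` in the last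
variable to a double sector with the listed properties. -/
def IsGreensFunction (T : EReal) (V : ℝ → ℝ → ℂ) (M N : Matrix (Fin 2) (Fin 2) ℂ)
    (G : ℝ → ℝ → ℝ → ℂ) : Prop :=
  ∃ α : ℝ, 0 < α ∧ α < Real.pi / 2 ∧ ∃ Gc : ℝ → ℝ → ℂ → ℂ,
    (∀ t ∈ timeInterval T, ∀ x : ℝ, x ≠ 0 →
      (∀ y : ℝ, y ≠ 0 → Gc t x (y : ℂ) = G t x y) ∧
      ContinuousOn (Gc t x) (doubleSector α) ∧
      DifferentiableOn ℂ (Gc t x) (interior (doubleSector α))) ∧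
    (∀ z ∈ doubleSector α,
      IsAC12 T (fun t x => Gc t x z) ∧ SolvesSchroedinger T V (fun t x => Gc t x z)) ∧
    (∀ y : ℝ, y ≠ 0 → ∀ t ∈ timeInterval T, SatisfiesTransmission M N (fun x => G t x y)) ∧
    (∀ x : ℝ, x ≠ 0 → ∃ x₀ : ℝ, |x| < x₀ ∧
      ∀ f : ℝ → ℂ, ContDiffOn ℝ ∞ f (Icc (-x₀) x₀) →
        Tendsto (fun t => ∫ y in (-x₀)..x₀, G t x y * f y) (𝓝[>] 0) (𝓝 (f x))) ∧
    HasGrowthBounds T M N α Gc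

/-- The space `𝒜_q(ℂ)` of entire functions with exponential growth of order `q`. -/
def expGrowth (q : ℝ) : Set (ℂ → ℂ) :=
  {F | Differentiable ℂ F ∧
    ∃ A B : ℝ, 0 ≤ A ∧ 0 ≤ B ∧ ∀ z : ℂ, ‖F z‖ ≤ A * Real.exp (B * ‖z‖ ^ q)}

/-- Convergence `F n → F₀` in `𝒜_q(ℂ)`. The supremum is taken in `[0, ∞]`. -/
def TendstoExpGrowth (q : ℝ) (F : ℕ → ℂ → ℂ) (F₀ : ℂ → ℂ) : Prop :=
  (∀ n, F n ∈ expGrowth q) ∧ F₀ ∈ expGrowth q ∧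
  ∃ B : ℝ, 0 ≤ B ∧
    Tendsto (fun n => ⨆ z : ℂ, ENNReal.ofReal (‖F n z - F₀ z‖ * Real.exp (-(B * ‖z‖ ^ q))))
      atTop (𝓝 0)

/-- The integrand `exp(-ε y²) G(t,x,y) F(y)`. -/
def regularizedIntegrand (G : ℝ → ℝ → ℝ → ℂ) (F : ℂ → ℂ) (t x ε y : ℝ) : ℂ :=
  Complex.exp (-((ε * y ^ 2 : ℝ) : ℂ)) * G t x y * F (y : ℂ)

/-- The wave function `Ψ(t,x;F) = lim_{ε → 0⁺} ∫ exp(-ε y²) G(t,x,y) F(y) dy`. -/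
def waveFunction (G : ℝ → ℝ → ℝ → ℂ) (F : ℂ → ℂ) (t x : ℝ) : ℂ :=
  limUnder (𝓝[>] (0 : ℝ)) (fun ε => ∫ y : ℝ, regularizedIntegrand G F t x ε y)

/-- The integrals and the limit that define `Ψ(t,x;F)` exist, and `Ψ(·,·;F)` is a solution of the
Cauchy problem with initial condition `F`. -/
def WaveFunctionSolves (T : EReal) (V : ℝ → ℝ → ℂ) (M N : Matrix (Fin 2) (Fin 2) ℂ)
    (G : ℝ → ℝ → ℝ → ℂ) (F : ℂ → ℂ) : Prop :=
  (∀ t ∈ timeInterval T, ∀ x : ℝ, x ≠ 0 →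
    (∀ ε : ℝ, 0 < ε → Integrable (regularizedIntegrand G F t x ε)) ∧
    Tendsto (fun ε => ∫ y : ℝ, regularizedIntegrand G F t x ε y) (𝓝[>] 0)
      (𝓝 (waveFunction G F t x))) ∧
  IsCauchySolution T V M N (fun x => F (x : ℂ)) (waveFunction G F)

/-- The sequence `Φ` admits a supershift with respect to the family `φ κ`, `κ ∈ O`, and `U ⊊ O`. -/
def AdmitsSupershift {X : Type*} [MetricSpace X] (O U : Set ℂ) (φ : ℂ → X → ℂ)
    (Φ : ℕ → X → ℂ) : Prop :=
  U ⊂ O ∧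
  (∃ (C : ℕ → ℕ → ℂ) (k : ℕ → ℕ → ℂ), (∀ n, ∀ l ≤ n, k n l ∈ U) ∧
    ∀ n s, Φ n s = ∑ l ∈ Finset.range (n + 1), C n l * φ (k n l) s) ∧
  ∃ κ ∈ O \ U, ∀ K : Set X, IsCompact K → TendstoUniformlyOn Φ (φ κ) atTop K

end

end Supershift

/-
On the line `z = e^{iβ} y` the factor `exp(i a (z - x)²)` of the Green's function decays like
`exp(-a sin(2β) y²)`, which beats the growth `exp(B |z|^p)` of the kernel and `exp(D |z|^q)` of the
initial condition because `p, q < 2`. By Cauchy's theorem `Ψ(t,x;F)` is therefore an absolutely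
convergent integral along this line, dominated locally uniformly together with its derivatives. The
differential equation then follows by differentiating under the integral, linearity is immediate,
and `F_n → F` in `𝒜_q(ℂ)` gives convergence uniformly on compact sets. Only two limits have to be
taken elsewhere: the transmission and initial conditions are known on the real axis alone. For the
former, the damped real integrals converge as `x → 0^±`, and the damping is removed uniformly in
`x`. For the latter only the tails `|y| > x₀ > |x|` are rotated, and these vanish as `a(t) → ∞`.
-/

namespace Supershift

noncomputable section

section Measurability

variable {X E : Type*} [MeasurableSpace X] [NormedAddCommGroup E]

theorem tendsto_nhdsWithin_of_dense {Y Z : Type*} [TopologicalSpace Y] [TopologicalSpace Z]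
    [RegularSpace Z] {g : Y → Z} {V D : Set Y} {y : Y} {z : Z} (hV : IsOpen V) (hD : Dense D)
    (hg : ContinuousOn g V) (h : Tendsto g (𝓝[V ∩ D] y) (𝓝 z)) : Tendsto g (𝓝[V] y) (𝓝 z) := by
  refine (closed_nhds_basis z).tendsto_right_iff.2 fun C ⟨hC, hC_closed⟩ => ?_
  obtain ⟨W, hW, hyW, hWC⟩ := mem_nhdsWithin.1 (h hC)
  refine mem_nhdsWithin.2 ⟨W, hW, hyW, fun x hx => ?_⟩
  have hx_closure : x ∈ closure (W ∩ V ∩ D) := hD.open_subset_closure_inter (hW.inter hV) hx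
  have hsub : W ∩ V ∩ D ⊆ V := fun x hx => hx.1.2
  exact hC_closed.closure_subset_iff.2 (image_subset_iff.2 (by rwa [inter_assoc]))
    (((hg x hx.2).mono hsub).mem_closure_image hx_closure)

theorem stronglyMeasurable_indicator_of_continuousOn {S : Type*} [TopologicalSpace S]
    [TopologicalSpace.MetrizableSpace S] [SecondCountableTopology S] [MeasurableSpace S]
    [OpensMeasurableSpace S] {U : Set S} (hU : MeasurableSet U) {f : X → S → E}
    (hc : ∀ x, ContinuousOn (f x) U) (hm : ∀ s ∈ U, StronglyMeasurable fun x => f x s) :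
    StronglyMeasurable fun p : X × S => U.indicator (f p.1) p.2 := by
  classical
  have hrestrict : StronglyMeasurable (Function.uncurry fun (s : U) (x : X) => f x s) :=
    stronglyMeasurable_uncurry_of_continuous_of_stronglyMeasurable
      (fun x => continuousOn_iff_continuous_domRestrict.1 (hc x)) fun s => hm s s.2
  refine stronglyMeasurable_of_restrict_of_restrict_compl (measurable_snd hU) ?_ ?_
  · convert hrestrict.comp_measurable
      (g := fun p : Prod.snd ⁻¹' U => ((⟨p.1.2, p.2⟩ : U), p.1.1)) (by fun_prop) using 1
    exact funext fun p => indicator_of_mem (s := U) p.2 (f p.1.1)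
  · convert stronglyMeasurable_const (b := (0 : E)) using 1
    exact funext fun p => indicator_of_notMem (s := U) p.2 (f p.1.1)

variable [NormedSpace ℝ E] {U : Set ℝ}

theorem hasDerivAt_iff_tendsto_rat (hU : IsOpen U) {f : ℝ → E} (hc : ContinuousOn f U) {s : ℝ}
    (hs : s ∈ U) {c : E} :
    HasDerivAt f c s ↔ Tendsto (fun r : ℚ => (r : ℝ)⁻¹ • (f (s + r) - f s))
      (comap (Rat.cast : ℚ → ℝ) (𝓝[≠] 0)) (𝓝 c) := by
  rw [hasDerivAt_iff_tendsto_slope_zero]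
  refine ⟨fun h => h.comp tendsto_comap, fun h => ?_⟩
  set V : Set ℝ := (fun h => s + h) ⁻¹' U ∩ {0}ᶜ with hV_def
  have hV : IsOpen V := (hU.preimage (continuous_const_add s)).inter isOpen_compl_singleton
  have hnhds : 𝓝[≠] (0 : ℝ) = 𝓝[V] 0 := by
    rw [hV_def, inter_comm, nhdsWithin_inter_of_mem']
    refine nhdsWithin_le_nhds ((continuous_const_add s).continuousAt.preimage_mem_nhds ?_)
    simpa using hU.mem_nhds hs
  have hslope : ContinuousOn (fun h : ℝ => h⁻¹ • (f (s + h) - f s)) V :=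
    (continuousOn_inv₀.mono inter_subset_right).smul
      ((hc.comp (continuous_const_add s).continuousOn fun _ h => h.1).sub continuousOn_const)
  rw [hnhds] at h ⊢
  refine tendsto_nhdsWithin_of_dense hV (Rat.denseRange_cast (𝕜 := ℝ)) hslope ?_
  rwa [nhdsWithin_inter', ← map_comap, tendsto_map'_iff]

theorem neBot_comap_ratCast_punctured_nhds_zero :
    (comap (Rat.cast : ℚ → ℝ) (𝓝[≠] 0)).NeBot := by
  rw [comap_neBot_iff_frequently, frequently_nhdsWithin_iff]
  exact mem_closure_iff_frequently.1 ((Rat.denseRange_cast (𝕜 := ℝ)).sdiff_singleton 0 0)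

theorem tendsto_rat_indicator_iff_hasDerivAt (hU : IsOpen U) {f : ℝ → E} (hc : ContinuousOn f U)
    {s : ℝ} (hs : s ∈ U) {c : E} :
    Tendsto (fun r : ℚ => (r : ℝ)⁻¹ • (U.indicator f (s + r) - U.indicator f s))
      (comap (Rat.cast : ℚ → ℝ) (𝓝[≠] 0)) (𝓝 c) ↔ HasDerivAt f c s := by
  rw [← hasDerivAt_iff_tendsto_rat hU (hc.congr (eqOn_indicator (f := f))) hs]
  exact (eqOn_indicator.eventuallyEq_of_mem (hU.mem_nhds hs)).hasDerivAt_iff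

theorem stronglyMeasurable_indicator_deriv [CompleteSpace E] (hU : IsOpen U) {f : X → ℝ → E}
    (hc : ∀ x, ContinuousOn (f x) U) (hm : ∀ s ∈ U, StronglyMeasurable fun x => f x s) :
    StronglyMeasurable fun p : X × ℝ => U.indicator (deriv (f p.1)) p.2 := by
  classical
  set l : Filter ℚ := comap (Rat.cast : ℚ → ℝ) (𝓝[≠] 0)
  have : l.NeBot := neBot_comap_ratCast_punctured_nhds_zero
  set quotient : ℚ → X × ℝ → E := fun r p =>
    (r : ℝ)⁻¹ • (U.indicator (f p.1) (p.2 + r) - U.indicator (f p.1) p.2)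
  have hf := stronglyMeasurable_indicator_of_continuousOn hU.measurableSet hc hm
  have hquotient : ∀ r, StronglyMeasurable (quotient r) := fun r =>
    ((hf.comp_measurable (measurable_fst.prodMk (measurable_snd.add_const (r : ℝ)))).sub
      hf).const_smul _
  have hiff : ∀ p : X × ℝ, p.2 ∈ U → ∀ c,
      Tendsto (quotient · p) l (𝓝 c) ↔ HasDerivAt (f p.1) c p.2 :=
    fun p hp c => tendsto_rat_indicator_iff_hasDerivAt hU (hc p.1) hp
  set D : Set (X × ℝ) := Prod.snd ⁻¹' U ∩ {p | ∃ c, Tendsto (quotient · p) l (𝓝 c)}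
  have hD : MeasurableSet D := (measurable_snd hU.measurableSet).inter
    (StronglyMeasurable.measurableSet_exists_tendsto hquotient)
  convert (StronglyMeasurable.limUnder (l := l) hquotient).indicator hD using 1
  funext p
  by_cases hpU : p.2 ∈ U
  · by_cases hpD : ∃ c, Tendsto (quotient · p) l (𝓝 c)
    · obtain ⟨c, hc⟩ := hpD
      rw [indicator_of_mem hpU, indicator_of_mem (show p ∈ D from ⟨hpU, c, hc⟩),
        ((hiff p hpU c).1 hc).deriv, hc.limUnder_eq]
    · rw [indicator_of_mem hpU, indicator_of_notMem fun h => hpD h.2]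
      refine deriv_zero_of_not_differentiableAt fun h => hpD ⟨_, (hiff p hpU _).2 h.hasDerivAt⟩
  · rw [indicator_of_notMem hpU, indicator_of_notMem fun h => hpU h.1]

theorem stronglyMeasurable_deriv_slice [CompleteSpace E] (hU : IsOpen U) {f : X → ℝ → E}
    (hc : ∀ x, ContinuousOn (f x) U) (hm : ∀ s ∈ U, StronglyMeasurable fun x => f x s) {s : ℝ}
    (hs : s ∈ U) : StronglyMeasurable fun x => deriv (f x) s := by
  have h := (stronglyMeasurable_indicator_deriv hU hc hm).comp_measurable
    (measurable_id.prodMk (measurable_const (a := s)))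
  exact (funext fun x => indicator_of_mem hs (deriv (f x))) ▸ h

theorem ae_prod_deriv_eq [CompleteSpace E] {μ : Measure X} (hU : IsOpen U) {f g : X → ℝ → E}
    (hc : ∀ x, ContinuousOn (f x) U) (hm : ∀ s ∈ U, StronglyMeasurable fun x => f x s)
    (hg : StronglyMeasurable fun p : X × ℝ => U.indicator (g p.1) p.2)
    (h : ∀ x, ∀ᵐ s, s ∈ U → deriv (f x) s = g x s) :
    ∀ᵐ p : X × ℝ ∂μ.prod volume, p.2 ∈ U → deriv (f p.1) p.2 = g p.1 p.2 := by
  have hset := (stronglyMeasurable_indicator_deriv hU hc hm).measurableSet_eq_fun hg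
  have hae : ∀ᵐ p : X × ℝ ∂μ.prod volume,
      U.indicator (deriv (f p.1)) p.2 = U.indicator (g p.1) p.2 := by
    refine (Measure.ae_prod_iff_ae_ae hset).2 (Eventually.of_forall fun x => ?_)
    filter_upwards [h x] with s hs
    by_cases hsU : s ∈ U
    · simpa only [indicator_of_mem hsU] using hs hsU
    · simp only [indicator_of_notMem hsU]
  filter_upwards [hae] with p hp hpU
  simpa only [indicator_of_mem hpU] using hp

end Measurability

section AbsolutelyContinuous

variable {E : Type*} [NormedAddCommGroup E] [NormedSpace ℝ E] {I : Set ℝ} {f g : ℝ → E}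

/-- `g` is a locally integrable derivative of `f` on `I`, in the sense that the fundamental theorem
of calculus holds: the relation that defines absolute continuity, with `g` made explicit. -/
def HasACDerivOn (f g : ℝ → E) (I : Set ℝ) : Prop :=
  LocallyIntegrableOn g I volume ∧ ∀ x ∈ I, ∀ y ∈ I, f y - f x = ∫ s in x..y, g s

theorem HasACDerivOn.isAC (h : HasACDerivOn f g I) : IsAC I f := ⟨g, h⟩

theorem HasACDerivOn.congr {f' : ℝ → E} (h : HasACDerivOn f g I) (heq : EqOn f' f I) :
    HasACDerivOn f' g I :=
  ⟨h.1, fun x hx y hy => by rw [heq hx, heq hy, h.2 x hx y hy]⟩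

theorem HasACDerivOn.mul_const {f g : ℝ → ℂ} (h : HasACDerivOn f g I) (c : ℂ) :
    HasACDerivOn (fun s => f s * c) (fun s => g s * c) I := by
  refine ⟨fun x hx => (h.1 x hx).imp fun t ht => ⟨ht.1, ht.2.mul_const c⟩, fun x hx y hy => ?_⟩
  rw [intervalIntegral.integral_mul_const, ← h.2 x hx y hy, sub_mul]

theorem exists_mem_Ioo_of_isOpen (hI : IsOpen I) {s : ℝ} (hs : s ∈ I) :
    ∃ c ∈ I, ∃ d ∈ I, s ∈ Ioo c d := by
  obtain ⟨l, u, ⟨hl, hu⟩, hlu⟩ := mem_nhds_iff_exists_Ioo_subset.1 (hI.mem_nhds hs)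
  obtain ⟨c, hlc, hcs⟩ := exists_between hl
  obtain ⟨d, hsd, hdu⟩ := exists_between hu
  exact ⟨c, hlu ⟨hlc, hcs.trans hu⟩, d, hlu ⟨hl.trans hsd, hdu⟩, hcs, hsd⟩

theorem HasACDerivOn.intervalIntegrable (hIc : I.OrdConnected) (h : HasACDerivOn f g I) {c d : ℝ}
    (hc : c ∈ I) (hd : d ∈ I) : IntervalIntegrable g volume c d :=
  (h.1.integrableOn_compact_subset (hIc.uIcc_subset hc hd)
    isCompact_uIcc).intervalIntegrable

theorem HasACDerivOn.eventuallyEq_primitive (hI : IsOpen I) (h : HasACDerivOn f g I) {c s : ℝ}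
    (hc : c ∈ I) (hs : s ∈ I) : f =ᶠ[𝓝 s] fun x => f c + ∫ t in c..x, g t := by
  filter_upwards [hI.mem_nhds hs] with x hx
  rw [← h.2 c hc x hx, add_sub_cancel]

theorem HasACDerivOn.continuousOn (hI : IsOpen I) (hIc : I.OrdConnected)
    (h : HasACDerivOn f g I) : ContinuousOn f I := by
  intro s hs
  obtain ⟨c, hc, d, hd, hcsd⟩ := exists_mem_Ioo_of_isOpen hI hs
  have hprimitive : ContinuousAt (fun x => ∫ t in c..x, g t) s :=
    (intervalIntegral.continuousOn_primitive_interval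
      (h.1.integrableOn_compact_subset (hIc.uIcc_subset hc hd) isCompact_uIcc)).continuousAt
      (by rw [uIcc_of_le (hcsd.1.trans hcsd.2).le]; exact Icc_mem_nhds hcsd.1 hcsd.2)
  exact ((continuousAt_const.add hprimitive).congr
    (h.eventuallyEq_primitive hI hc hs).symm).continuousWithinAt

theorem HasACDerivOn.hasDerivAt_of_continuousOn [CompleteSpace E] (hI : IsOpen I)
    (hIc : I.OrdConnected) (h : HasACDerivOn f g I) (hg : ContinuousOn g I) {s : ℝ} (hs : s ∈ I) :
    HasDerivAt f (g s) s :=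
  ((intervalIntegral.integral_hasDerivAt_right (h.intervalIntegrable hIc hs hs)
    (hg.stronglyMeasurableAtFilter hI s hs) (hg.continuousAt (hI.mem_nhds hs))).const_add
      (f s)).congr_of_eventuallyEq (h.eventuallyEq_primitive hI hs hs)

theorem HasACDerivOn.ae_hasDerivAt [CompleteSpace E] (hI : IsOpen I) (hIc : I.OrdConnected)
    (h : HasACDerivOn f g I) : ∀ᵐ s, s ∈ I → HasDerivAt f (g s) s := by
  refine measure_null_of_locally_null _ fun s hs => ?_
  have hsI : s ∈ I := by_contra fun hsI => hs fun h => absurd h hsI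
  obtain ⟨c, hc, d, hd, hcsd⟩ := exists_mem_Ioo_of_isOpen hI hsI
  have hae : ∀ᵐ x, x ∈ Ioo c d → x ∈ I → HasDerivAt f (g x) x := by
    filter_upwards [(h.intervalIntegrable hIc hc hd).ae_hasDerivAt_integral] with x hx hxcd hxI
    have hprimitive := hx (Icc_subset_uIcc (Ioo_subset_Icc_self hxcd)) c left_mem_uIcc
    exact (hprimitive.const_add (f c)).congr_of_eventuallyEq (h.eventuallyEq_primitive hI hc hxI)
  refine ⟨_, inter_mem_nhdsWithin _ (isOpen_Ioo.mem_nhds hcsd), measure_mono_null ?_ hae⟩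
  exact fun x hx hx' => hx.1 (hx' hx.2)

theorem IsAC.hasACDerivOn_deriv [CompleteSpace E] (hI : IsOpen I) (hIc : I.OrdConnected)
    (h : IsAC I f) : HasACDerivOn f (deriv f) I := by
  obtain ⟨g, hg : HasACDerivOn f g I⟩ := h
  have hae : ∀ᵐ s, s ∈ I → g s = deriv f s :=
    (hg.ae_hasDerivAt hI hIc).mono fun s hs hsI => (hs hsI).deriv.symm
  refine ⟨(locallyIntegrableOn_iff hI.isLocallyClosed).2 fun K hK hKc => ?_, fun x hx y hy => ?_⟩
  · refine (hg.1.integrableOn_compact_subset hK hKc).congr_fun_ae ?_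
    exact (ae_restrict_iff' hKc.measurableSet).2 (hae.mono fun s hs hsK => hs (hK hsK))
  · rw [hg.2 x hx y hy]
    refine intervalIntegral.integral_congr_ae (hae.mono fun s hs hsxy => hs ?_)
    exact hIc.uIcc_subset hx hy (uIoc_subset_uIcc hsxy)

theorem IsAC.continuousOn (hI : IsOpen I) (hIc : I.OrdConnected) (h : IsAC I f) :
    ContinuousOn f I :=
  let ⟨_, hg⟩ := h
  HasACDerivOn.continuousOn hI hIc hg

theorem IsAC.ae_differentiableAt [CompleteSpace E] (hI : IsOpen I) (hIc : I.OrdConnected)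
    (h : IsAC I f) : ∀ᵐ s, s ∈ I → DifferentiableAt ℝ f s :=
  let ⟨_, hg⟩ := h
  (HasACDerivOn.ae_hasDerivAt hI hIc hg).mono fun _ hs hsI => (hs hsI).differentiableAt

end AbsolutelyContinuous

section ParametricIntegral

variable {Y E : Type*} [MeasurableSpace Y] {μ : Measure Y} [NormedAddCommGroup E] [NormedSpace ℝ E]
  [CompleteSpace E] {I : Set ℝ} {f : ℝ → Y → E}

theorem integrable_deriv_prod (hI : IsOpen I) (hIc : I.OrdConnected)
    (hac : ∀ y, IsAC I fun s => f s y) (hm : ∀ s ∈ I, StronglyMeasurable (f s)) {c d : ℝ}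
    (hc : c ∈ I) (hd : d ∈ I) {h : ℝ → ℝ} {b : Y → ℝ} (hh : IntegrableOn h (Icc c d))
    (hb : Integrable b μ)
    (hbound : ∀ᵐ s, s ∈ Icc c d → ∀ y, ‖deriv (fun s' => f s' y) s‖ ≤ h s * b y) :
    Integrable (Function.uncurry fun s y => deriv (fun s' => f s' y) s)
      ((volume.restrict (Icc c d)).prod μ) := by
  have hfst := Measure.quasiMeasurePreserving_fst (μ := volume.restrict (Icc c d)) (ν := μ)
  refine (hh.mul_prod hb).mono' ?_ ?_
  · refine ((stronglyMeasurable_indicator_deriv hI (f := fun y s => f s y)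
      (fun y => (hac y).continuousOn hI hIc) hm).comp_measurable
        measurable_swap).aestronglyMeasurable.congr ?_
    filter_upwards [hfst.ae (ae_restrict_mem measurableSet_Icc)] with p hp
    exact indicator_of_mem (hIc.out hc hd hp) (deriv fun s' => f s' p.2)
  · filter_upwards [hfst.ae ((ae_restrict_iff' measurableSet_Icc).2 hbound)] with p hp using hp p.2

variable [SFinite μ]

theorem hasACDerivOn_integral (hI : IsOpen I) (hIc : I.OrdConnected)
    (hac : ∀ y, IsAC I fun s => f s y) (hm : ∀ s ∈ I, StronglyMeasurable (f s))
    (hint : ∀ s ∈ I, Integrable (f s) μ)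
    (hbound : ∀ c ∈ I, ∀ d ∈ I, c ≤ d → ∃ (h : ℝ → ℝ) (b : Y → ℝ), IntegrableOn h (Icc c d) ∧
      Integrable b μ ∧ ∀ᵐ s, s ∈ Icc c d → ∀ y, ‖deriv (fun s' => f s' y) s‖ ≤ h s * b y) :
    HasACDerivOn (fun s => ∫ y, f s y ∂μ) (fun s => ∫ y, deriv (fun s' => f s' y) s ∂μ) I := by
  have hprod : ∀ c ∈ I, ∀ d ∈ I, c ≤ d → Integrable
      (Function.uncurry fun s y => deriv (fun s' => f s' y) s)
      ((volume.restrict (Icc c d)).prod μ) := fun c hc d hd hcd =>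
    let ⟨_, _, hh, hb, hle⟩ := hbound c hc d hd hcd
    integrable_deriv_prod hI hIc hac hm hc hd hh hb hle
  have hftc : ∀ c ∈ I, ∀ d ∈ I, c ≤ d → (∫ y, f d y ∂μ) - ∫ y, f c y ∂μ =
      ∫ s in c..d, ∫ y, deriv (fun s' => f s' y) s ∂μ := by
    intro c hc d hd hcd
    rw [← integral_sub (hint d hd) (hint c hc)]
    simp_rw [fun y => ((hac y).hasACDerivOn_deriv hI hIc).2 c hc d hd,
      intervalIntegral.integral_of_le hcd, ← integral_Icc_eq_integral_Ioc]
    exact (integral_integral_swap (hprod c hc d hd hcd)).symm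
  refine ⟨fun x hx => ?_, fun c hc d hd => ?_⟩
  · obtain ⟨c, hc, d, hd, hcxd⟩ := exists_mem_Ioo_of_isOpen hI hx
    exact ⟨Icc c d, mem_nhdsWithin_of_mem_nhds (Icc_mem_nhds hcxd.1 hcxd.2),
      (hprod c hc d hd (hcxd.1.trans hcxd.2).le).integral_prod_left⟩
  · rcases le_total c d with h | h
    · exact hftc c hc d hd h
    · rw [intervalIntegral.integral_symm, ← hftc d hd c hc h, neg_sub]

theorem hasDerivAt_integral_of_isAC_deriv (hI : IsOpen I) (hIc : I.OrdConnected)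
    (hac : ∀ y, IsAC I fun s => f s y) (hac' : ∀ y, IsAC I (deriv fun s => f s y))
    (hm : ∀ s ∈ I, StronglyMeasurable (f s)) (hint : ∀ s ∈ I, Integrable (f s) μ)
    (hbound : ∀ c ∈ I, ∀ d ∈ I, c ≤ d → ∃ b : Y → ℝ, Integrable b μ ∧ ∀ s ∈ Icc c d, ∀ y,
      ‖deriv (fun s' => f s' y) s‖ ≤ b y ∧ ‖deriv (deriv fun s' => f s' y) s‖ ≤ b y) :
    (∀ s ∈ I, HasDerivAt (fun s => ∫ y, f s y ∂μ) (∫ y, deriv (fun s' => f s' y) s ∂μ) s) ∧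
    IsAC I (fun s => ∫ y, f s y ∂μ) ∧
    HasACDerivOn (deriv fun s => ∫ y, f s y ∂μ)
      (fun s => ∫ y, deriv (deriv fun s' => f s' y) s ∂μ) I := by
  have hm' : ∀ s ∈ I, StronglyMeasurable fun y => deriv (fun s' => f s' y) s := fun _ hs =>
    stronglyMeasurable_deriv_slice hI (f := fun y s => f s y)
      (fun y => (hac y).continuousOn hI hIc) hm hs
  have hint' : ∀ s ∈ I, Integrable (fun y => deriv (fun s' => f s' y) s) μ := fun s hs =>
    let ⟨_, hb, hle⟩ := hbound s hs s hs le_rfl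
    hb.mono' (hm' s hs).aestronglyMeasurable
      (Eventually.of_forall fun y => (hle s ⟨le_rfl, le_rfl⟩ y).1)
  have hfirst : HasACDerivOn (fun s => ∫ y, f s y ∂μ)
      (fun s => ∫ y, deriv (fun s' => f s' y) s ∂μ) I := by
    refine hasACDerivOn_integral hI hIc hac hm hint fun c hc d hd hcd => ?_
    obtain ⟨b, hb, hle⟩ := hbound c hc d hd hcd
    exact ⟨1, b, integrableOn_const (by simp), hb,
      Eventually.of_forall fun s hs y => by simpa using (hle s hs y).1⟩
  have hsecond : HasACDerivOn (fun s => ∫ y, deriv (fun s' => f s' y) s ∂μ)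
      (fun s => ∫ y, deriv (deriv fun s' => f s' y) s ∂μ) I := by
    refine hasACDerivOn_integral (f := fun s y => deriv (fun s' => f s' y) s) hI hIc hac' hm'
      hint' fun c hc d hd hcd => ?_
    obtain ⟨b, hb, hle⟩ := hbound c hc d hd hcd
    exact ⟨1, b, integrableOn_const (by simp), hb,
      Eventually.of_forall fun s hs y => by simpa using (hle s hs y).2⟩
  have hderiv := fun s (hs : s ∈ I) =>
    hfirst.hasDerivAt_of_continuousOn hI hIc (hsecond.continuousOn hI hIc) hs
  exact ⟨hderiv, hfirst.isAC, hsecond.congr fun s hs => (hderiv s hs).deriv⟩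

end ParametricIntegral

theorem isOpen_timeInterval (T : EReal) : IsOpen (timeInterval T) :=
  (isOpen_lt continuous_const continuous_id).inter
    (isOpen_lt continuous_coe_real_ereal continuous_const)

theorem ordConnected_timeInterval (T : EReal) : (timeInterval T).OrdConnected :=
  ⟨fun _ hx _ hy _ hz => ⟨hx.1.trans_le hz.1, (EReal.coe_le_coe_iff.2 hz.2).trans_lt hy.2⟩⟩

theorem IsACPunctured.continuousOn {f : ℝ → ℂ} (h : IsACPunctured f) : ContinuousOn f {0}ᶜ := by
  rw [← Iio_union_Ioi]
  exact (h.1.continuousOn isOpen_Iio ordConnected_Iio).union_of_isOpen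
    (h.2.continuousOn isOpen_Ioi ordConnected_Ioi) isOpen_Iio isOpen_Ioi

/-- The factor `V` need not be measurable: where `k(p,·)` does not vanish, it is eliminated by
comparison with a node `r i` at which `k(p,·) ≠ 0`. -/
theorem ae_ae_eq_mul {X Y ι : Type*} [MeasurableSpace X] [MeasurableSpace Y] [Countable ι]
    {μ : Measure X} {ν : Measure Y} [SFinite μ] [SFinite ν] {k H : X → Y → ℂ} {V : X → ℂ}
    {Ω : Set X} (hΩ : MeasurableSet Ω) (hk : Measurable (Function.uncurry k))
    (hH : Measurable (Function.uncurry H)) (r : ι → Y)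
    (hzero : ∀ p ∈ Ω, (∀ i, k p (r i) = 0) → ∀ y, k p y = 0)
    (heq : ∀ y, ∀ᵐ p ∂μ, p ∈ Ω → H p y = V p * k p y) :
    ∀ᵐ p ∂μ, p ∈ Ω → ∀ᵐ y ∂ν, H p y = V p * k p y := by
  have hslice : ∀ {u : X → Y → ℂ}, Measurable (Function.uncurry u) → ∀ y,
      Measurable fun q : X × Y => u q.1 y := fun hu y =>
    hu.comp (measurable_fst.prodMk measurable_const)
  have hΩ_fst : MeasurableSet {q : X × Y | q.1 ∈ Ω} := measurable_fst hΩ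
  have hnode : ∀ᵐ p ∂μ, ∀ i, p ∈ Ω → H p (r i) = V p * k p (r i) := ae_all_iff.2 fun i => heq (r i)
  have hcross : ∀ᵐ p ∂μ, ∀ i, ∀ᵐ y ∂ν, p ∈ Ω → H p y * k p (r i) = H p (r i) * k p y := by
    refine ae_all_iff.2 fun i => (Measure.ae_ae_comm (hΩ_fst.imp (measurableSet_eq_fun
      (hH.mul (hslice hk (r i))) ((hslice hH (r i)).mul hk)))).2 (Eventually.of_forall fun y => ?_)
    filter_upwards [heq y, heq (r i)] with p hy hr hp
    rw [hy hp, hr hp]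
    ring
  have hvanish : ∀ᵐ p ∂μ, ∀ᵐ y ∂ν, p ∈ Ω → (∀ i, k p (r i) = 0) → H p y = 0 := by
    have hnull : MeasurableSet {q : X × Y | ∀ i, k q.1 (r i) = 0} := by
      simp only [ofPred_forall]
      exact MeasurableSet.iInter fun i => measurableSet_eq_fun (hslice hk (r i)) measurable_const
    refine (Measure.ae_ae_comm (hΩ_fst.imp (hnull.imp (measurableSet_eq_fun hH
      measurable_const)))).2 (Eventually.of_forall fun y => ?_)
    filter_upwards [heq y] with p hy hp hr
    rw [hy hp, hzero p hp hr y, mul_zero]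
  filter_upwards [hnode, hcross, hvanish] with p hnode hcross hvanish hp
  by_cases h : ∀ i, k p (r i) = 0
  · filter_upwards [hvanish] with y hy
    rw [hy hp h, hzero p hp h y, mul_zero]
  · obtain ⟨i, hi⟩ := not_forall.1 h
    filter_upwards [hcross i] with y hy
    refine mul_right_cancel₀ hi ?_
    rw [hy hp, hnode i hp]
    ring

/-- A family `k(·,·,y)` of functions in `AC_{1,2}`, extended by zero, whose members and their
derivatives are dominated, locally in one variable, by integrable functions of the parameter `y`:
the hypothesis under which `∫ k(t,x,y) dy` may be differentiated under the integral sign. -/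
structure IsDominatedFamily (T : EReal) (k : ℝ → ℝ → ℝ → ℂ) : Prop where
  zero : ∀ t x y, (t ∉ timeInterval T ∨ x = 0 ∨ y = 0) → k t x y = 0
  ac12 : ∀ y, IsAC12 T fun t x => k t x y
  cont : ∀ t ∈ timeInterval T, ∀ x, x ≠ 0 → ContinuousOn (k t x) {0}ᶜ
  integrable : ∀ t ∈ timeInterval T, ∀ x, x ≠ 0 → Integrable (k t x)
  bound_time : ∀ x, x ≠ 0 → ∀ c ∈ timeInterval T, ∀ d ∈ timeInterval T, c ≤ d →
    ∃ h g : ℝ → ℝ, IntegrableOn h (Icc c d) ∧ Integrable g ∧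
      ∀ᵐ s, s ∈ Icc c d → ∀ y, ‖deriv (fun s' => k s' x y) s‖ ≤ h s * g y
  bound_space : ∀ t ∈ timeInterval T, ∀ c d, c ≤ d → (0 : ℝ) ∉ Icc c d →
    ∃ g : ℝ → ℝ, Integrable g ∧ ∀ s ∈ Icc c d, ∀ y,
      ‖deriv (fun s' => k t s' y) s‖ ≤ g y ∧ ‖deriv (deriv fun s' => k t s' y) s‖ ≤ g y

namespace IsDominatedFamily

variable {T : EReal} {k : ℝ → ℝ → ℝ → ℂ}

theorem eq_zero_of_notMem (hk : IsDominatedFamily T k) {t : ℝ} (ht : t ∉ timeInterval T) :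
    k t = fun _ _ => 0 := funext₂ fun x y => hk.zero t x y (Or.inl ht)

theorem eq_zero_at_origin (hk : IsDominatedFamily T k) (t : ℝ) : k t 0 = fun _ => 0 :=
  funext fun y => hk.zero t 0 y (Or.inr (Or.inl rfl))

theorem eq_zero_of_forall_rat (hk : IsDominatedFamily T k) {t x : ℝ} (ht : t ∈ timeInterval T)
    (hx : x ≠ 0) (h : ∀ r : ℚ, k t x r = 0) (y : ℝ) : k t x y = 0 := by
  rcases eq_or_ne y 0 with hy | hy
  · exact hk.zero t x y (Or.inr (Or.inr hy))
  have hrat : EqOn (k t x) (fun _ => 0) ({0}ᶜ ∩ range (Rat.cast : ℚ → ℝ)) := by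
    rintro _ ⟨-, r, rfl⟩
    exact h r
  exact hrat.of_subset_closure (hk.cont t ht x hx) continuousOn_const inter_subset_left
    (Rat.denseRange_cast.open_subset_closure_inter isOpen_compl_singleton) hy

section Measurability

theorem stronglyMeasurable_param (hk : IsDominatedFamily T k) (t x : ℝ) :
    StronglyMeasurable (k t x) := by
  by_cases ht : t ∈ timeInterval T
  · rcases eq_or_ne x 0 with rfl | hx
    · simpa only [hk.eq_zero_at_origin] using stronglyMeasurable_const
    · exact (measurable_of_continuousOn_compl_singleton 0 (hk.cont t ht x hx)).stronglyMeasurable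
  · simpa only [hk.eq_zero_of_notMem ht] using stronglyMeasurable_const

theorem continuousOn_time (hk : IsDominatedFamily T k) (x y : ℝ) :
    ContinuousOn (fun t => k t x y) (timeInterval T) := by
  rcases eq_or_ne x 0 with rfl | hx
  · simpa only [hk.eq_zero_at_origin] using continuousOn_const
  · exact ((hk.ac12 y).1 x hx).continuousOn (isOpen_timeInterval T) (ordConnected_timeInterval T)

theorem continuousOn_space (hk : IsDominatedFamily T k) (t y : ℝ) :
    ContinuousOn (fun x => k t x y) {0}ᶜ := by
  by_cases ht : t ∈ timeInterval T
  · exact ((hk.ac12 y).2 t ht).1.continuousOn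
  · simpa only [hk.eq_zero_of_notMem ht] using continuousOn_const

theorem continuousOn_deriv_space (hk : IsDominatedFamily T k) (t y : ℝ) :
    ContinuousOn (deriv fun x => k t x y) {0}ᶜ := by
  by_cases ht : t ∈ timeInterval T
  · exact ((hk.ac12 y).2 t ht).2.2.continuousOn
  · simpa only [hk.eq_zero_of_notMem ht, deriv_const'] using continuousOn_const

theorem stronglyMeasurable_space_param (hk : IsDominatedFamily T k) (t : ℝ) :
    StronglyMeasurable fun p : ℝ × ℝ => k t p.2 p.1 := by
  convert stronglyMeasurable_indicator_of_continuousOn (measurableSet_singleton (0 : ℝ)).compl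
    (f := fun y x => k t x y) (hk.continuousOn_space t) fun x _ => hk.stronglyMeasurable_param t x
    using 1
  exact funext fun p => ((indicator_apply_eq_self (f := fun x => k t x p.1)).2 fun h =>
    hk.zero t p.2 p.1 (Or.inr (Or.inl (notMem_compl_iff.1 h)))).symm

theorem stronglyMeasurable_joint (hk : IsDominatedFamily T k) :
    StronglyMeasurable fun p : (ℝ × ℝ) × ℝ => k p.1.1 p.1.2 p.2 := by
  convert (stronglyMeasurable_indicator_of_continuousOn (isOpen_timeInterval T).measurableSet
    (f := fun (q : ℝ × ℝ) t => k t q.2 q.1) (fun q => hk.continuousOn_time q.2 q.1)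
      fun t _ => hk.stronglyMeasurable_space_param t).comp_measurable
    (g := fun p : (ℝ × ℝ) × ℝ => ((p.2, p.1.2), p.1.1)) (by fun_prop) using 1
  exact funext fun p => ((indicator_apply_eq_self (f := fun t => k t p.1.2 p.2)).2 fun h =>
    hk.zero p.1.1 p.1.2 p.2 (Or.inl h)).symm

theorem stronglyMeasurable_deriv_time (hk : IsDominatedFamily T k) :
    StronglyMeasurable fun p : (ℝ × ℝ) × ℝ =>
      (timeInterval T).indicator (deriv fun t => k t p.1.2 p.2) p.1.1 :=
  (stronglyMeasurable_indicator_deriv (isOpen_timeInterval T)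
    (f := fun (q : ℝ × ℝ) t => k t q.2 q.1) (fun q => hk.continuousOn_time q.2 q.1)
      fun t _ => hk.stronglyMeasurable_space_param t).comp_measurable
    (g := fun p : (ℝ × ℝ) × ℝ => ((p.2, p.1.2), p.1.1)) (by fun_prop)

theorem stronglyMeasurable_deriv_space (hk : IsDominatedFamily T k) {x : ℝ} (hx : x ≠ 0) :
    StronglyMeasurable fun q : ℝ × ℝ => deriv (fun x => k q.2 x q.1) x :=
  stronglyMeasurable_deriv_slice isOpen_compl_singleton (f := fun (q : ℝ × ℝ) x => k q.2 x q.1)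
    (fun q => hk.continuousOn_space q.2 q.1)
    (fun x _ => hk.stronglyMeasurable_joint.comp_measurable
      (g := fun q : ℝ × ℝ => ((q.2, x), q.1)) (by fun_prop)) hx

theorem stronglyMeasurable_deriv_deriv_space (hk : IsDominatedFamily T k) :
    StronglyMeasurable fun p : (ℝ × ℝ) × ℝ =>
      ({0}ᶜ : Set ℝ).indicator (deriv (deriv fun x => k p.1.1 x p.2)) p.1.2 :=
  (stronglyMeasurable_indicator_deriv isOpen_compl_singleton
    (f := fun (q : ℝ × ℝ) => deriv fun x => k q.2 x q.1)
    (fun q => hk.continuousOn_deriv_space q.2 q.1)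
      fun _ hx => hk.stronglyMeasurable_deriv_space hx).comp_measurable
    (g := fun p : (ℝ × ℝ) × ℝ => ((p.2, p.1.1), p.1.2)) (by fun_prop)

theorem stronglyMeasurable_integral (hk : IsDominatedFamily T k) :
    StronglyMeasurable fun p : ℝ × ℝ => ∫ y, k p.1 p.2 y :=
  hk.stronglyMeasurable_joint.integral_prod_right' (ν := volume)

end Measurability

section Regularity

theorem hasACDerivOn_integral_time (hk : IsDominatedFamily T k) (x : ℝ) :
    HasACDerivOn (fun t => ∫ y, k t x y) (fun t => ∫ y, deriv (fun t' => k t' x y) t)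
      (timeInterval T) := by
  rcases eq_or_ne x 0 with rfl | hx
  · simp [HasACDerivOn, hk.eq_zero_at_origin, locallyIntegrableOn_zero]
  · exact hasACDerivOn_integral (f := fun t => k t x) (isOpen_timeInterval T)
      (ordConnected_timeInterval T) (fun y => (hk.ac12 y).1 x hx)
      (fun t _ => hk.stronglyMeasurable_param t x) (fun t ht => hk.integrable t ht x hx)
      (hk.bound_time x hx)

theorem hasDerivAt_integral_space_of_notMem (hk : IsDominatedFamily T k) {t : ℝ}
    (ht : t ∈ timeInterval T) {I : Set ℝ} (hI : IsOpen I) (hIc : I.OrdConnected)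
    (h0 : (0 : ℝ) ∉ I) (hac : ∀ y, IsAC I fun x => k t x y)
    (hac' : ∀ y, IsAC I (deriv fun x => k t x y)) :
    (∀ x ∈ I, HasDerivAt (fun x => ∫ y, k t x y) (∫ y, deriv (fun x' => k t x' y) x) x) ∧
    IsAC I (fun x => ∫ y, k t x y) ∧
    HasACDerivOn (deriv fun x => ∫ y, k t x y)
      (fun x => ∫ y, deriv (deriv fun x' => k t x' y) x) I :=
  hasDerivAt_integral_of_isAC_deriv hI hIc hac hac' (fun x _ => hk.stronglyMeasurable_param t x)
    (fun x hx => hk.integrable t ht x (ne_of_mem_of_not_mem hx h0))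
    fun c hc d hd hcd => hk.bound_space t ht c d hcd fun h => h0 (hIc.out hc hd h)

theorem hasDerivAt_integral_space_neg (hk : IsDominatedFamily T k) {t : ℝ}
    (ht : t ∈ timeInterval T) :
    (∀ x ∈ Iio 0, HasDerivAt (fun x => ∫ y, k t x y) (∫ y, deriv (fun x' => k t x' y) x) x) ∧
    IsAC (Iio 0) (fun x => ∫ y, k t x y) ∧
    HasACDerivOn (deriv fun x => ∫ y, k t x y)
      (fun x => ∫ y, deriv (deriv fun x' => k t x' y) x) (Iio 0) :=
  hk.hasDerivAt_integral_space_of_notMem ht isOpen_Iio ordConnected_Iio self_notMem_Iio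
    (fun y => ((hk.ac12 y).2 t ht).1.1) fun y => ((hk.ac12 y).2 t ht).2.2.1

theorem hasDerivAt_integral_space_pos (hk : IsDominatedFamily T k) {t : ℝ}
    (ht : t ∈ timeInterval T) :
    (∀ x ∈ Ioi 0, HasDerivAt (fun x => ∫ y, k t x y) (∫ y, deriv (fun x' => k t x' y) x) x) ∧
    IsAC (Ioi 0) (fun x => ∫ y, k t x y) ∧
    HasACDerivOn (deriv fun x => ∫ y, k t x y)
      (fun x => ∫ y, deriv (deriv fun x' => k t x' y) x) (Ioi 0) :=
  hk.hasDerivAt_integral_space_of_notMem ht isOpen_Ioi ordConnected_Ioi self_notMem_Ioi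
    (fun y => ((hk.ac12 y).2 t ht).1.2) fun y => ((hk.ac12 y).2 t ht).2.2.2

theorem hasDerivAt_integral_space (hk : IsDominatedFamily T k) {t x : ℝ} (ht : t ∈ timeInterval T)
    (hx : x ≠ 0) : HasDerivAt (fun x => ∫ y, k t x y) (∫ y, deriv (fun x' => k t x' y) x) x :=
  hx.lt_or_gt.elim ((hk.hasDerivAt_integral_space_neg ht).1 x)
    ((hk.hasDerivAt_integral_space_pos ht).1 x)

theorem isAC12_integral (hk : IsDominatedFamily T k) : IsAC12 T fun t x => ∫ y, k t x y := by
  refine ⟨fun x _ => (hk.hasACDerivOn_integral_time x).isAC, fun t ht => ?_⟩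
  obtain ⟨-, hneg, hneg'⟩ := hk.hasDerivAt_integral_space_neg ht
  obtain ⟨-, hpos, hpos'⟩ := hk.hasDerivAt_integral_space_pos ht
  exact ⟨⟨hneg, hpos⟩, fun x hx => (hk.hasDerivAt_integral_space ht hx).differentiableAt,
    hneg'.isAC, hpos'.isAC⟩

theorem continuousOn_integral_time (hk : IsDominatedFamily T k) (x : ℝ) :
    ContinuousOn (fun t => ∫ y, k t x y) (timeInterval T) :=
  (hk.hasACDerivOn_integral_time x).continuousOn (isOpen_timeInterval T)
    (ordConnected_timeInterval T)

theorem continuousOn_integral_space (hk : IsDominatedFamily T k) (t : ℝ) :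
    ContinuousOn (fun x => ∫ y, k t x y) {0}ᶜ := by
  by_cases ht : t ∈ timeInterval T
  · exact (hk.isAC12_integral.2 t ht).1.continuousOn
  · simpa [hk.eq_zero_of_notMem ht] using continuousOn_const

theorem continuousOn_deriv_integral_space (hk : IsDominatedFamily T k) (t : ℝ) :
    ContinuousOn (deriv fun x => ∫ y, k t x y) {0}ᶜ := by
  by_cases ht : t ∈ timeInterval T
  · exact (hk.isAC12_integral.2 t ht).2.2.continuousOn
  · simpa [hk.eq_zero_of_notMem ht] using continuousOn_const

theorem ae_deriv_deriv_integral_space_slice (hk : IsDominatedFamily T k) (t : ℝ) :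
    ∀ᵐ x, x ∈ ({0}ᶜ : Set ℝ) →
      deriv (deriv fun x => ∫ y, k t x y) x = ∫ y, deriv (deriv fun x' => k t x' y) x := by
  by_cases ht : t ∈ timeInterval T
  · filter_upwards
      [(hk.hasDerivAt_integral_space_neg ht).2.2.ae_hasDerivAt isOpen_Iio ordConnected_Iio,
        (hk.hasDerivAt_integral_space_pos ht).2.2.ae_hasDerivAt isOpen_Ioi ordConnected_Ioi]
      with x hneg hpos hx
    exact (lt_or_gt_of_ne hx).elim (fun h => (hneg h).deriv) fun h => (hpos h).deriv
  · simp [hk.eq_zero_of_notMem ht]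

theorem ae_deriv_integral_time (hk : IsDominatedFamily T k) :
    ∀ᵐ p : ℝ × ℝ, p.1 ∈ timeInterval T →
      deriv (fun t => ∫ y, k t p.2 y) p.1 = ∫ y, deriv (fun t => k t p.2 y) p.1 := by
  have hI := isOpen_timeInterval T
  have hae : ∀ᵐ p : ℝ × ℝ, p.2 ∈ timeInterval T →
      deriv (fun t => ∫ y, k t p.1 y) p.2 = ∫ y, deriv (fun t => k t p.1 y) p.2 := by
    refine ae_prod_deriv_eq (μ := volume) (f := fun x t => ∫ y, k t x y)
      (g := fun x t => ∫ y, deriv (fun t' => k t' x y) t) hI hk.continuousOn_integral_time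
      (fun t _ => hk.stronglyMeasurable_integral.comp_measurable
        (measurable_const.prodMk measurable_id)) ?_ fun x => ?_
    · convert (hk.stronglyMeasurable_deriv_time.integral_prod_right' (ν := volume)).comp_measurable
        measurable_swap using 2 with p
      by_cases hp : p.2 ∈ timeInterval T <;> simp [hp]
    · filter_upwards [(hk.hasACDerivOn_integral_time x).ae_hasDerivAt hI
        (ordConnected_timeInterval T)] with t ht htI using (ht htI).deriv
  exact Measure.measurePreserving_swap.quasiMeasurePreserving.ae hae

theorem ae_deriv_deriv_integral_space (hk : IsDominatedFamily T k) :
    ∀ᵐ p : ℝ × ℝ, p.2 ∈ ({0}ᶜ : Set ℝ) →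
      deriv (deriv fun x => ∫ y, k p.1 x y) p.2 = ∫ y, deriv (deriv fun x => k p.1 x y) p.2 := by
  refine ae_prod_deriv_eq (μ := volume) (f := fun t => deriv fun x => ∫ y, k t x y)
    (g := fun t x => ∫ y, deriv (deriv fun x' => k t x' y) x) isOpen_compl_singleton
    hk.continuousOn_deriv_integral_space (fun x hx => ?_) ?_ hk.ae_deriv_deriv_integral_space_slice
  · exact stronglyMeasurable_deriv_slice isOpen_compl_singleton
      (f := fun t x => ∫ y, k t x y) hk.continuousOn_integral_space
      (fun x _ => hk.stronglyMeasurable_integral.comp_measurable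
        (measurable_id.prodMk measurable_const)) hx
  · convert hk.stronglyMeasurable_deriv_deriv_space.integral_prod_right' (ν := volume)
      using 2 with p
    by_cases hp : p.2 = 0 <;> simp [hp]

end Regularity

theorem integrable_deriv_deriv_space (hk : IsDominatedFamily T k) {t x : ℝ}
    (ht : t ∈ timeInterval T) (hx : x ≠ 0) :
    Integrable fun y => deriv (deriv fun x => k t x y) x := by
  obtain ⟨g, hg, hle⟩ := hk.bound_space t ht x x le_rfl fun h => hx (le_antisymm h.1 h.2)
  refine hg.mono' ?_ (Eventually.of_forall fun y => (hle x ⟨le_rfl, le_rfl⟩ y).2)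
  refine (hk.stronglyMeasurable_deriv_deriv_space.comp_measurable ((measurable_const
    (a := (t, x))).prodMk measurable_id)).aestronglyMeasurable.congr (Eventually.of_forall ?_)
  exact fun y => indicator_of_mem (s := {0}ᶜ) hx _

theorem ae_ae_schroedinger (hk : IsDominatedFamily T k) {V : ℝ → ℝ → ℂ}
    (hV : ∀ y, SolvesSchroedinger T V fun t x => k t x y) :
    ∀ᵐ p : ℝ × ℝ, p.1 ∈ timeInterval T → p.2 ≠ 0 → ∀ᵐ y,
      Complex.I * deriv (fun t => k t p.2 y) p.1 =
        V p.1 p.2 * k p.1 p.2 y - deriv (deriv fun x => k p.1 x y) p.2 := by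
  have hae := ae_ae_eq_mul (k := fun (p : ℝ × ℝ) y => k p.1 p.2 y) (V := fun p : ℝ × ℝ => V p.1 p.2)
    (H := fun p y => Complex.I * (timeInterval T).indicator (deriv fun t => k t p.2 y) p.1 +
      ({0}ᶜ : Set ℝ).indicator (deriv (deriv fun x => k p.1 x y)) p.2) (μ := volume) (ν := volume)
    ((isOpen_timeInterval T).measurableSet.prod (measurableSet_singleton 0).compl)
    hk.stronglyMeasurable_joint.measurable
    ((measurable_const.mul hk.stronglyMeasurable_deriv_time.measurable).add
      hk.stronglyMeasurable_deriv_deriv_space.measurable) (Rat.cast : ℚ → ℝ)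
    (fun p hp h => hk.eq_zero_of_forall_rat hp.1 hp.2 h) fun y => ?_
  · filter_upwards [hae] with p hp ht hx
    filter_upwards [hp ⟨ht, hx⟩] with y hy
    rw [← hy, indicator_of_mem ht, indicator_of_mem (s := {0}ᶜ) hx, add_sub_cancel_right]
  · filter_upwards [hV y] with p hp hpΩ
    rw [indicator_of_mem hpΩ.1, indicator_of_mem hpΩ.2, hp hpΩ.1 hpΩ.2]
    ring

theorem solvesSchroedinger_integral (hk : IsDominatedFamily T k) {V : ℝ → ℝ → ℂ}
    (hV : ∀ y, SolvesSchroedinger T V fun t x => k t x y) :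
    SolvesSchroedinger T V fun t x => ∫ y, k t x y := by
  unfold SolvesSchroedinger
  filter_upwards [hk.ae_ae_schroedinger hV, hk.ae_deriv_integral_time,
    hk.ae_deriv_deriv_integral_space] with p hp htime hspace ht hx
  rw [htime ht, hspace hx, ← integral_const_mul, integral_congr_ae (hp ht hx),
    integral_sub ((hk.integrable p.1 ht p.2 hx).const_mul _)
      (hk.integrable_deriv_deriv_space ht hx), integral_const_mul]
  ring

end IsDominatedFamily

section ContourShift

variable {E : Type*} [NormedAddCommGroup E] {β : ℝ} {h : ℂ → E} {b : ℝ → ℝ}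

theorem integrable_comp_add_mul_I (hc : ContinuousOn h {w | w.im ∈ Icc 0 β}) (hb : Integrable b)
    (hle : ∀ w : ℂ, w.im ∈ Icc 0 β → ‖h w‖ ≤ b w.re) {θ : ℝ} (hθ : θ ∈ Icc 0 β) :
    Integrable fun s : ℝ => h (s + θ * Complex.I) := by
  refine hb.mono' (Continuous.aestronglyMeasurable ?_) (Eventually.of_forall fun s => ?_)
  · exact hc.comp_continuous (by fun_prop) fun s => by simpa using hθ
  · simpa using hle (s + θ * Complex.I) (by simpa using hθ)

variable [NormedSpace ℂ E]

theorem norm_integral_vertical_le (hβ : 0 ≤ β) (hle : ∀ w : ℂ, w.im ∈ Icc 0 β → ‖h w‖ ≤ b w.re)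
    (s : ℝ) : ‖∫ θ in (0 : ℝ)..β, h (s + θ * Complex.I)‖ ≤ b s * β := by
  have hbound := intervalIntegral.norm_integral_le_of_norm_le_const (a := 0) (b := β) (C := b s)
    (f := fun θ : ℝ => h (s + θ * Complex.I)) fun θ hθ => by
      rw [uIoc_of_le hβ] at hθ
      simpa using hle (s + θ * Complex.I) (by simpa using ⟨hθ.1.le, hθ.2⟩)
  rwa [sub_zero, abs_of_nonneg hβ] at hbound

theorem integral_horizontal_sub_eq_vertical_sub (hβ : 0 ≤ β)
    (hc : ContinuousOn h {w | w.im ∈ Icc 0 β}) (hd : DifferentiableOn ℂ h {w | w.im ∈ Ioo 0 β})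
    (R : ℝ) :
    (∫ s in (-R)..R, h s) - ∫ s in (-R)..R, h (s + β * Complex.I) =
      Complex.I • (∫ θ in (0 : ℝ)..β, h ((-R : ℝ) + θ * Complex.I)) -
        Complex.I • ∫ θ in (0 : ℝ)..β, h (R + θ * Complex.I) := by
  have hrect := Complex.integral_boundary_rect_eq_zero_of_continuousOn_of_differentiableOn h
    (-R : ℝ) (R + β * Complex.I)
    (hc.mono fun w hw => by simpa [uIcc_of_le hβ] using (Complex.mem_reProdIm.1 hw).2)
    (hd.mono fun w hw => by simpa [hβ] using (Complex.mem_reProdIm.1 hw).2)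
  simp only [Complex.ofReal_re, Complex.ofReal_im, Complex.add_re, Complex.mul_re, Complex.I_re,
    mul_zero, Complex.I_im, mul_one, sub_self, add_zero, Complex.add_im, Complex.mul_im,
    zero_add, Complex.ofReal_zero, zero_mul] at hrect
  rw [← sub_eq_zero, ← hrect]
  abel

theorem integral_eq_integral_add_mul_I (hβ : 0 ≤ β)
    (hc : ContinuousOn h {w | w.im ∈ Icc 0 β}) (hd : DifferentiableOn ℂ h {w | w.im ∈ Ioo 0 β})
    (hb : Integrable b) (hle : ∀ w : ℂ, w.im ∈ Icc 0 β → ‖h w‖ ≤ b w.re)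
    (htop : Tendsto b atTop (𝓝 0)) (hbot : Tendsto b atBot (𝓝 0)) :
    ∫ s : ℝ, h s = ∫ s : ℝ, h (s + β * Complex.I) := by
  have hline : ∀ θ ∈ Icc 0 β, Tendsto (fun R : ℝ => ∫ s in (-R)..R, h (s + θ * Complex.I)) atTop
      (𝓝 (∫ s : ℝ, h (s + θ * Complex.I))) := fun θ hθ =>
    intervalIntegral_tendsto_integral (integrable_comp_add_mul_I hc hb hle hθ)
      tendsto_neg_atTop_atBot tendsto_id
  have hbottom := hline 0 ⟨le_rfl, hβ⟩
  simp only [Complex.ofReal_zero, zero_mul, add_zero] at hbottom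
  have hright : Tendsto (fun R : ℝ => ∫ θ in (0 : ℝ)..β, h (R + θ * Complex.I)) atTop (𝓝 0) :=
    squeeze_zero_norm (norm_integral_vertical_le hβ hle) (by simpa using htop.mul_const β)
  have hleft : Tendsto (fun R : ℝ => ∫ θ in (0 : ℝ)..β, h ((-R : ℝ) + θ * Complex.I)) atTop
      (𝓝 0) :=
    squeeze_zero_norm (fun R => norm_integral_vertical_le hβ hle (-R))
      (by simpa using (hbot.comp tendsto_neg_atTop_atBot).mul_const β)
  have hvertical := (hleft.const_smul Complex.I).sub (hright.const_smul Complex.I)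
  rw [smul_zero, sub_zero] at hvertical
  exact sub_eq_zero.1 (tendsto_nhds_unique ((hbottom.sub (hline β ⟨hβ, le_rfl⟩)).congr
    (integral_horizontal_sub_eq_vertical_sub hβ hc hd)) hvertical)

end ContourShift

section Rotation

theorem integral_Ioi_eq_integral_comp_exp {E : Type*} [NormedAddCommGroup E] [NormedSpace ℝ E]
    (g : ℝ → E) : ∫ y in Ioi 0, g y = ∫ s, Real.exp s • g (Real.exp s) := by
  rw [← Real.range_exp, ← image_univ, integral_image_eq_integral_abs_deriv_smul MeasurableSet.univ
    (fun s _ => (Real.hasDerivAt_exp s).hasDerivWithinAt) Real.exp_injective.injOn]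
  simp only [abs_of_pos (Real.exp_pos _), setIntegral_univ]

theorem integrable_exp_mul_exp_neg_exp :
    Integrable fun s : ℝ => Real.exp s * Real.exp (-Real.exp s) := by
  have h := integrableOn_exp_neg_Ioi 0
  rw [← Real.range_exp, ← image_univ, integrableOn_image_iff_integrableOn_abs_deriv_smul
    MeasurableSet.univ (fun s _ => (Real.hasDerivAt_exp s).hasDerivWithinAt)
    Real.exp_injective.injOn, integrableOn_univ] at h
  simpa only [abs_of_pos (Real.exp_pos _), smul_eq_mul] using h

theorem tendsto_exp_mul_exp_neg_exp_atTop :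
    Tendsto (fun s : ℝ => Real.exp s * Real.exp (-Real.exp s)) atTop (𝓝 0) := by
  simpa only [Function.comp_def, pow_one] using
    (Real.tendsto_pow_mul_exp_neg_atTop_nhds_zero 1).comp Real.tendsto_exp_atTop

theorem tendsto_exp_mul_exp_neg_exp_atBot :
    Tendsto (fun s : ℝ => Real.exp s * Real.exp (-Real.exp s)) atBot (𝓝 0) :=
  squeeze_zero (fun _ => by positivity) (fun s => mul_le_of_le_one_right (Real.exp_pos s).le
    (Real.exp_le_one_iff.2 (neg_nonpos.2 (Real.exp_pos s).le))) Real.tendsto_exp_atBot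

theorem integral_Ioi_eq_integral_rotated {β : ℝ} (hβ : 0 ≤ β) {f : ℂ → ℂ} {K : ℝ}
    (hc : ContinuousOn (fun w => f (Complex.exp w)) {w | w.im ∈ Icc 0 β})
    (hd : DifferentiableOn ℂ (fun w => f (Complex.exp w)) {w | w.im ∈ Ioo 0 β})
    (hle : ∀ w : ℂ, w.im ∈ Icc 0 β → ‖f (Complex.exp w)‖ ≤ K * Real.exp (-Real.exp w.re)) :
    ∫ y in Ioi (0 : ℝ), f y =
      Complex.exp (β * Complex.I) * ∫ y in Ioi (0 : ℝ), f (Complex.exp (β * Complex.I) * y) := by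
  -- in the logarithmic variable `w`, the rotation by `β` is the translation by `β i`
  have hshift := integral_eq_integral_add_mul_I (h := fun w => Complex.exp w * f (Complex.exp w)) hβ
    (Complex.continuous_exp.continuousOn.mul hc)
    (Complex.differentiable_exp.differentiableOn.mul hd)
    (integrable_exp_mul_exp_neg_exp.const_mul K)
    (fun w hw => by
      rw [norm_mul, Complex.norm_exp, mul_left_comm]
      exact mul_le_mul_of_nonneg_left (hle w hw) (Real.exp_pos _).le)
    (by simpa using tendsto_exp_mul_exp_neg_exp_atTop.const_mul K)
    (by simpa using tendsto_exp_mul_exp_neg_exp_atBot.const_mul K)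
  rw [integral_Ioi_eq_integral_comp_exp fun y : ℝ => f y, integral_Ioi_eq_integral_comp_exp
    fun y : ℝ => f (Complex.exp (β * Complex.I) * y), ← integral_const_mul]
  simp only [Complex.real_smul, Complex.ofReal_exp, ← mul_assoc, ← Complex.exp_add]
  simpa only [add_comm] using hshift

end Rotation

section SectorGeometry

variable {β : ℝ} {z : ℂ}

theorem neg_mem_doubleSector : -z ∈ doubleSector β ↔ z ∈ doubleSector β := by
  simp only [doubleSector, Set.mem_ofPred_eq, ne_eq, neg_eq_zero, neg_neg, or_comm]

theorem neg_mem_interior_doubleSector :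
    -z ∈ interior (doubleSector β) ↔ z ∈ interior (doubleSector β) := by
  have hneg : Neg.neg ⁻¹' doubleSector β = doubleSector β := ext fun _ => neg_mem_doubleSector
  conv_rhs => rw [← hneg]
  exact Set.ext_iff.1 ((Homeomorph.neg ℂ).preimage_interior (doubleSector β)) z

theorem doubleSector_mono {α : ℝ} (h : β ≤ α) : doubleSector β ⊆ doubleSector α :=
  fun _ hz => ⟨hz.1, hz.2.imp (fun h' => ⟨h'.1, h'.2.trans h⟩) fun h' => ⟨h'.1, h'.2.trans h⟩⟩

theorem mem_doubleSector_of_cone (hβ : 0 ≤ β) (hre : 0 < z.re) (him : 0 ≤ z.im)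
    (hcone : z.im * Real.cos β ≤ z.re * Real.sin β) : z ∈ doubleSector β := by
  have hz : z ≠ 0 := fun h => hre.ne' (by rw [h, Complex.zero_re])
  have harg := (abs_lt.1 (Complex.abs_arg_lt_pi_div_two_iff.2 (Or.inl hre)))
  refine ⟨hz, Or.inl ⟨Complex.arg_nonneg_iff.2 him, ?_⟩⟩
  by_contra! hlt
  have hsin : 0 < Real.sin (z.arg - β) :=
    Real.sin_pos_of_pos_of_lt_pi (sub_pos.2 hlt) (by linarith [Complex.arg_le_pi z])
  rw [← Complex.norm_mul_cos_arg, ← Complex.norm_mul_sin_arg, mul_assoc, mul_assoc,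
    mul_le_mul_iff_of_pos_left (norm_pos_iff.2 hz)] at hcone
  rw [Real.sin_sub] at hsin
  exact absurd hcone (not_le.2 (sub_pos.1 hsin))

theorem mem_interior_doubleSector_of_cone (hβ : 0 ≤ β) (hre : 0 < z.re) (him : 0 < z.im)
    (hcone : z.im * Real.cos β < z.re * Real.sin β) : z ∈ interior (doubleSector β) := by
  have hopen : IsOpen {u : ℂ | 0 < u.re ∧ 0 < u.im ∧ u.im * Real.cos β < u.re * Real.sin β} :=
    (isOpen_lt continuous_const Complex.continuous_re).and
      ((isOpen_lt continuous_const Complex.continuous_im).and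
        (isOpen_lt (Complex.continuous_im.mul_const _) (Complex.continuous_re.mul_const _)))
  exact mem_interior.2 ⟨_, fun u hu => mem_doubleSector_of_cone hβ hu.1 hu.2.1.le hu.2.2.le, hopen,
    hre, him, hcone⟩

theorem add_exp_cone_eq (x₀ : ℝ) (w : ℂ) :
    (x₀ + Complex.exp w).re * Real.sin β - (x₀ + Complex.exp w).im * Real.cos β =
      x₀ * Real.sin β + Real.exp w.re * Real.sin (β - w.im) := by
  rw [Real.sin_sub, Complex.add_re, Complex.add_im, Complex.exp_re, Complex.exp_im,
    Complex.ofReal_re, Complex.ofReal_im]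
  ring

theorem add_exp_re_pos (hβ : β < Real.pi / 2) {x₀ : ℝ} (hx₀ : 0 ≤ x₀) {w : ℂ}
    (hw : w.im ∈ Icc 0 β) : 0 < (x₀ + Complex.exp w).re := by
  have hcos : 0 < Real.cos w.im :=
    Real.cos_pos_of_mem_Ioo ⟨by linarith [Real.pi_pos, hw.1], hw.2.trans_lt hβ⟩
  rw [Complex.add_re, Complex.exp_re, Complex.ofReal_re]
  positivity

theorem add_exp_mem_doubleSector (hβ : β < Real.pi / 2) {x₀ : ℝ} (hx₀ : 0 ≤ x₀) {w : ℂ}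
    (hw : w.im ∈ Icc 0 β) : x₀ + Complex.exp w ∈ doubleSector β := by
  have hβ0 : 0 ≤ β := hw.1.trans hw.2
  refine mem_doubleSector_of_cone hβ0 (add_exp_re_pos hβ hx₀ hw) ?_ (sub_nonneg.1 ?_)
  · rw [Complex.add_im, Complex.exp_im, Complex.ofReal_im, zero_add]
    exact mul_nonneg (Real.exp_pos _).le
      (Real.sin_nonneg_of_nonneg_of_le_pi hw.1 (by linarith [hw.2]))
  · rw [add_exp_cone_eq]
    exact add_nonneg (mul_nonneg hx₀ (Real.sin_nonneg_of_nonneg_of_le_pi hβ0 (by linarith)))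
      (mul_nonneg (Real.exp_pos _).le (Real.sin_nonneg_of_nonneg_of_le_pi (sub_nonneg.2 hw.2)
        (by linarith [hw.1])))

theorem add_exp_mem_interior_doubleSector (hβ : β < Real.pi / 2) {x₀ : ℝ} (hx₀ : 0 ≤ x₀) {w : ℂ}
    (hw : w.im ∈ Ioo 0 β) : x₀ + Complex.exp w ∈ interior (doubleSector β) := by
  have hβ0 : 0 ≤ β := (hw.1.trans hw.2).le
  refine mem_interior_doubleSector_of_cone hβ0 (add_exp_re_pos hβ hx₀ (Ioo_subset_Icc_self hw)) ?_
    (sub_pos.1 ?_)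
  · rw [Complex.add_im, Complex.exp_im, Complex.ofReal_im, zero_add]
    exact mul_pos (Real.exp_pos _) (Real.sin_pos_of_pos_of_lt_pi hw.1 (by linarith [hw.2]))
  · rw [add_exp_cone_eq]
    exact add_pos_of_nonneg_of_pos
      (mul_nonneg hx₀ (Real.sin_nonneg_of_nonneg_of_le_pi hβ0 (by linarith)))
      (mul_pos (Real.exp_pos _) (Real.sin_pos_of_pos_of_lt_pi (sub_pos.2 hw.2)
        (by linarith [hw.1])))

theorem exp_mul_real_mem_doubleSector (hβ : β < Real.pi / 2) {θ : ℝ} (hθ : θ ∈ Icc 0 β)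
    {y : ℝ} (hy : y ≠ 0) : Complex.exp (θ * Complex.I) * y ∈ doubleSector β := by
  have hpos : ∀ r : ℝ, 0 < r → Complex.exp (θ * Complex.I) * r ∈ doubleSector β := fun r hr => by
    have h := add_exp_mem_doubleSector hβ le_rfl (w := Real.log r + θ * Complex.I)
      (by simpa using hθ)
    rwa [Complex.ofReal_zero, zero_add, Complex.exp_add, ← Complex.ofReal_exp, Real.exp_log hr,
      mul_comm] at h
  rcases hy.lt_or_gt with h | h
  · rw [← neg_mem_doubleSector, ← mul_neg, ← Complex.ofReal_neg]
    exact hpos (-y) (neg_pos.2 h)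
  · exact hpos y h

theorem real_mem_doubleSector (hβ0 : 0 ≤ β) (hβ : β < Real.pi / 2) {y : ℝ} (hy : y ≠ 0) :
    (y : ℂ) ∈ doubleSector β := by
  simpa using exp_mul_real_mem_doubleSector hβ (θ := 0) ⟨le_rfl, hβ0⟩ hy

theorem re_sq_eq_norm_sq_mul_cos (z : ℂ) : (z ^ 2).re = ‖z‖ ^ 2 * Real.cos (2 * z.arg) := by
  rw [Real.cos_two_mul', pow_two, Complex.mul_re]
  nth_rw 1 2 [← Complex.norm_mul_cos_arg]
  nth_rw 1 2 [← Complex.norm_mul_sin_arg z]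
  ring

theorem re_sq_nonneg_of_mem_doubleSector (hβ : β ≤ Real.pi / 4) (hz : z ∈ doubleSector β) :
    0 ≤ (z ^ 2).re := by
  have hsq : ∀ u : ℂ, u.arg ∈ Icc 0 β → 0 ≤ (u ^ 2).re := fun u hu => by
    rw [re_sq_eq_norm_sq_mul_cos]
    exact mul_nonneg (sq_nonneg _)
      (Real.cos_nonneg_of_mem_Icc ⟨by linarith [hu.1, Real.pi_pos], by linarith [hu.2]⟩)
  exact hz.2.elim (hsq z) fun h => neg_sq z ▸ hsq (-z) h

end SectorGeometry

section Majorants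

theorem exists_mul_rpow_le_mul_sq_add (B : ℝ) {p δ : ℝ} (hp0 : 0 ≤ p) (hp2 : p < 2) (hδ : 0 < δ) :
    ∃ C : ℝ, ∀ s : ℝ, 0 ≤ s → B * s ^ p ≤ δ * s ^ 2 + C := by
  have hlittle : ∀ᶠ s : ℝ in atTop, B * s ^ p ≤ δ * s ^ 2 := by
    have hlim : Tendsto (fun s : ℝ => B * s ^ (-(2 - p))) atTop (𝓝 0) := by
      simpa using (tendsto_rpow_neg_atTop (sub_pos.2 hp2)).const_mul B
    filter_upwards [hlim.eventually_le_const hδ, eventually_gt_atTop 0] with s hs hs0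
    calc B * s ^ p = B * s ^ (-(2 - p)) * s ^ 2 := by
          rw [mul_assoc, ← Real.rpow_natCast, ← Real.rpow_add hs0]
          norm_num
      _ ≤ δ * s ^ 2 := by gcongr
  obtain ⟨R, hR⟩ := eventually_atTop.1 hlittle
  refine ⟨|B| * |R| ^ p, fun s hs => ?_⟩
  rcases le_total R s with h | h
  · exact (hR s h).trans (le_add_of_nonneg_right (by positivity))
  · calc B * s ^ p ≤ |B| * |R| ^ p := by
          gcongr
          exacts [le_abs_self B, h.trans (le_abs_self R)]
      _ ≤ _ := le_add_of_nonneg_left (by positivity)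

theorem exists_rpow_add_rpow_sub_sq_le {p q m : ℝ} (hp0 : 0 < p) (hp2 : p < 2)
    (hq0 : 0 < q) (hq2 : q < 2) (B₁ B₂ X D : ℝ) (hm : 0 < m) :
    ∃ K : ℝ, ∀ r ρ : ℝ, 0 ≤ r → 0 ≤ ρ → ρ ≤ X + r →
      B₁ * ρ ^ p + B₂ * ρ ^ q + D * r - m * r ^ 2 ≤ K - r := by
  have hδ : 0 < m / 8 := by positivity
  obtain ⟨C₁, h₁⟩ := exists_mul_rpow_le_mul_sq_add B₁ hp0.le hp2 hδ
  obtain ⟨C₂, h₂⟩ := exists_mul_rpow_le_mul_sq_add B₂ hq0.le hq2 hδ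
  obtain ⟨C₃, h₃⟩ := exists_mul_rpow_le_mul_sq_add (D + 1) zero_le_one one_lt_two
    (show 0 < m / 2 by positivity)
  refine ⟨C₁ + C₂ + C₃ + m / 2 * X ^ 2, fun r ρ hr hρ hρX => ?_⟩
  have hsq : ρ ^ 2 ≤ 2 * X ^ 2 + 2 * r ^ 2 :=
    (pow_le_pow_left₀ hρ hρX 2).trans (by linarith [add_sq_le (a := X) (b := r)])
  have hlin := h₃ r hr
  rw [Real.rpow_one] at hlin
  linarith [h₁ ρ hρ, h₂ ρ hρ, mul_le_mul_of_nonneg_left hsq hδ.le]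

theorem integrable_exp_neg_abs : Integrable fun y : ℝ => Real.exp (-|y|) := by
  rw [← integrableOn_univ, ← Iic_union_Ioi (a := (0 : ℝ)), integrableOn_union]
  constructor
  · refine (integrableOn_exp_Iic 0).congr_fun (fun y hy => ?_) measurableSet_Iic
    simp only [abs_of_nonpos (show y ≤ 0 from hy), neg_neg]
  · refine (integrableOn_exp_neg_Ioi 0).congr_fun (fun y hy => ?_) measurableSet_Ioi
    simp only [abs_of_pos (show (0 : ℝ) < y from hy)]

end Majorants

section Phase

/-- The factor `exp(i a (z - x)²)` that a Green's function is divided by to obtain its reduced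
kernel. -/
def phase (a x : ℝ) (z : ℂ) : ℂ := Complex.exp (Complex.I * (a : ℂ) * (z - (x : ℂ)) ^ 2)

theorem norm_phase (a x : ℝ) (z : ℂ) :
    ‖phase a x z‖ = Real.exp (-(a * (2 * (z.re - x) * z.im))) := by
  rw [phase, Complex.norm_exp]
  congr 1
  simp only [pow_two, Complex.mul_re, Complex.mul_im, Complex.I_re, Complex.I_im, Complex.ofReal_re,
    Complex.ofReal_im, Complex.sub_re, Complex.sub_im]
  ring

theorem phase_ne_zero (a x : ℝ) (z : ℂ) : phase a x z ≠ 0 := Complex.exp_ne_zero _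

theorem hasDerivAt_phase_space (a x : ℝ) (z : ℂ) :
    HasDerivAt (fun x : ℝ => phase a x z)
      (phase a x z * (-(2 * Complex.I * a * (z - x)))) x := by
  refine ((((Complex.ofRealCLM.hasDerivAt (x := x)).const_sub z).pow 2).const_mul
    (Complex.I * (a : ℂ))).cexp.congr_deriv ?_
  simp only [phase, Pi.pow_apply, Complex.ofRealCLM_apply, Complex.ofReal_one]
  push_cast
  ring

theorem hasDerivAt_phase_time {a : ℝ → ℝ} {a' t : ℝ} (ha : HasDerivAt a a' t) (x : ℝ) (z : ℂ) :
    HasDerivAt (fun t : ℝ => phase (a t) x z)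
      (phase (a t) x z * (Complex.I * a' * (z - x) ^ 2)) t :=
  ((ha.ofReal_comp.const_mul Complex.I).mul_const ((z - (x : ℂ)) ^ 2)).cexp

theorem norm_two_mul_I_mul {a : ℝ} (ha : 0 ≤ a) : ‖2 * Complex.I * (a : ℂ)‖ = 2 * a := by
  rw [norm_mul, norm_mul, Complex.norm_I, Complex.norm_real, Complex.norm_two,
    Real.norm_of_nonneg ha, mul_one]

theorem norm_sub_le_exp {X x : ℝ} (hx : |x| ≤ X) (z : ℂ) :
    ‖z - x‖ ≤ Real.exp X * Real.exp ‖z‖ := by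
  have htri : ‖z - x‖ ≤ ‖z‖ + |x| := by simpa using norm_sub_le z (x : ℂ)
  rw [← Real.exp_add]
  linarith [Real.add_one_le_exp (X + ‖z‖)]

theorem norm_two_mul_I_mul_sub_le {a a₁ X x : ℝ} (ha0 : 0 ≤ a) (ha : a ≤ a₁) (hx : |x| ≤ X)
    (z : ℂ) : ‖2 * Complex.I * (a : ℂ) * (z - x)‖ ≤ 2 * a₁ * Real.exp X * Real.exp ‖z‖ := by
  have ha₁ : 0 ≤ a₁ := ha0.trans ha
  rw [norm_mul, norm_two_mul_I_mul ha0, mul_assoc (2 * a₁)]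
  gcongr
  exact norm_sub_le_exp hx z

end Phase

section ReducedKernel

theorem phase_mul_reducedKernel (a : ℝ → ℝ) (G : ℝ → ℝ → ℂ → ℂ) (t x : ℝ) (z : ℂ) :
    phase (a t) x z * reducedKernel a G t x z = G t x z := by
  rw [phase, reducedKernel, ← mul_assoc, ← Complex.exp_add, add_neg_cancel, Complex.exp_zero,
    one_mul]

theorem reducedKernel_eq_inv_phase_mul (a : ℝ → ℝ) (G : ℝ → ℝ → ℂ → ℂ) (t x : ℝ) (z : ℂ) :
    reducedKernel a G t x z = (phase (a t) x z)⁻¹ * G t x z := by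
  rw [reducedKernel, phase, Complex.exp_neg]

variable {a : ℝ → ℝ} {G : ℝ → ℝ → ℂ → ℂ} {t x : ℝ} {z : ℂ}

theorem differentiableAt_reducedKernel_space (h : DifferentiableAt ℝ (fun x => G t x z) x) :
    DifferentiableAt ℝ (fun x => reducedKernel a G t x z) x := by
  simp_rw [reducedKernel_eq_inv_phase_mul]
  exact ((hasDerivAt_phase_space (a t) x z).differentiableAt.inv (phase_ne_zero _ _ _)).mul h

theorem deriv_space_eq_phase_mul (h : DifferentiableAt ℝ (fun x => G t x z) x) :
    deriv (fun x => G t x z) x = phase (a t) x z *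
      (-(2 * Complex.I * a t * (z - x)) * reducedKernel a G t x z +
        deriv (fun x => reducedKernel a G t x z) x) := by
  have hmul := (hasDerivAt_phase_space (a t) x z).mul
    (differentiableAt_reducedKernel_space (a := a) h).hasDerivAt
  have hG : (fun x => G t x z) = (fun x => phase (a t) x z) * fun x => reducedKernel a G t x z :=
    funext fun x => (phase_mul_reducedKernel a G t x z).symm
  rw [hG, hmul.deriv]
  ring

theorem hasDerivAt_neg_two_mul_I_mul_sub (b : ℝ) (z : ℂ) (x : ℝ) :
    HasDerivAt (fun x : ℝ => -(2 * Complex.I * b * (z - x))) (2 * Complex.I * b) x := by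
  refine (((Complex.ofRealCLM.hasDerivAt (x := x)).const_sub z).const_mul
    (2 * Complex.I * (b : ℂ))).neg.congr_deriv ?_
  simp

theorem differentiableAt_deriv_reducedKernel_space
    (h : ∀ᶠ x' in 𝓝 x, DifferentiableAt ℝ (fun x => G t x z) x')
    (h' : DifferentiableAt ℝ (deriv fun x => G t x z) x) :
    DifferentiableAt ℝ (deriv fun x => reducedKernel a G t x z) x := by
  have heq : (deriv fun x => reducedKernel a G t x z) =ᶠ[𝓝 x] fun x' : ℝ =>
      (phase (a t) x' z)⁻¹ * deriv (fun x => G t x z) x' -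
        -(2 * Complex.I * a t * (z - x')) * reducedKernel a G t x' z := by
    filter_upwards [h] with x' hx'
    rw [deriv_space_eq_phase_mul (a := a) hx', inv_mul_cancel_left₀ (phase_ne_zero _ _ _)]
    ring
  refine DifferentiableAt.congr_of_eventuallyEq ?_ heq
  exact (((hasDerivAt_phase_space (a t) x z).differentiableAt.inv (phase_ne_zero _ _ _)).mul
    h').sub ((hasDerivAt_neg_two_mul_I_mul_sub (a t) z x).differentiableAt.mul
      (differentiableAt_reducedKernel_space h.self_of_nhds))

theorem deriv_deriv_space_eq_phase_mul
    (h : ∀ᶠ x' in 𝓝 x, DifferentiableAt ℝ (fun x => G t x z) x')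
    (h' : DifferentiableAt ℝ (deriv fun x => G t x z) x) :
    deriv (deriv fun x => G t x z) x = phase (a t) x z *
      (-(2 * Complex.I * a t * (z - x)) *
        (-(2 * Complex.I * a t * (z - x)) * reducedKernel a G t x z +
          deriv (fun x => reducedKernel a G t x z) x) +
       (2 * Complex.I * a t * reducedKernel a G t x z -
        2 * Complex.I * a t * (z - x) * deriv (fun x => reducedKernel a G t x z) x +
        deriv (deriv fun x => reducedKernel a G t x z) x)) := by
  have hG := differentiableAt_reducedKernel_space (a := a) h.self_of_nhds
  have heq : (deriv fun x => G t x z) =ᶠ[𝓝 x] fun x' : ℝ => phase (a t) x' z *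
      (-(2 * Complex.I * a t * (z - x')) * reducedKernel a G t x' z +
        deriv (fun x => reducedKernel a G t x z) x') :=
    h.mono fun x' hx' => deriv_space_eq_phase_mul hx'
  have hmul := (hasDerivAt_phase_space (a t) x z).mul
    (((hasDerivAt_neg_two_mul_I_mul_sub (a t) z x).mul hG.hasDerivAt).add
      (differentiableAt_deriv_reducedKernel_space (a := a) h h').hasDerivAt)
  rw [heq.deriv_eq]
  refine hmul.deriv.trans ?_
  simp only [Pi.add_apply, Pi.mul_apply]
  ring

theorem deriv_time_eq_phase_mul (ha : DifferentiableAt ℝ a t)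
    (h : DifferentiableAt ℝ (fun t => G t x z) t) :
    deriv (fun t => G t x z) t = phase (a t) x z *
      (Complex.I * deriv a t * (z - x) ^ 2 * reducedKernel a G t x z +
        deriv (fun t => reducedKernel a G t x z) t) := by
  have hp := hasDerivAt_phase_time ha.hasDerivAt x z
  have hr : DifferentiableAt ℝ (fun t => reducedKernel a G t x z) t := by
    simp_rw [reducedKernel_eq_inv_phase_mul]
    exact (hp.differentiableAt.inv (phase_ne_zero _ _ _)).mul h
  have hG : (fun t => G t x z) = (fun t => phase (a t) x z) * fun t => reducedKernel a G t x z :=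
    funext fun t => (phase_mul_reducedKernel a G t x z).symm
  rw [hG, (hp.mul hr.hasDerivAt).deriv]
  ring

end ReducedKernel

/-- The regularity and growth properties, on a double sector of opening `β ≤ π / 4`, of the
continuation of a Green's function. -/
structure IsSectorKernel (T : EReal) (β : ℝ) (G : ℝ → ℝ → ℂ → ℂ) (a : ℝ → ℝ) (p : ℝ)
    (A B : Fin 3 → ℝ → ℝ → ℝ) : Prop where
  angle_pos : 0 < β
  angle_le : β ≤ Real.pi / 4
  cont : ∀ t ∈ timeInterval T, ∀ x : ℝ, x ≠ 0 → ContinuousOn (G t x) (doubleSector β)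
  holo : ∀ t ∈ timeInterval T, ∀ x : ℝ, x ≠ 0 →
    DifferentiableOn ℂ (G t x) (interior (doubleSector β))
  ac12 : ∀ z ∈ doubleSector β, IsAC12 T fun t x => G t x z
  a_ac : IsAC (timeInterval T) a
  a_pos : ∀ t ∈ timeInterval T, 0 < a t
  p_pos : 0 < p
  p_lt : p < 2
  A_cont : ∀ j, ContinuousOn (Function.uncurry (A j)) (timeInterval T ×ˢ {0}ᶜ)
  B_cont : ∀ j, ContinuousOn (Function.uncurry (B j)) (timeInterval T ×ˢ {0}ᶜ)
  nonneg : ∀ j, ∀ t ∈ timeInterval T, ∀ x : ℝ, x ≠ 0 → 0 ≤ A j t x ∧ 0 ≤ B j t x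
  bound : ∀ t ∈ timeInterval T, ∀ x : ℝ, x ≠ 0 → ∀ z ∈ doubleSector β,
    ‖reducedKernel a G t x z‖ ≤ A 0 t x * Real.exp (B 0 t x * ‖z‖ ^ p) ∧
    ‖deriv (fun x' => reducedKernel a G t x' z) x‖ ≤ A 1 t x * Real.exp (B 1 t x * ‖z‖ ^ p) ∧
    ‖deriv (deriv (fun x' => reducedKernel a G t x' z)) x‖
      ≤ A 2 t x * Real.exp (B 2 t x * ‖z‖ ^ p) ∧
    ‖deriv (fun t' => reducedKernel a G t' x z) t‖ ≤ A 2 t x * Real.exp (B 2 t x * ‖z‖ ^ p)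

namespace IsSectorKernel

variable {T : EReal} {β : ℝ} {G : ℝ → ℝ → ℂ → ℂ} {a : ℝ → ℝ} {p : ℝ} {A B : Fin 3 → ℝ → ℝ → ℝ}
  {t x A' B' X a₁ : ℝ} {z : ℂ}

theorem angle_lt (hG : IsSectorKernel T β G a p A B) : β < Real.pi / 2 := by
  linarith [hG.angle_le, Real.pi_pos]

theorem mul_exp_le (hG : IsSectorKernel T β G a p A B) (ht : t ∈ timeInterval T) (hx : x ≠ 0)
    {j : Fin 3} (hA : A j t x ≤ A') (hB : B j t x ≤ B') (z : ℂ) :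
    A j t x * Real.exp (B j t x * ‖z‖ ^ p) ≤ A' * Real.exp (B' * ‖z‖ ^ p) := by
  have hA' : 0 ≤ A' := (hG.nonneg j t ht x hx).1.trans hA
  gcongr

theorem norm_le (hG : IsSectorKernel T β G a p A B) (ht : t ∈ timeInterval T) (hx : x ≠ 0)
    (hz : z ∈ doubleSector β) (hA : A 0 t x ≤ A') (hB : B 0 t x ≤ B') :
    ‖G t x z‖ ≤ A' * (Real.exp (B' * ‖z‖ ^ p) * ‖phase (a t) x z‖) := by
  rw [← phase_mul_reducedKernel a G t x z, norm_mul, ← mul_assoc, mul_comm]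
  gcongr
  exact (hG.bound t ht x hx z hz).1.trans (hG.mul_exp_le ht hx hA hB z)

theorem norm_deriv_space_le (hG : IsSectorKernel T β G a p A B) (ht : t ∈ timeInterval T)
    (hx : x ≠ 0) (hz : z ∈ doubleSector β) (hA : A 0 t x ≤ A') (hB : B 0 t x ≤ B')
    (hA1 : A 1 t x ≤ A') (hB1 : B 1 t x ≤ B') (hX : |x| ≤ X) (ha : a t ≤ a₁) :
    ‖deriv (fun x => G t x z) x‖ ≤ A' * (2 * a₁ * Real.exp X + 1) *
      (Real.exp (B' * ‖z‖ ^ p) * Real.exp (2 * ‖z‖) * ‖phase (a t) x z‖) := by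
  have hA' : 0 ≤ A' := (hG.nonneg 0 t ht x hx).1.trans hA
  have ha₁ : 0 ≤ a₁ := (hG.a_pos t ht).le.trans ha
  have h0 := (hG.bound t ht x hx z hz).1.trans (hG.mul_exp_le ht hx hA hB z)
  have h1 := (hG.bound t ht x hx z hz).2.1.trans (hG.mul_exp_le ht hx hA1 hB1 z)
  have hlin := norm_two_mul_I_mul_sub_le (hG.a_pos t ht).le ha hX z
  have he : Real.exp ‖z‖ ≤ Real.exp (2 * ‖z‖) :=
    Real.exp_le_exp.2 (by linarith [norm_nonneg z])
  have he1 : 1 ≤ Real.exp (2 * ‖z‖) := Real.one_le_exp (by positivity)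
  rw [deriv_space_eq_phase_mul (a := a) (((hG.ac12 z hz).2 t ht).2.1 x hx), norm_mul]
  calc _ ≤ ‖phase (a t) x z‖ * (2 * a₁ * Real.exp X * Real.exp ‖z‖ *
          (A' * Real.exp (B' * ‖z‖ ^ p)) + A' * Real.exp (B' * ‖z‖ ^ p)) := by
        refine mul_le_mul_of_nonneg_left ((norm_add_le _ _).trans (add_le_add ?_ h1))
          (norm_nonneg _)
        rw [norm_mul, norm_neg]
        gcongr
    _ ≤ ‖phase (a t) x z‖ * (2 * a₁ * Real.exp X * Real.exp (2 * ‖z‖) *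
          (A' * Real.exp (B' * ‖z‖ ^ p)) +
            A' * Real.exp (B' * ‖z‖ ^ p) * Real.exp (2 * ‖z‖)) := by
        refine mul_le_mul_of_nonneg_left (add_le_add ?_ ?_) (norm_nonneg _)
        · exact mul_le_mul_of_nonneg_right (by gcongr) (by positivity)
        · exact le_mul_of_one_le_right (by positivity) he1
    _ = _ := by ring

theorem norm_deriv_deriv_space_le (hG : IsSectorKernel T β G a p A B) (ht : t ∈ timeInterval T)
    (hx : x ≠ 0) (hz : z ∈ doubleSector β) (hA : ∀ j, A j t x ≤ A') (hB : ∀ j, B j t x ≤ B')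
    (hX : |x| ≤ X) (ha : a t ≤ a₁) :
    ‖deriv (deriv fun x => G t x z) x‖ ≤
      A' * ((2 * a₁ * Real.exp X + 1) ^ 2 + 2 * a₁) *
      (Real.exp (B' * ‖z‖ ^ p) * Real.exp (2 * ‖z‖) * ‖phase (a t) x z‖) := by
  have hA' : 0 ≤ A' := (hG.nonneg 0 t ht x hx).1.trans (hA 0)
  have hat := (hG.a_pos t ht).le
  have ha₁ : 0 ≤ a₁ := hat.trans ha
  by_cases hd : DifferentiableAt ℝ (deriv fun x => G t x z) x
  swap
  · rw [deriv_zero_of_not_differentiableAt hd, norm_zero]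
    positivity
  have hev : ∀ᶠ x' in 𝓝 x, DifferentiableAt ℝ (fun x => G t x z) x' := by
    filter_upwards [isOpen_ne.mem_nhds hx] with x' hx' using ((hG.ac12 z hz).2 t ht).2.1 x' hx'
  have h0 := (hG.bound t ht x hx z hz).1.trans (hG.mul_exp_le ht hx (hA 0) (hB 0) z)
  have h1 := (hG.bound t ht x hx z hz).2.1.trans (hG.mul_exp_le ht hx (hA 1) (hB 1) z)
  have h2 := (hG.bound t ht x hx z hz).2.2.1.trans (hG.mul_exp_le ht hx (hA 2) (hB 2) z)
  have hlin := norm_two_mul_I_mul_sub_le hat ha hX z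
  have hconst : ‖2 * Complex.I * (a t : ℂ)‖ ≤ 2 * a₁ := by
    rw [norm_two_mul_I_mul hat]
    linarith
  have hsq : Real.exp (2 * ‖z‖) = Real.exp ‖z‖ ^ 2 := by
    rw [← Real.exp_nat_mul, Nat.cast_two]
  have he : 1 ≤ Real.exp ‖z‖ := Real.one_le_exp (norm_nonneg z)
  rw [deriv_deriv_space_eq_phase_mul (a := a) hev hd, norm_mul, hsq]
  set L := 2 * a₁ * Real.exp X
  set R := A' * Real.exp (B' * ‖z‖ ^ p)
  set e := Real.exp ‖z‖
  have : 0 ≤ L := by positivity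
  calc _ ≤ ‖phase (a t) x z‖ *
        (L * e * (L * e * R + R) + (2 * a₁ * R + L * e * R + R)) := by
        refine mul_le_mul_of_nonneg_left (norm_add_le_of_le ?_ (norm_add_le_of_le
          (norm_sub_le_of_le ?_ ?_) h2)) (norm_nonneg _)
        · exact norm_mul_le_of_le (by rwa [norm_neg])
            (norm_add_le_of_le (norm_mul_le_of_le (by rwa [norm_neg]) h0) h1)
        · exact norm_mul_le_of_le hconst h0
        · exact norm_mul_le_of_le hlin h1
    _ = ‖phase (a t) x z‖ * (((L * e + 1) ^ 2 + 2 * a₁) * R) := by ring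
    _ ≤ ‖phase (a t) x z‖ * (((L * e + e) ^ 2 + 2 * a₁ * e ^ 2) * R) := by
        have hle : 2 * a₁ ≤ 2 * a₁ * e ^ 2 :=
          le_mul_of_one_le_right (by positivity) (one_le_pow₀ he)
        gcongr
    _ = _ := by
        simp only [R]
        ring

theorem norm_deriv_time_le (hG : IsSectorKernel T β G a p A B) (ht : t ∈ timeInterval T)
    (hx : x ≠ 0) (hz : z ∈ doubleSector β) (hA : ∀ j, A j t x ≤ A') (hB : ∀ j, B j t x ≤ B')
    (hX : |x| ≤ X) (had : DifferentiableAt ℝ a t) :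
    ‖deriv (fun t => G t x z) t‖ ≤ (|deriv a t| + 1) * (A' * Real.exp X ^ 2 *
      (Real.exp (B' * ‖z‖ ^ p) * Real.exp (2 * ‖z‖) * ‖phase (a t) x z‖)) := by
  have hA' : 0 ≤ A' := (hG.nonneg 0 t ht x hx).1.trans (hA 0)
  by_cases hd : DifferentiableAt ℝ (fun t => G t x z) t
  swap
  · rw [deriv_zero_of_not_differentiableAt hd, norm_zero]
    positivity
  have h0 := (hG.bound t ht x hx z hz).1.trans (hG.mul_exp_le ht hx (hA 0) (hB 0) z)
  have h2 := (hG.bound t ht x hx z hz).2.2.2.trans (hG.mul_exp_le ht hx (hA 2) (hB 2) z)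
  have hn := norm_sub_le_exp hX z
  have hsq : Real.exp (2 * ‖z‖) = Real.exp ‖z‖ ^ 2 := by
    rw [← Real.exp_nat_mul, Nat.cast_two]
  have he : 1 ≤ (Real.exp X * Real.exp ‖z‖) ^ 2 :=
    one_le_pow₀ (one_le_mul_of_one_le_of_one_le
      (Real.one_le_exp ((abs_nonneg x).trans hX)) (Real.one_le_exp (norm_nonneg z)))
  rw [deriv_time_eq_phase_mul (a := a) had hd, norm_mul, hsq]
  set R := A' * Real.exp (B' * ‖z‖ ^ p)
  calc _ ≤ ‖phase (a t) x z‖ * (|deriv a t| * (Real.exp X * Real.exp ‖z‖) ^ 2 * R + R) := by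
        refine mul_le_mul_of_nonneg_left (norm_add_le_of_le ?_ h2) (norm_nonneg _)
        rw [norm_mul, norm_mul, norm_mul, norm_pow, Complex.norm_I, Complex.norm_real,
          Real.norm_eq_abs, one_mul]
        gcongr
    _ ≤ ‖phase (a t) x z‖ * (|deriv a t| * (Real.exp X * Real.exp ‖z‖) ^ 2 * R +
          R * (Real.exp X * Real.exp ‖z‖) ^ 2) := by
        gcongr
        exact le_mul_of_one_le_right (by positivity) he
    _ = _ := by
        simp only [R]
        ring

end IsSectorKernel

section Congruence

variable {T : EReal} {f g : ℝ → ℂ} {Ψ Φ : ℝ → ℝ → ℂ} {V : ℝ → ℝ → ℂ}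

theorem eventuallyEq_nhds_of_forall_ne_zero (h : ∀ x, x ≠ 0 → f x = g x) {x : ℝ} (hx : x ≠ 0) :
    f =ᶠ[𝓝 x] g :=
  eventually_of_mem (isOpen_ne.mem_nhds hx) h

theorem deriv_eq_of_forall_ne_zero (h : ∀ x, x ≠ 0 → f x = g x) {x : ℝ} (hx : x ≠ 0) :
    deriv f x = deriv g x :=
  (eventuallyEq_nhds_of_forall_ne_zero h hx).deriv_eq

theorem IsACPunctured.congr (hf : IsACPunctured f) (h : ∀ x, x ≠ 0 → f x = g x) :
    IsACPunctured g := by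
  obtain ⟨⟨_, hneg⟩, ⟨_, hpos⟩⟩ := hf
  exact ⟨(HasACDerivOn.congr hneg fun x hx => (h x (ne_of_lt hx)).symm).isAC,
    (HasACDerivOn.congr hpos fun x hx => (h x (ne_of_gt hx)).symm).isAC⟩

theorem IsACPunctured.mul_const (hf : IsACPunctured f) (c : ℂ) :
    IsACPunctured fun x => f x * c := by
  obtain ⟨⟨_, hneg⟩, ⟨_, hpos⟩⟩ := hf
  exact ⟨(HasACDerivOn.mul_const hneg c).isAC, (HasACDerivOn.mul_const hpos c).isAC⟩

theorem IsAC12.congr (hΨ : IsAC12 T Ψ) (h : ∀ t ∈ timeInterval T, ∀ x, x ≠ 0 → Ψ t x = Φ t x) :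
    IsAC12 T Φ := by
  refine ⟨fun x hx => ?_, fun t ht => ?_⟩
  · obtain ⟨_, hg⟩ := hΨ.1 x hx
    exact (HasACDerivOn.congr hg fun t ht => (h t ht x hx).symm).isAC
  · obtain ⟨hac, hdiff, hac'⟩ := hΨ.2 t ht
    exact ⟨hac.congr (h t ht), fun x hx => (hdiff x hx).congr_of_eventuallyEq
      (eventuallyEq_nhds_of_forall_ne_zero (h t ht) hx).symm,
      hac'.congr fun x hx => deriv_eq_of_forall_ne_zero (h t ht) hx⟩

theorem IsAC12.mul_const (hΨ : IsAC12 T Ψ) (c : ℂ) : IsAC12 T fun t x => Ψ t x * c := by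
  refine ⟨fun x hx => ?_, fun t ht => ?_⟩
  · obtain ⟨_, hg⟩ := hΨ.1 x hx
    exact (HasACDerivOn.mul_const hg c).isAC
  · obtain ⟨hac, hdiff, hac'⟩ := hΨ.2 t ht
    exact ⟨hac.mul_const c, fun x hx => (hdiff x hx).mul_const c,
      (hac'.mul_const c).congr fun x _ => (deriv_mul_const_field c).symm⟩

theorem SolvesSchroedinger.congr (hΨ : SolvesSchroedinger T V Ψ)
    (h : ∀ t ∈ timeInterval T, ∀ x, x ≠ 0 → Ψ t x = Φ t x) : SolvesSchroedinger T V Φ := by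
  refine hΨ.mono fun r hr ht hx => ?_
  have htime : deriv (fun t => Ψ t r.2) r.1 = deriv (fun t => Φ t r.2) r.1 :=
    EventuallyEq.deriv_eq <|
      eventually_of_mem ((isOpen_timeInterval T).mem_nhds ht) fun s hs => h s hs r.2 hx
  have hspace : deriv (deriv (Ψ r.1)) r.2 = deriv (deriv (Φ r.1)) r.2 :=
    deriv_eq_of_forall_ne_zero (fun x => deriv_eq_of_forall_ne_zero (h r.1 ht)) hx
  rw [← htime, ← hspace, ← h r.1 ht r.2 hx]
  exact hr ht hx

theorem SolvesSchroedinger.mul_const (hΨ : SolvesSchroedinger T V Ψ) (c : ℂ) :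
    SolvesSchroedinger T V fun t x => Ψ t x * c := by
  refine hΨ.mono fun r hr ht hx => ?_
  have hspace : (deriv fun x => Ψ r.1 x * c) = fun x => deriv (Ψ r.1) x * c :=
    funext fun x => deriv_mul_const_field c
  rw [hspace, deriv_mul_const_field, deriv_mul_const_field, ← mul_assoc, hr ht hx]
  ring

theorem SatisfiesTransmission.congr {M N : Matrix (Fin 2) (Fin 2) ℂ}
    (hf : SatisfiesTransmission M N f) (h : ∀ x, x ≠ 0 → f x = g x) :
    SatisfiesTransmission M N g := by
  have hfg : f =ᶠ[𝓝[≠] 0] g := eventually_of_mem self_mem_nhdsWithin h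
  have hderiv : deriv f =ᶠ[𝓝[≠] 0] deriv g :=
    eventually_of_mem self_mem_nhdsWithin fun x => deriv_eq_of_forall_ne_zero h
  have hpos : 𝓝[>] (0 : ℝ) ≤ 𝓝[≠] 0 := nhdsWithin_mono _ fun x hx => ne_of_gt hx
  have hneg : 𝓝[<] (0 : ℝ) ≤ 𝓝[≠] 0 := nhdsWithin_mono _ fun x hx => ne_of_lt hx
  refine ⟨fun hN hM => ?_, fun hN => ?_⟩
  · obtain ⟨up, um, hup, hum, hMu⟩ := hf.1 hN hM
    exact ⟨up, um, hup.congr' (hfg.filter_mono hpos), hum.congr' (hfg.filter_mono hneg), hMu⟩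
  · obtain ⟨up, um, dp, dm, hup, hum, hdp, hdm, hMN⟩ := hf.2 hN
    exact ⟨up, um, dp, dm, hup.congr' (hfg.filter_mono hpos), hum.congr' (hfg.filter_mono hneg),
      hdp.congr' (hderiv.filter_mono hpos), hdm.congr' (hderiv.filter_mono hneg), hMN⟩

end Congruence

section Majorant

/-- A continuous weight on the line bounded by `C exp(D |y|^q - ε y²)`. -/
structure IsWeight (q C D ε : ℝ) (w : ℝ → ℂ) : Prop where
  continuous : Continuous w
  gauss_nonneg : 0 ≤ ε
  bound : ∀ y, ‖w y‖ ≤ C * Real.exp (D * |y| ^ q - ε * y ^ 2)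

theorem IsWeight.const_nonneg {q C D ε : ℝ} {w : ℝ → ℂ} (hw : IsWeight q C D ε w) : 0 ≤ C :=
  nonneg_of_mul_nonneg_left ((norm_nonneg _).trans (hw.bound 0)) (Real.exp_pos _)

theorem norm_exp_mul_I_mul (θ y : ℝ) : ‖Complex.exp (θ * Complex.I) * y‖ = |y| := by
  rw [norm_mul, Complex.norm_exp_ofReal_mul_I, one_mul, Complex.norm_real, Real.norm_eq_abs]

theorem norm_phase_ray_le {θ a₀ a₁ X a x : ℝ} (hθ0 : 0 ≤ θ) (hθ : θ ≤ Real.pi / 2) (ha0 : 0 ≤ a₀)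
    (h0 : a₀ ≤ a) (h1 : a ≤ a₁) (hx : |x| ≤ X) (y : ℝ) :
    ‖phase a x (Complex.exp (θ * Complex.I) * y)‖ ≤
      Real.exp (2 * a₁ * X * |y| - a₀ * Real.sin (2 * θ) * y ^ 2) := by
  have ha : 0 ≤ a := ha0.trans h0
  have hs : 0 ≤ Real.sin θ := Real.sin_nonneg_of_nonneg_of_le_pi hθ0 (by linarith [Real.pi_pos])
  have hc : 0 ≤ Real.cos θ := Real.cos_nonneg_of_mem_Icc ⟨by linarith [Real.pi_pos], hθ⟩
  have hquad : a₀ * (Real.sin θ * Real.cos θ * y ^ 2) ≤ a * (Real.sin θ * Real.cos θ * y ^ 2) := by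
    gcongr
  have hlin : a * (x * y * Real.sin θ) ≤ a₁ * (X * |y|) := by
    have habs : x * y * Real.sin θ ≤ |x| * |y| := by
      rw [← abs_mul, ← mul_one |x * y|]
      exact mul_le_mul (le_abs_self _) (Real.sin_le_one θ) hs (abs_nonneg _)
    calc a * (x * y * Real.sin θ) ≤ a * (|x| * |y|) := by gcongr
      _ ≤ a₁ * (X * |y|) := by gcongr; exact ha.trans h1
  rw [norm_phase, Real.exp_le_exp, Complex.re_mul_ofReal, Complex.im_mul_ofReal,
    Complex.exp_ofReal_mul_I_re, Complex.exp_ofReal_mul_I_im, Real.sin_two_mul]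
  nlinarith

theorem exists_norm_mul_weight_le {p q C D ε θ a₀ : ℝ} {w : ℝ → ℂ} (hp0 : 0 < p) (hp2 : p < 2)
    (hq0 : 0 < q) (hq2 : q < 2) (hw : IsWeight q C D ε w) (hθ0 : 0 ≤ θ) (hθ : θ ≤ Real.pi / 4)
    (hε : 0 < ε + Real.sin (2 * θ)) (ha₀ : 0 < a₀) (a₁ X B' : ℝ) :
    ∃ K : ℝ, 0 ≤ K ∧ ∀ a x y c : ℝ, ∀ u z : ℂ, a₀ ≤ a → a ≤ a₁ → |x| ≤ X → 0 ≤ c →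
      z = Complex.exp (θ * Complex.I) * y →
      ‖u‖ ≤ c * (Real.exp (B' * ‖z‖ ^ p) * Real.exp (2 * ‖z‖) * ‖phase a x z‖) →
      ‖u * w y‖ ≤ c * (K * Real.exp (-|y|)) := by
  have hs : 0 ≤ Real.sin (2 * θ) :=
    Real.sin_nonneg_of_nonneg_of_le_pi (by linarith) (by linarith [Real.pi_pos])
  have hm : 0 < a₀ * Real.sin (2 * θ) + ε := by
    rcases hs.eq_or_lt with h | h
    · rw [← h] at hε ⊢
      linarith
    · linarith [mul_pos ha₀ h, hw.gauss_nonneg]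
  obtain ⟨K, hK⟩ := exists_rpow_add_rpow_sub_sq_le hp0 hp2 hq0 hq2 B' D 0 (2 + 2 * a₁ * X) hm
  have hC := hw.const_nonneg
  refine ⟨C * Real.exp K, by positivity, fun a x y c u z h0 h1 hx hc hz hu => ?_⟩
  have hexp := hK |y| |y| (abs_nonneg y) (abs_nonneg y) (by simp)
  rw [sq_abs] at hexp
  subst hz
  rw [norm_exp_mul_I_mul] at hu
  calc ‖u * w y‖ ≤ c * (Real.exp (B' * |y| ^ p) * Real.exp (2 * |y|) *
        Real.exp (2 * a₁ * X * |y| - a₀ * Real.sin (2 * θ) * y ^ 2)) *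
        (C * Real.exp (D * |y| ^ q - ε * y ^ 2)) := by
        refine norm_mul_le_of_le (hu.trans ?_) (hw.bound y)
        gcongr
        exact norm_phase_ray_le hθ0 (by linarith [Real.pi_pos]) ha₀.le h0 h1 hx y
    _ = c * (C * Real.exp (B' * |y| ^ p + D * |y| ^ q + (2 + 2 * a₁ * X) * |y| -
        (a₀ * Real.sin (2 * θ) + ε) * y ^ 2)) := by
        rw [mul_assoc c, mul_left_comm _ C, ← Real.exp_add, ← Real.exp_add, ← Real.exp_add]
        congr 3
        ring
    _ ≤ c * (C * Real.exp (K - |y|)) := by gcongr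
    _ = _ := by rw [sub_eq_add_neg, Real.exp_add, mul_assoc]

end Majorant

namespace IsSectorKernel

variable {T : EReal} {β : ℝ} {G : ℝ → ℝ → ℂ → ℂ} {a : ℝ → ℝ} {p : ℝ} {A B : Fin 3 → ℝ → ℝ → ℝ}
  {q C D ε θ : ℝ} {w : ℝ → ℂ}

section WeightedBounds

variable (hG : IsSectorKernel T β G a p A B) (hq0 : 0 < q) (hq2 : q < 2)
  (hw : IsWeight q C D ε w) (hθ : θ ∈ Icc 0 β) (hε : 0 < ε + Real.sin (2 * θ))
  {A' a₀ a₁ : ℝ} (B' X : ℝ) (hA' : 0 ≤ A') (ha₀ : 0 < a₀)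
include hG hq0 hq2 hw hθ hε hA' ha₀

theorem exists_weighted_bound (a₁ : ℝ) :
    ∃ K : ℝ, 0 ≤ K ∧ ∀ t ∈ timeInterval T, ∀ x : ℝ, x ≠ 0 → a₀ ≤ a t → a t ≤ a₁ → |x| ≤ X →
      A 0 t x ≤ A' → B 0 t x ≤ B' → ∀ y : ℝ, y ≠ 0 →
        ‖G t x (Complex.exp (θ * Complex.I) * y) * w y‖ ≤ K * Real.exp (-|y|) := by
  obtain ⟨K, hK0, hK⟩ := exists_norm_mul_weight_le hG.p_pos hG.p_lt hq0 hq2 hw hθ.1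
    (hθ.2.trans hG.angle_le) hε ha₀ a₁ X B'
  refine ⟨A' * K, by positivity, fun t ht x hx h0 h1 hxX hA hB y hy => ?_⟩
  rw [mul_assoc]
  refine hK _ x y A' _ _ h0 h1 hxX hA' rfl ((hG.norm_le ht hx
    (exp_mul_real_mem_doubleSector hG.angle_lt hθ hy) hA hB).trans ?_)
  gcongr
  exact le_mul_of_one_le_right (Real.exp_pos _).le (Real.one_le_exp (by positivity))

theorem exists_weighted_bound_deriv_space (ha₁ : 0 ≤ a₁) :
    ∃ K : ℝ, 0 ≤ K ∧ ∀ t ∈ timeInterval T, ∀ x : ℝ, x ≠ 0 → a₀ ≤ a t → a t ≤ a₁ → |x| ≤ X →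
      A 0 t x ≤ A' → B 0 t x ≤ B' → A 1 t x ≤ A' → B 1 t x ≤ B' → ∀ y : ℝ, y ≠ 0 →
        ‖deriv (fun x => G t x (Complex.exp (θ * Complex.I) * y)) x * w y‖
          ≤ K * Real.exp (-|y|) := by
  obtain ⟨K, hK0, hK⟩ := exists_norm_mul_weight_le hG.p_pos hG.p_lt hq0 hq2 hw hθ.1
    (hθ.2.trans hG.angle_le) hε ha₀ a₁ X B'
  refine ⟨A' * (2 * a₁ * Real.exp X + 1) * K, by positivity,
    fun t ht x hx h0 h1 hxX hA hB hA1 hB1 y hy => ?_⟩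
  rw [mul_assoc]
  exact hK _ x y _ _ _ h0 h1 hxX (by positivity) rfl (hG.norm_deriv_space_le ht hx
    (exp_mul_real_mem_doubleSector hG.angle_lt hθ hy) hA hB hA1 hB1 hxX h1)

theorem exists_weighted_bound_deriv_deriv_space (ha₁ : 0 ≤ a₁) :
    ∃ K : ℝ, 0 ≤ K ∧ ∀ t ∈ timeInterval T, ∀ x : ℝ, x ≠ 0 → a₀ ≤ a t → a t ≤ a₁ → |x| ≤ X →
      (∀ j, A j t x ≤ A') → (∀ j, B j t x ≤ B') → ∀ y : ℝ, y ≠ 0 →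
        ‖deriv (deriv fun x => G t x (Complex.exp (θ * Complex.I) * y)) x * w y‖
          ≤ K * Real.exp (-|y|) := by
  obtain ⟨K, hK0, hK⟩ := exists_norm_mul_weight_le hG.p_pos hG.p_lt hq0 hq2 hw hθ.1
    (hθ.2.trans hG.angle_le) hε ha₀ a₁ X B'
  refine ⟨A' * ((2 * a₁ * Real.exp X + 1) ^ 2 + 2 * a₁) * K, by positivity,
    fun t ht x hx h0 h1 hxX hA hB y hy => ?_⟩
  rw [mul_assoc]
  exact hK _ x y _ _ _ h0 h1 hxX (by positivity) rfl (hG.norm_deriv_deriv_space_le ht hx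
    (exp_mul_real_mem_doubleSector hG.angle_lt hθ hy) hA hB hxX h1)

theorem exists_weighted_bound_deriv_time (a₁ : ℝ) :
    ∃ K : ℝ, 0 ≤ K ∧ ∀ t ∈ timeInterval T, ∀ x : ℝ, x ≠ 0 → a₀ ≤ a t → a t ≤ a₁ → |x| ≤ X →
      (∀ j, A j t x ≤ A') → (∀ j, B j t x ≤ B') → DifferentiableAt ℝ a t → ∀ y : ℝ, y ≠ 0 →
        ‖deriv (fun t => G t x (Complex.exp (θ * Complex.I) * y)) t * w y‖
          ≤ (|deriv a t| + 1) * (K * Real.exp (-|y|)) := by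
  obtain ⟨K, hK0, hK⟩ := exists_norm_mul_weight_le hG.p_pos hG.p_lt hq0 hq2 hw hθ.1
    (hθ.2.trans hG.angle_le) hε ha₀ a₁ X B'
  refine ⟨A' * Real.exp X ^ 2 * K, by positivity,
    fun t ht x hx h0 h1 hxX hA hB had y hy => ?_⟩
  rw [mul_assoc _ K, ← mul_assoc]
  refine hK _ x y _ _ _ h0 h1 hxX (by positivity) rfl ?_
  rw [mul_assoc (|deriv a t| + 1)]
  exact hG.norm_deriv_time_le ht hx (exp_mul_real_mem_doubleSector hG.angle_lt hθ hy) hA hB hxX had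

end WeightedBounds

theorem continuousOn_a (hG : IsSectorKernel T β G a p A B) : ContinuousOn a (timeInterval T) :=
  hG.a_ac.continuousOn (isOpen_timeInterval T) (ordConnected_timeInterval T)

theorem exists_bounds_on_compact (hG : IsSectorKernel T β G a p A B) {Q : Set (ℝ × ℝ)}
    (hQ : IsCompact Q) (hQs : Q ⊆ timeInterval T ×ˢ {0}ᶜ) :
    ∃ A' a₀ : ℝ, 0 ≤ A' ∧ 0 < a₀ ∧ ∀ t x : ℝ, (t, x) ∈ Q →
      (∀ j, A j t x ≤ A') ∧ (∀ j, B j t x ≤ A') ∧ |x| ≤ A' ∧ a₀ ≤ a t ∧ a t ≤ A' := by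
  have hac : ContinuousOn (fun r : ℝ × ℝ => a r.1) Q :=
    hG.continuousOn_a.comp continuous_fst.continuousOn fun r hr => (hQs hr).1
  -- All quantities are bounded at once through the sup norm of the tuple they form.
  obtain ⟨c, hc⟩ := hQ.exists_bound_of_continuousOn
    (((continuousOn_pi.2 fun j => (hG.A_cont j).mono hQs).prodMk
      (continuousOn_pi.2 fun j => (hG.B_cont j).mono hQs)).prodMk
      (continuous_snd.continuousOn.prodMk
        (hac.prodMk (hac.inv₀ fun r hr => (hG.a_pos r.1 (hQs hr).1).ne'))))
  simp only [norm_prod_le_iff, pi_norm_le_iff_of_nonempty, Function.uncurry] at hc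
  refine ⟨|c|, (|c| + 1)⁻¹, abs_nonneg c, by positivity, fun t x hr => ?_⟩
  obtain ⟨⟨hA, hB⟩, hx, ha, hinv⟩ := hc (t, x) hr
  have hle := le_abs_self c
  refine ⟨fun j => ((le_abs_self _).trans (hA j)).trans hle,
    fun j => ((le_abs_self _).trans (hB j)).trans hle, hx.trans hle, ?_,
    ((le_abs_self _).trans ha).trans hle⟩
  rw [inv_le_comm₀ (by positivity) (hG.a_pos t (hQs hr).1)]
  have hinv' : (a t)⁻¹ ≤ c := (le_abs_self _).trans hinv
  linarith

end IsSectorKernel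

open Classical in
/-- The kernel `G(t,x,e^{iθ} y) w(y)` along a rotated line. The extension by zero makes it jointly
measurable in all three variables. -/
def weightedKernel (T : EReal) (θ : ℝ) (G : ℝ → ℝ → ℂ → ℂ) (w : ℝ → ℂ) (t x y : ℝ) : ℂ :=
  if t ∈ timeInterval T ∧ x ≠ 0 ∧ y ≠ 0 then G t x (Complex.exp (θ * Complex.I) * y) * w y else 0

section WeightedKernel

variable {T : EReal} {θ : ℝ} {G : ℝ → ℝ → ℂ → ℂ} {w : ℝ → ℂ} {t x y : ℝ}

theorem weightedKernel_apply (ht : t ∈ timeInterval T) (hx : x ≠ 0) (hy : y ≠ 0) :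
    weightedKernel T θ G w t x y = G t x (Complex.exp (θ * Complex.I) * y) * w y :=
  if_pos ⟨ht, hx, hy⟩

theorem weightedKernel_eq_zero (h : t ∉ timeInterval T ∨ x = 0 ∨ y = 0) :
    weightedKernel T θ G w t x y = 0 :=
  if_neg (by tauto)

theorem weightedKernel_zero : weightedKernel T θ G w t x 0 = 0 :=
  weightedKernel_eq_zero (Or.inr (Or.inr rfl))

theorem weightedKernel_ae_eq (ht : t ∈ timeInterval T) (hx : x ≠ 0) :
    weightedKernel T θ G w t x =ᵐ[volume]
      fun y : ℝ => G t x (Complex.exp (θ * Complex.I) * y) * w y := by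
  filter_upwards [Measure.ae_ne volume (0 : ℝ)] with y hy
    using weightedKernel_apply ht hx hy

theorem deriv_weightedKernel_time (ht : t ∈ timeInterval T) (hx : x ≠ 0) (hy : y ≠ 0) :
    deriv (fun t => weightedKernel T θ G w t x y) t =
      deriv (fun t => G t x (Complex.exp (θ * Complex.I) * y)) t * w y := by
  rw [← deriv_mul_const_field]
  exact EventuallyEq.deriv_eq <| eventually_of_mem ((isOpen_timeInterval T).mem_nhds ht)
    fun s hs => weightedKernel_apply hs hx hy

theorem deriv_weightedKernel_space (ht : t ∈ timeInterval T) (hx : x ≠ 0) (hy : y ≠ 0) :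
    deriv (fun x => weightedKernel T θ G w t x y) x =
      deriv (fun x => G t x (Complex.exp (θ * Complex.I) * y)) x * w y := by
  rw [← deriv_mul_const_field]
  exact deriv_eq_of_forall_ne_zero (fun s hs => weightedKernel_apply ht hs hy) hx

theorem deriv_deriv_weightedKernel_space (ht : t ∈ timeInterval T) (hx : x ≠ 0) (hy : y ≠ 0) :
    deriv (deriv fun x => weightedKernel T θ G w t x y) x =
      deriv (deriv fun x => G t x (Complex.exp (θ * Complex.I) * y)) x * w y := by
  rw [← deriv_mul_const_field]
  exact deriv_eq_of_forall_ne_zero (fun s hs => deriv_weightedKernel_space ht hs hy) hx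

end WeightedKernel

theorem isAC_zero (I : Set ℝ) : IsAC I fun _ => (0 : ℂ) :=
  ⟨fun _ => 0, (locallyIntegrable_const 0).locallyIntegrableOn I, by simp⟩

theorem isAC12_zero (T : EReal) : IsAC12 T fun _ _ => 0 :=
  ⟨fun _ _ => isAC_zero _, fun _ _ => ⟨⟨isAC_zero _, isAC_zero _⟩,
    fun _ _ => differentiableAt_const _, by simp [IsACPunctured, isAC_zero]⟩⟩

namespace IsSectorKernel

variable {T : EReal} {β : ℝ} {G : ℝ → ℝ → ℂ → ℂ} {a : ℝ → ℝ} {p : ℝ} {A B : Fin 3 → ℝ → ℝ → ℝ}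
  {q C D ε θ t x : ℝ} {w : ℝ → ℂ}

theorem isAC12_weightedKernel (hG : IsSectorKernel T β G a p A B) (hθ : θ ∈ Icc 0 β) (y : ℝ) :
    IsAC12 T fun t x => weightedKernel T θ G w t x y := by
  rcases eq_or_ne y 0 with rfl | hy
  · simp only [weightedKernel_zero]
    exact isAC12_zero T
  · exact ((hG.ac12 _ (exp_mul_real_mem_doubleSector hG.angle_lt hθ hy)).mul_const (w y)).congr
      fun t ht x hx => (weightedKernel_apply ht hx hy).symm

theorem solvesSchroedinger_weightedKernel (hG : IsSectorKernel T β G a p A B) (hθ : θ ∈ Icc 0 β)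
    {V : ℝ → ℝ → ℂ} (hV : ∀ z ∈ doubleSector β, SolvesSchroedinger T V fun t x => G t x z)
    (y : ℝ) : SolvesSchroedinger T V fun t x => weightedKernel T θ G w t x y := by
  rcases eq_or_ne y 0 with rfl | hy
  · simp only [weightedKernel_zero]
    exact Eventually.of_forall fun p _ _ => by simp
  · exact ((hV _ (exp_mul_real_mem_doubleSector hG.angle_lt hθ hy)).mul_const (w y)).congr
      fun t ht x hx => (weightedKernel_apply ht hx hy).symm

theorem continuousOn_weightedKernel (hG : IsSectorKernel T β G a p A B) (hθ : θ ∈ Icc 0 β)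
    (hw : Continuous w) (ht : t ∈ timeInterval T) (hx : x ≠ 0) :
    ContinuousOn (weightedKernel T θ G w t x) {0}ᶜ := by
  have hray : ContinuousOn (fun y : ℝ => G t x (Complex.exp (θ * Complex.I) * y)) {0}ᶜ :=
    (hG.cont t ht x hx).comp (by fun_prop) fun y hy =>
      exp_mul_real_mem_doubleSector hG.angle_lt hθ hy
  exact (hray.mul hw.continuousOn).congr fun y hy => weightedKernel_apply ht hx hy

section Domination

variable (hG : IsSectorKernel T β G a p A B) (hq0 : 0 < q) (hq2 : q < 2)
  (hw : IsWeight q C D ε w) (hθ : θ ∈ Icc 0 β) (hε : 0 < ε + Real.sin (2 * θ))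
include hG hq0 hq2 hw hθ hε

theorem exists_norm_weightedKernel_le (ht : t ∈ timeInterval T) {S : Set ℝ} (hS : IsCompact S)
    (hS0 : S ⊆ {0}ᶜ) :
    ∃ K : ℝ, 0 ≤ K ∧ ∀ x ∈ S, ∀ y, ‖weightedKernel T θ G w t x y‖ ≤ K * Real.exp (-|y|) := by
  obtain ⟨A', a₀, hA', ha₀, hb⟩ := hG.exists_bounds_on_compact (Q := {t} ×ˢ S)
    (isCompact_singleton.prod hS) (prod_mono (by simpa using ht) hS0)
  obtain ⟨K, hK0, hK⟩ := hG.exists_weighted_bound hq0 hq2 hw hθ hε A' A' hA' ha₀ A'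
  refine ⟨K, hK0, fun x hx y => ?_⟩
  rcases eq_or_ne y 0 with rfl | hy
  · rw [weightedKernel_zero, norm_zero]
    positivity
  · obtain ⟨hA, hB, hxA, ha, ha'⟩ := hb t x ⟨rfl, hx⟩
    rw [weightedKernel_apply ht (hS0 hx) hy]
    exact hK t ht x (hS0 hx) ha ha' hxA (hA 0) (hB 0) y hy

theorem integrable_weightedKernel (ht : t ∈ timeInterval T) (hx : x ≠ 0) :
    Integrable (weightedKernel T θ G w t x) := by
  obtain ⟨K, -, hK⟩ := hG.exists_norm_weightedKernel_le hq0 hq2 hw hθ hε ht (S := {x})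
    isCompact_singleton (by simpa using hx.symm)
  have hm := measurable_of_continuousOn_compl_singleton 0
    (hG.continuousOn_weightedKernel hθ hw.continuous ht hx)
  exact (integrable_exp_neg_abs.const_mul K).mono' hm.aestronglyMeasurable
    (Eventually.of_forall (hK x rfl))

theorem exists_norm_deriv_weightedKernel_time_le (hx : x ≠ 0) {c d : ℝ}
    (hcd : Icc c d ⊆ timeInterval T) :
    ∃ K : ℝ, ∀ᵐ s, s ∈ Icc c d → ∀ y, ‖deriv (fun t => weightedKernel T θ G w t x y) s‖
      ≤ (|deriv a s| + 1) * (K * Real.exp (-|y|)) := by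
  obtain ⟨A', a₀, hA', ha₀, hb⟩ := hG.exists_bounds_on_compact (Q := Icc c d ×ˢ {x})
    (isCompact_Icc.prod isCompact_singleton) (prod_mono hcd (by simpa using hx.symm))
  obtain ⟨K, hK0, hK⟩ := hG.exists_weighted_bound_deriv_time hq0 hq2 hw hθ hε A' A' hA' ha₀ A'
  refine ⟨K, ?_⟩
  filter_upwards [hG.a_ac.ae_differentiableAt (isOpen_timeInterval T)
    (ordConnected_timeInterval T)] with s hs hsI y
  rcases eq_or_ne y 0 with rfl | hy
  · simp only [weightedKernel_zero, deriv_const', norm_zero]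
    positivity
  · obtain ⟨hA, hB, hxA, ha, ha'⟩ := hb s x ⟨hsI, rfl⟩
    rw [deriv_weightedKernel_time (hcd hsI) hx hy]
    exact hK s (hcd hsI) x hx ha ha' hxA hA hB (hs (hcd hsI)) y hy

theorem exists_norm_deriv_weightedKernel_space_le (ht : t ∈ timeInterval T) {S : Set ℝ}
    (hS : IsCompact S) (hS0 : S ⊆ {0}ᶜ) :
    ∃ K : ℝ, ∀ x ∈ S, ∀ y,
      ‖deriv (fun x => weightedKernel T θ G w t x y) x‖ ≤ K * Real.exp (-|y|) ∧
      ‖deriv (deriv fun x => weightedKernel T θ G w t x y) x‖ ≤ K * Real.exp (-|y|) := by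
  obtain ⟨A', a₀, hA', ha₀, hb⟩ := hG.exists_bounds_on_compact (Q := {t} ×ˢ S)
    (isCompact_singleton.prod hS) (prod_mono (by simpa using ht) hS0)
  obtain ⟨K₁, hK₁0, hK₁⟩ :=
    hG.exists_weighted_bound_deriv_space hq0 hq2 hw hθ hε A' A' hA' ha₀ hA'
  obtain ⟨K₂, -, hK₂⟩ :=
    hG.exists_weighted_bound_deriv_deriv_space hq0 hq2 hw hθ hε A' A' hA' ha₀ hA'
  refine ⟨max K₁ K₂, fun x hx y => ?_⟩
  rcases eq_or_ne y 0 with rfl | hy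
  · simp only [weightedKernel_zero, deriv_const', norm_zero, and_self]
    positivity
  · obtain ⟨hA, hB, hxA, ha, ha'⟩ := hb t x ⟨rfl, hx⟩
    rw [deriv_weightedKernel_space ht (hS0 hx) hy, deriv_deriv_weightedKernel_space ht (hS0 hx) hy]
    constructor
    · refine (hK₁ t ht x (hS0 hx) ha ha' hxA (hA 0) (hB 0) (hA 1) (hB 1) y hy).trans ?_
      gcongr
      exact le_max_left _ _
    · refine (hK₂ t ht x (hS0 hx) ha ha' hxA hA hB y hy).trans ?_
      gcongr
      exact le_max_right _ _

theorem isDominatedFamily : IsDominatedFamily T (weightedKernel T θ G w) where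
  zero t x y h := weightedKernel_eq_zero h
  ac12 := hG.isAC12_weightedKernel hθ
  cont t ht x hx := hG.continuousOn_weightedKernel hθ hw.continuous ht hx
  integrable t ht x hx := hG.integrable_weightedKernel hq0 hq2 hw hθ hε ht hx
  bound_time x hx c hc d hd _ := by
    have hsub : Icc c d ⊆ timeInterval T := (ordConnected_timeInterval T).out hc hd
    obtain ⟨K, hK⟩ := hG.exists_norm_deriv_weightedKernel_time_le hq0 hq2 hw hθ hε hx hsub
    have hda : IntegrableOn (deriv a) (Icc c d) :=
      ((hG.a_ac.hasACDerivOn_deriv (isOpen_timeInterval T)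
        (ordConnected_timeInterval T)).1).integrableOn_compact_subset hsub isCompact_Icc
    exact ⟨fun s => |deriv a s| + 1, fun y => K * Real.exp (-|y|),
      hda.abs.add (integrableOn_const (by simp)), integrable_exp_neg_abs.const_mul K, hK⟩
  bound_space t ht c d _ h0 := by
    obtain ⟨K, hK⟩ := hG.exists_norm_deriv_weightedKernel_space_le hq0 hq2 hw hθ hε ht
      isCompact_Icc (subset_compl_singleton_iff.2 h0)
    exact ⟨fun y => K * Real.exp (-|y|), integrable_exp_neg_abs.const_mul K, hK⟩

end Domination

end IsSectorKernel

section Damping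

/-- The damped function `exp(-ε z²) F(z)`. -/
def damped (ε : ℝ) (F : ℂ → ℂ) (z : ℂ) : ℂ := Complex.exp (-(ε * z ^ 2)) * F z

theorem damped_zero (F : ℂ → ℂ) : damped 0 F = F := by
  funext z
  simp [damped]

theorem norm_damped (ε : ℝ) (F : ℂ → ℂ) (z : ℂ) :
    ‖damped ε F z‖ = Real.exp (-(ε * (z ^ 2).re)) * ‖F z‖ := by
  rw [damped, norm_mul, Complex.norm_exp, Complex.neg_re, Complex.re_ofReal_mul]

theorem differentiable_damped {F : ℂ → ℂ} (hF : Differentiable ℂ F) (ε : ℝ) :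
    Differentiable ℂ (damped ε F) :=
  (((differentiable_id.pow 2).const_mul (ε : ℂ)).neg.cexp).mul hF

theorem norm_damped_le_norm {ε : ℝ} (hε : 0 ≤ ε) (F : ℂ → ℂ) {z : ℂ} (hz : 0 ≤ (z ^ 2).re) :
    ‖damped ε F z‖ ≤ ‖F z‖ := by
  rw [norm_damped]
  exact mul_le_of_le_one_left (norm_nonneg _)
    (Real.exp_le_one_iff.2 (neg_nonpos.2 (mul_nonneg hε hz)))

theorem tendsto_damped (F : ℂ → ℂ) (z : ℂ) :
    Tendsto (fun ε : ℝ => damped ε F z) (𝓝[>] 0) (𝓝 (F z)) := by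
  have h : Continuous fun ε : ℝ => damped ε F z := by
    unfold damped
    fun_prop
  simpa only [damped_zero] using (h.tendsto 0).mono_left nhdsWithin_le_nhds

/-- An entire function bounded by `C exp(D ‖z‖^q)`: the growth condition of `𝒜_q(ℂ)` with explicit
constants. -/
structure HasExpGrowth (q C D : ℝ) (F : ℂ → ℂ) : Prop where
  differentiable : Differentiable ℂ F
  bound : ∀ z, ‖F z‖ ≤ C * Real.exp (D * ‖z‖ ^ q)

theorem HasExpGrowth.const_nonneg {q C D : ℝ} {F : ℂ → ℂ} (hF : HasExpGrowth q C D F) : 0 ≤ C :=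
  nonneg_of_mul_nonneg_left ((norm_nonneg _).trans (hF.bound 0)) (Real.exp_pos _)

theorem HasExpGrowth.norm_damped_le {q C D : ℝ} {F : ℂ → ℂ} (hF : HasExpGrowth q C D F) {ε : ℝ}
    (hε : 0 ≤ ε) {z : ℂ} (hz : 0 ≤ (z ^ 2).re) :
    ‖damped ε F z‖ ≤ C * Real.exp (D * ‖z‖ ^ q) :=
  (norm_damped_le_norm hε F hz).trans (hF.bound z)

theorem re_sq_exp_mul (θ y : ℝ) :
    ((Complex.exp (θ * Complex.I) * y) ^ 2).re = Real.cos (2 * θ) * y ^ 2 := by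
  have h : (Complex.exp (θ * Complex.I) * y) ^ 2 =
      Complex.exp ((2 * θ : ℝ) * Complex.I) * ((y ^ 2 : ℝ) : ℂ) := by
    rw [mul_pow, ← Complex.exp_nat_mul]
    push_cast
    ring_nf
  rw [h, Complex.re_mul_ofReal, Complex.exp_ofReal_mul_I_re]

theorem re_sq_exp_mul_nonneg {θ : ℝ} (hθ0 : 0 ≤ θ) (hθ : θ ≤ Real.pi / 4) (y : ℝ) :
    0 ≤ ((Complex.exp (θ * Complex.I) * y) ^ 2).re := by
  rw [re_sq_exp_mul]
  exact mul_nonneg (Real.cos_nonneg_of_mem_Icc ⟨by linarith [Real.pi_pos], by linarith⟩)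
    (sq_nonneg y)

/-- The weight `e^{iθ} exp(-ε z²) F(z)` at the point `z = e^{iθ} y` of a rotated line; the factor
`e^{iθ}` is the Jacobian of the rotation. -/
def rayWeight (θ ε : ℝ) (F : ℂ → ℂ) (y : ℝ) : ℂ :=
  Complex.exp (θ * Complex.I) * damped ε F (Complex.exp (θ * Complex.I) * y)

theorem rayWeight_zero_angle (ε : ℝ) (F : ℂ → ℂ) (y : ℝ) : rayWeight 0 ε F y = damped ε F y := by
  simp [rayWeight]

theorem norm_rayWeight (θ ε : ℝ) (F : ℂ → ℂ) (y : ℝ) :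
    ‖rayWeight θ ε F y‖ = ‖damped ε F (Complex.exp (θ * Complex.I) * y)‖ := by
  rw [rayWeight, norm_mul, Complex.norm_exp_ofReal_mul_I, one_mul]

theorem continuous_rayWeight {F : ℂ → ℂ} (hF : Differentiable ℂ F) (θ ε : ℝ) :
    Continuous (rayWeight θ ε F) :=
  continuous_const.mul ((differentiable_damped hF ε).continuous.comp (by fun_prop))

theorem HasExpGrowth.isWeight_ray {q C D : ℝ} {F : ℂ → ℂ} (hF : HasExpGrowth q C D F) {θ ε : ℝ}
    (hθ0 : 0 ≤ θ) (hθ : θ ≤ Real.pi / 4) (hε : 0 ≤ ε) :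
    IsWeight q C D 0 (rayWeight θ ε F) where
  continuous := continuous_rayWeight hF.differentiable θ ε
  gauss_nonneg := le_rfl
  bound y := by
    rw [norm_rayWeight, zero_mul, sub_zero, ← norm_exp_mul_I_mul θ y]
    exact hF.norm_damped_le hε (re_sq_exp_mul_nonneg hθ0 hθ y)

theorem HasExpGrowth.isWeight_real {q C D : ℝ} {F : ℂ → ℂ} (hF : HasExpGrowth q C D F) {ε : ℝ}
    (hε : 0 ≤ ε) : IsWeight q C D ε (rayWeight 0 ε F) where
  continuous := continuous_rayWeight hF.differentiable 0 ε
  gauss_nonneg := hε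
  bound y := by
    have h := hF.bound (Complex.exp ((0 : ℝ) * Complex.I) * y)
    rw [norm_exp_mul_I_mul] at h
    rw [norm_rayWeight, norm_damped, re_sq_exp_mul, mul_zero, Real.cos_zero, one_mul]
    calc Real.exp (-(ε * y ^ 2)) * ‖F (Complex.exp ((0 : ℝ) * Complex.I) * y)‖
        ≤ Real.exp (-(ε * y ^ 2)) * (C * Real.exp (D * |y| ^ q)) := by gcongr
      _ = C * Real.exp (D * |y| ^ q - ε * y ^ 2) := by
          rw [mul_left_comm, ← Real.exp_add, neg_add_eq_sub]

end Damping

section Tails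

variable {T : EReal} {β : ℝ} {G : ℝ → ℝ → ℂ → ℂ} {a : ℝ → ℝ} {p : ℝ} {A B : Fin 3 → ℝ → ℝ → ℝ}
  {q C D : ℝ} {F : ℂ → ℂ} {t x : ℝ} {σ x₀ : ℝ}

theorem sign_mul_add_exp_mem (hβ : β < Real.pi / 2) (hσ : σ = 1 ∨ σ = -1)
    (hx₀ : 0 ≤ x₀) {w : ℂ} (hw : w.im ∈ Icc 0 β) :
    (σ : ℂ) * (x₀ + Complex.exp w) ∈ doubleSector β := by
  have h := add_exp_mem_doubleSector hβ hx₀ hw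
  rcases hσ with rfl | rfl
  · simpa using h
  · simpa using neg_mem_doubleSector.2 h

theorem sign_mul_add_exp_mem_interior (hβ : β < Real.pi / 2) (hσ : σ = 1 ∨ σ = -1)
    (hx₀ : 0 ≤ x₀) {w : ℂ} (hw : w.im ∈ Ioo 0 β) :
    (σ : ℂ) * (x₀ + Complex.exp w) ∈ interior (doubleSector β) := by
  have h := add_exp_mem_interior_doubleSector hβ hx₀ hw
  rcases hσ with rfl | rfl
  · simpa using h
  · simpa using neg_mem_interior_doubleSector.2 h

theorem norm_sign_mul_add_le (hσ : σ = 1 ∨ σ = -1) (hx₀ : 0 ≤ x₀) (u : ℂ) :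
    ‖(σ : ℂ) * (x₀ + u)‖ ≤ x₀ + ‖u‖ := by
  have hnorm : ‖(σ : ℂ)‖ = 1 := by rcases hσ with rfl | rfl <;> simp
  rw [norm_mul, hnorm, one_mul]
  simpa [abs_of_nonneg hx₀] using norm_add_le (x₀ : ℂ) u

theorem sign_mul_le_abs (hσ : σ = 1 ∨ σ = -1) (x : ℝ) : σ * x ≤ |x| := by
  rcases hσ with rfl | rfl
  · simpa using le_abs_self x
  · simpa using neg_le_abs x

theorem phase_exponent_sign_mul (hσ : σ = 1 ∨ σ = -1) (u : ℂ) :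
    (((σ : ℂ) * (x₀ + u)).re - x) * ((σ : ℂ) * (x₀ + u)).im = (x₀ + u.re - σ * x) * u.im := by
  rcases hσ with rfl | rfl
  · simp
  · simp only [Complex.re_ofReal_mul, Complex.im_ofReal_mul, Complex.add_re, Complex.add_im,
      Complex.ofReal_re, Complex.ofReal_im]
    ring

theorem re_sq_sign_mul (hσ : σ = 1 ∨ σ = -1) (u : ℂ) :
    (((σ : ℂ) * (x₀ + u)) ^ 2).re = (x₀ + u.re) ^ 2 - u.im ^ 2 := by
  have hsq : (σ : ℂ) ^ 2 = 1 := by rcases hσ with rfl | rfl <;> simp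
  rw [mul_pow, hsq, one_mul]
  simp [pow_two]

theorem exp_im_mem_Icc {w : ℂ} (hw : w.im ∈ Icc 0 (Real.pi / 4)) :
    (Complex.exp w).im ∈ Icc 0 (Complex.exp w).re := by
  rw [Complex.exp_im, Complex.exp_re]
  have hsin : 0 ≤ Real.sin w.im :=
    Real.sin_nonneg_of_nonneg_of_le_pi hw.1 (by linarith [hw.2, Real.pi_pos])
  have hsc : Real.sin w.im ≤ Real.cos w.im := by
    rw [← Real.cos_pi_div_two_sub]
    exact Real.cos_le_cos_of_nonneg_of_le_pi hw.1 (by linarith [Real.pi_pos, hw.1])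
      (by linarith [hw.2])
  exact ⟨by positivity, by gcongr⟩

theorem sq_sub_le_phase_add_damping {m a ε : ℝ} (hma : m ≤ a) (hmε : m ≤ ε) (hm : 0 ≤ m)
    (hσ : σ = 1 ∨ σ = -1) (hx₀ : 0 ≤ x₀) {u : ℂ} (hu : u.im ∈ Icc 0 u.re) :
    m * ‖u‖ ^ 2 - 2 * a * |x| * ‖u‖ ≤
      a * (2 * ((((σ : ℂ) * (x₀ + u)).re - x) * ((σ : ℂ) * (x₀ + u)).im)) +
        ε * (((σ : ℂ) * (x₀ + u)) ^ 2).re := by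
  rw [phase_exponent_sign_mul hσ, re_sq_sign_mul hσ]
  -- The phase controls `2 Re u Im u` and the damping `(Re u)² - (Im u)²`; for `0 ≤ Im u ≤ Re u`
  -- their sum dominates `‖u‖²`.
  have hre : 0 ≤ u.re := hu.1.trans hu.2
  have ha : 0 ≤ a := hm.trans hma
  have hε : 0 ≤ ε := hm.trans hmε
  have hnorm : ‖u‖ ^ 2 = u.re ^ 2 + u.im ^ 2 := by
    rw [Complex.sq_norm, Complex.normSq_apply]
    ring
  have hphase : m * (2 * (u.re * u.im)) ≤ a * (2 * (u.re * u.im)) :=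
    mul_le_mul_of_nonneg_right hma (mul_nonneg two_pos.le (mul_nonneg hre hu.1))
  have hdamp : m * (u.re ^ 2 - u.im ^ 2) ≤ ε * (u.re ^ 2 - u.im ^ 2) :=
    mul_le_mul_of_nonneg_right hmε (sub_nonneg.2 (pow_le_pow_left₀ hu.1 hu.2 2))
  have hcross : 0 ≤ m * (u.im * (u.re - u.im)) :=
    mul_nonneg hm (mul_nonneg hu.1 (sub_nonneg.2 hu.2))
  have hlin : a * (σ * x * u.im) ≤ a * (|x| * ‖u‖) :=
    mul_le_mul_of_nonneg_left (mul_le_mul (sign_mul_le_abs hσ x)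
      ((le_abs_self _).trans (Complex.abs_im_le_norm u)) hu.1 (abs_nonneg x)) ha
  have hx₀im : 0 ≤ a * (x₀ * u.im) := mul_nonneg ha (mul_nonneg hx₀ hu.1)
  have hx₀re : 0 ≤ ε * (x₀ ^ 2 + 2 * (x₀ * u.re)) := by positivity
  rw [hnorm]
  linarith

namespace IsSectorKernel

theorem exists_norm_mul_damped_le (hG : IsSectorKernel T β G a p A B) (hq0 : 0 < q)
    (hq2 : q < 2) (hF : HasExpGrowth q C D F) (ht : t ∈ timeInterval T) (hx : x ≠ 0)
    {ε : ℝ} (hσ : σ = 1 ∨ σ = -1) (hx₀ : 0 ≤ x₀) (hε : 0 < ε) :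
    ∃ K : ℝ, ∀ w : ℂ, w.im ∈ Icc 0 β →
      ‖G t x (σ * (x₀ + Complex.exp w)) * damped ε F (σ * (x₀ + Complex.exp w))‖ ≤
        K * Real.exp (-Real.exp w.re) := by
  have hA := (hG.nonneg 0 t ht x hx).1
  have hC := hF.const_nonneg
  have hm : 0 < min (a t) ε := lt_min (hG.a_pos t ht) hε
  obtain ⟨K, hK⟩ := exists_rpow_add_rpow_sub_sq_le hG.p_pos hG.p_lt hq0 hq2 (B 0 t x) D x₀
    (2 * a t * |x|) hm
  refine ⟨A 0 t x * C * Real.exp K, fun w hw => ?_⟩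
  have hzm := sign_mul_add_exp_mem hG.angle_lt hσ hx₀ hw
  have hnorm := norm_sign_mul_add_le hσ hx₀ (Complex.exp w)
  have hquad := sq_sub_le_phase_add_damping (x := x) (min_le_left (a t) ε) (min_le_right (a t) ε)
    hm.le hσ hx₀ (exp_im_mem_Icc ⟨hw.1, hw.2.trans hG.angle_le⟩)
  rw [Complex.norm_exp] at hnorm hquad
  generalize (σ : ℂ) * (x₀ + Complex.exp w) = z at *
  have hexp := hK _ _ (Real.exp_pos w.re).le (norm_nonneg z) hnorm
  rw [norm_mul, norm_damped]
  calc ‖G t x z‖ * (Real.exp (-(ε * (z ^ 2).re)) * ‖F z‖)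
      ≤ A 0 t x * (Real.exp (B 0 t x * ‖z‖ ^ p) * ‖phase (a t) x z‖) *
          (Real.exp (-(ε * (z ^ 2).re)) * (C * Real.exp (D * ‖z‖ ^ q))) := by
        gcongr
        · exact hG.norm_le ht hx hzm le_rfl le_rfl
        · exact hF.bound z
    _ = A 0 t x * C * Real.exp (B 0 t x * ‖z‖ ^ p + -(a t * (2 * (z.re - x) * z.im)) +
          -(ε * (z ^ 2).re) + D * ‖z‖ ^ q) := by
        rw [norm_phase, Real.exp_add, Real.exp_add, Real.exp_add]
        ring
    _ ≤ A 0 t x * C * Real.exp (K - Real.exp w.re) := by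
        gcongr
        linarith
    _ = A 0 t x * C * Real.exp K * Real.exp (-Real.exp w.re) := by
        rw [sub_eq_add_neg, Real.exp_add, ← mul_assoc]

end IsSectorKernel

/-- The integral of `G(t,x,z) exp(-ε z²) F(z)` along the ray `z = σ (x₀ + e^{iβ} s)`, `s > 0`,
where the sign `σ = ±1` distinguishes the two tails. -/
def tailIntegral (β : ℝ) (G : ℝ → ℝ → ℂ → ℂ) (F : ℂ → ℂ) (σ x₀ ε t x : ℝ) : ℂ :=
  Complex.exp (β * Complex.I) * ∫ s in Ioi (0 : ℝ),
    G t x (σ * (x₀ + Complex.exp (β * Complex.I) * s)) *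
      damped ε F (σ * (x₀ + Complex.exp (β * Complex.I) * s))

theorem IsSectorKernel.integral_Ioi_eq_tailIntegral (hG : IsSectorKernel T β G a p A B)
    (hq0 : 0 < q) (hq2 : q < 2) (hF : HasExpGrowth q C D F) (ht : t ∈ timeInterval T) (hx : x ≠ 0)
    {ε : ℝ} (hσ : σ = 1 ∨ σ = -1) (hx₀ : 0 ≤ x₀) (hε : 0 < ε) :
    ∫ y in Ioi (0 : ℝ), G t x (σ * (x₀ + y)) * damped ε F (σ * (x₀ + y)) =
      tailIntegral β G F σ x₀ ε t x := by
  obtain ⟨K, hK⟩ := hG.exists_norm_mul_damped_le hq0 hq2 hF ht hx hσ hx₀ hε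
  have hd := differentiable_damped hF.differentiable ε
  have hline : Differentiable ℂ fun w => (σ : ℂ) * (x₀ + Complex.exp w) := by fun_prop
  refine integral_Ioi_eq_integral_rotated hG.angle_pos.le
    (f := fun u => G t x (σ * (x₀ + u)) * damped ε F (σ * (x₀ + u))) ?_ ?_ hK
  · exact ((hG.cont t ht x hx).comp hline.continuous.continuousOn fun w hw =>
      sign_mul_add_exp_mem hG.angle_lt hσ hx₀ hw).mul
      (hd.continuous.comp hline.continuous).continuousOn
  · exact ((hG.holo t ht x hx).comp hline.differentiableOn fun w hw =>
      sign_mul_add_exp_mem_interior hG.angle_lt hσ hx₀ hw).mul (hd.comp hline).differentiableOn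

end Tails

theorem setIntegral_Ioi_comp_add_left (f : ℝ → ℂ) (x₀ : ℝ) :
    ∫ y in Ioi (0 : ℝ), f (x₀ + y) = ∫ y in Ioi x₀, f y := by
  have h := (measurePreserving_add_left (volume : Measure ℝ) x₀).setIntegral_preimage_emb
    (MeasurableEquiv.addLeft x₀).measurableEmbedding f (Ioi x₀)
  rwa [preimage_const_add_Ioi, sub_self] at h

theorem integral_eq_intervalIntegral_add_tails {f : ℝ → ℂ} (hf : Integrable f) (x₀ : ℝ) :
    ∫ y, f y = (∫ y in (-x₀)..x₀, f y) + (∫ y in Ioi (0 : ℝ), f (x₀ + y)) +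
      ∫ y in Ioi (0 : ℝ), f (-(x₀ + y)) := by
  rw [setIntegral_Ioi_comp_add_left f x₀, setIntegral_Ioi_comp_add_left (fun y => f (-y)) x₀,
    integral_comp_neg_Ioi,
    intervalIntegral.integral_interval_add_Ioi hf.integrableOn hf.integrableOn, add_comm,
    intervalIntegral.integral_Iic_add_Ioi hf.integrableOn hf.integrableOn]

section DampingError

variable {β ε : ℝ}

/-- An upper bound, up to a constant, for the effect of the damping factor `exp(-ε z²)` on integrals
along the line `z = e^{iβ} y`. -/
def dampingError (β ε : ℝ) : ℝ :=
  ∫ y : ℝ, ‖Complex.exp (-(ε * (Complex.exp (β * Complex.I) * y) ^ 2)) - 1‖ * Real.exp (-|y|)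

theorem norm_dampingError_integrand_le (hβ0 : 0 ≤ β) (hβ : β ≤ Real.pi / 4) (hε : 0 ≤ ε) (y : ℝ) :
    ‖‖Complex.exp (-(ε * (Complex.exp (β * Complex.I) * y) ^ 2)) - 1‖ * Real.exp (-|y|)‖ ≤
      2 * Real.exp (-|y|) := by
  rw [norm_mul, norm_norm, Real.norm_of_nonneg (Real.exp_pos _).le]
  gcongr
  refine (norm_sub_le _ _).trans ?_
  rw [Complex.norm_exp, norm_one, Complex.neg_re, Complex.re_ofReal_mul]
  have hexp := Real.exp_le_one_iff.2
    (neg_nonpos.2 (mul_nonneg hε (re_sq_exp_mul_nonneg hβ0 hβ y)))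
  linarith

theorem integrable_dampingError (hβ0 : 0 ≤ β) (hβ : β ≤ Real.pi / 4) (hε : 0 ≤ ε) :
    Integrable fun y : ℝ =>
      ‖Complex.exp (-(ε * (Complex.exp (β * Complex.I) * y) ^ 2)) - 1‖ * Real.exp (-|y|) :=
  (integrable_exp_neg_abs.const_mul 2).mono' (Continuous.aestronglyMeasurable (by fun_prop))
    (Eventually.of_forall (norm_dampingError_integrand_le hβ0 hβ hε))

theorem tendsto_dampingError (hβ0 : 0 ≤ β) (hβ : β ≤ Real.pi / 4) :
    Tendsto (dampingError β) (𝓝[>] 0) (𝓝 0) := by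
  suffices h : Tendsto (dampingError β) (𝓝[>] 0) (𝓝 (∫ _ : ℝ, (0 : ℝ))) by simpa using h
  refine tendsto_integral_filter_of_dominated_convergence (fun y => 2 * Real.exp (-|y|)) ?_ ?_
    (integrable_exp_neg_abs.const_mul 2) (Eventually.of_forall fun y => ?_)
  · exact Eventually.of_forall fun ε => Continuous.aestronglyMeasurable (by fun_prop)
  · filter_upwards [self_mem_nhdsWithin] with ε hε
    exact Eventually.of_forall (norm_dampingError_integrand_le hβ0 hβ (le_of_lt hε))
  · have h : Continuous fun ε : ℝ =>
        ‖Complex.exp (-(ε * (Complex.exp (β * Complex.I) * y) ^ 2)) - 1‖ * Real.exp (-|y|) := by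
      fun_prop
    simpa using (h.tendsto 0).mono_left (nhdsWithin_le_nhds (s := Ioi 0))

theorem norm_integral_damped_sub_le {K : ℝ} (hβ0 : 0 ≤ β) (hβ : β ≤ Real.pi / 4) (hε : 0 ≤ ε)
    {F : ℂ → ℂ} {k : ℝ → ℂ} (hi : Integrable fun y => k y * rayWeight β ε F y)
    (hi0 : Integrable fun y => k y * rayWeight β 0 F y)
    (hK : ∀ᵐ y : ℝ, ‖k y * rayWeight β 0 F y‖ ≤ K * Real.exp (-|y|)) :
    ‖(∫ y, k y * rayWeight β ε F y) - ∫ y, k y * rayWeight β 0 F y‖ ≤ K * dampingError β ε := by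
  rw [← integral_sub hi hi0, dampingError, ← integral_const_mul]
  refine norm_integral_le_of_norm_le ((integrable_dampingError hβ0 hβ hε).const_mul K) ?_
  filter_upwards [hK] with y hy
  have hfactor : k y * rayWeight β ε F y - k y * rayWeight β 0 F y =
      (Complex.exp (-(ε * (Complex.exp (β * Complex.I) * y) ^ 2)) - 1) *
        (k y * rayWeight β 0 F y) := by
    simp only [rayWeight, damped_zero]
    rw [damped]
    ring
  rw [hfactor, norm_mul, mul_left_comm]
  gcongr

end DampingError

/-- The integral `∫ G(t,x,z) exp(-ε z²) F(z) dz` along the rotated line `z = e^{iθ} y`. -/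
def rayWave (T : EReal) (θ : ℝ) (G : ℝ → ℝ → ℂ → ℂ) (F : ℂ → ℂ) (ε t x : ℝ) : ℂ :=
  ∫ y, weightedKernel T θ G (rayWeight θ ε F) t x y

theorem rayWave_eq_integral {T : EReal} {G : ℝ → ℝ → ℂ → ℂ} {t x : ℝ} (ht : t ∈ timeInterval T)
    (hx : x ≠ 0) (F : ℂ → ℂ) (θ ε : ℝ) :
    rayWave T θ G F ε t x =
      ∫ y : ℝ, G t x (Complex.exp (θ * Complex.I) * y) * rayWeight θ ε F y :=
  integral_congr_ae (weightedKernel_ae_eq ht hx)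

theorem integral_Ioi_weightedKernel_ray {T : EReal} {G : ℝ → ℝ → ℂ → ℂ} {F : ℂ → ℂ} {t x σ : ℝ}
    (ht : t ∈ timeInterval T) (hx : x ≠ 0) (hσ : σ = 1 ∨ σ = -1) (β ε : ℝ) :
    ∫ y in Ioi (0 : ℝ), weightedKernel T β G (rayWeight β ε F) t x (σ * y) =
      tailIntegral β G F σ 0 ε t x := by
  rw [tailIntegral, ← integral_const_mul]
  refine setIntegral_congr_fun measurableSet_Ioi fun y (hy : 0 < y) => ?_
  have hσy : σ * y ≠ 0 := mul_ne_zero (by rcases hσ with rfl | rfl <;> norm_num) hy.ne'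
  have hz : Complex.exp (β * Complex.I) * (σ * y : ℝ) =
      σ * ((0 : ℝ) + Complex.exp (β * Complex.I) * y) := by
    push_cast
    ring
  simp only [weightedKernel_apply ht hx hσy, rayWeight, hz]
  ring

theorem regularizedIntegrand_ae_eq {T : EReal} {G : ℝ → ℝ → ℂ → ℂ} {G₀ : ℝ → ℝ → ℝ → ℂ} {F : ℂ → ℂ}
    {t x ε : ℝ} (ht : t ∈ timeInterval T) (hx : x ≠ 0)
    (hr : ∀ y : ℝ, y ≠ 0 → G t x (y : ℂ) = G₀ t x y) :
    regularizedIntegrand G₀ F t x ε =ᵐ[volume] weightedKernel T 0 G (rayWeight 0 ε F) t x := by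
  filter_upwards [Measure.ae_ne volume (0 : ℝ)] with y hy
  rw [weightedKernel_apply ht hx hy, rayWeight_zero_angle, regularizedIntegrand, damped,
    ← hr y hy]
  simp only [Complex.ofReal_zero, zero_mul, Complex.exp_zero, one_mul]
  push_cast
  ring

namespace IsSectorKernel

variable {T : EReal} {β : ℝ} {G : ℝ → ℝ → ℂ → ℂ} {a : ℝ → ℝ} {p : ℝ} {A B : Fin 3 → ℝ → ℝ → ℝ}
  {q C D : ℝ} {F : ℂ → ℂ} {t x ε σ x₀ : ℝ}

theorem sin_two_mul_angle_pos (hG : IsSectorKernel T β G a p A B) : 0 < Real.sin (2 * β) :=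
  Real.sin_pos_of_pos_of_lt_pi (by linarith [hG.angle_pos]) (by linarith [hG.angle_le, Real.pi_pos])

section Ray

variable (hG : IsSectorKernel T β G a p A B) (hq0 : 0 < q) (hq2 : q < 2)
  (hF : HasExpGrowth q C D F)
include hG hq0 hq2 hF

theorem isDominatedFamily_ray (hε : 0 ≤ ε) :
    IsDominatedFamily T (weightedKernel T β G (rayWeight β ε F)) :=
  hG.isDominatedFamily hq0 hq2 (hF.isWeight_ray hG.angle_pos.le hG.angle_le hε)
    ⟨hG.angle_pos.le, le_rfl⟩ (by linarith [hG.sin_two_mul_angle_pos])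

theorem isDominatedFamily_real (hε : 0 < ε) :
    IsDominatedFamily T (weightedKernel T 0 G (rayWeight 0 ε F)) :=
  hG.isDominatedFamily hq0 hq2 (hF.isWeight_real hε.le) ⟨le_rfl, hG.angle_pos.le⟩
    (by simpa using hε)

theorem integral_Ioi_weightedKernel_real (ht : t ∈ timeInterval T) (hx : x ≠ 0) (hε : 0 < ε)
    (hσ : σ = 1 ∨ σ = -1) (hx₀ : 0 ≤ x₀) :
    ∫ y in Ioi (0 : ℝ), weightedKernel T 0 G (rayWeight 0 ε F) t x (σ * (x₀ + y)) =
      tailIntegral β G F σ x₀ ε t x := by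
  rw [← hG.integral_Ioi_eq_tailIntegral hq0 hq2 hF ht hx hσ hx₀ hε]
  refine setIntegral_congr_fun measurableSet_Ioi fun y (hy : 0 < y) => ?_
  have hy₀ : σ * (x₀ + y) ≠ 0 :=
    mul_ne_zero (by rcases hσ with rfl | rfl <;> norm_num) (by positivity)
  simp [weightedKernel_apply ht hx hy₀, rayWeight_zero_angle]

theorem rayWave_zero_angle_eq (ht : t ∈ timeInterval T) (hx : x ≠ 0) (hε : 0 < ε) (hx₀ : 0 ≤ x₀) :
    rayWave T 0 G F ε t x = (∫ y in (-x₀)..x₀, G t x y * damped ε F y) +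
      tailIntegral β G F 1 x₀ ε t x + tailIntegral β G F (-1) x₀ ε t x := by
  rw [rayWave, integral_eq_intervalIntegral_add_tails
    ((hG.isDominatedFamily_real hq0 hq2 hF hε).integrable t ht x hx) x₀,
    ← hG.integral_Ioi_weightedKernel_real hq0 hq2 hF ht hx hε (Or.inl rfl) hx₀,
    ← hG.integral_Ioi_weightedKernel_real hq0 hq2 hF ht hx hε (Or.inr rfl) hx₀]
  simp only [one_mul, neg_one_mul]
  congr 2
  refine intervalIntegral.integral_congr_ae ?_
  filter_upwards [weightedKernel_ae_eq (θ := 0) (G := G) (w := rayWeight 0 ε F) ht hx] with y hy _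
  simpa [rayWeight_zero_angle] using hy

theorem rayWave_eq_tailIntegral (ht : t ∈ timeInterval T) (hx : x ≠ 0) (hε : 0 ≤ ε) :
    rayWave T β G F ε t x = tailIntegral β G F 1 0 ε t x + tailIntegral β G F (-1) 0 ε t x := by
  rw [rayWave, integral_eq_intervalIntegral_add_tails
    ((hG.isDominatedFamily_ray hq0 hq2 hF hε).integrable t ht x hx) 0, neg_zero,
    intervalIntegral.integral_same, zero_add,
    ← integral_Ioi_weightedKernel_ray ht hx (Or.inl rfl) β ε,
    ← integral_Ioi_weightedKernel_ray ht hx (Or.inr rfl) β ε]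
  simp only [zero_add, one_mul, neg_one_mul]

theorem rayWave_zero_angle_eq_rayWave (ht : t ∈ timeInterval T) (hx : x ≠ 0) (hε : 0 < ε) :
    rayWave T 0 G F ε t x = rayWave T β G F ε t x := by
  rw [hG.rayWave_zero_angle_eq hq0 hq2 hF ht hx hε le_rfl,
    hG.rayWave_eq_tailIntegral hq0 hq2 hF ht hx hε.le, neg_zero, intervalIntegral.integral_same,
    zero_add]

theorem integrable_ray (ht : t ∈ timeInterval T) (hx : x ≠ 0) (hε : 0 ≤ ε) :
    Integrable fun y : ℝ => G t x (Complex.exp (β * Complex.I) * y) * rayWeight β ε F y :=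
  ((hG.isDominatedFamily_ray hq0 hq2 hF hε).integrable t ht x hx).congr (weightedKernel_ae_eq ht hx)

theorem norm_rayWave_sub_le (ht : t ∈ timeInterval T) (hx : x ≠ 0) (hε : 0 ≤ ε) {K : ℝ}
    (hK : ∀ y : ℝ, ‖weightedKernel T β G (rayWeight β 0 F) t x y‖ ≤ K * Real.exp (-|y|)) :
    ‖rayWave T β G F ε t x - rayWave T β G F 0 t x‖ ≤ K * dampingError β ε := by
  rw [rayWave_eq_integral ht hx, rayWave_eq_integral ht hx]
  refine norm_integral_damped_sub_le hG.angle_pos.le hG.angle_le hε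
    (hG.integrable_ray hq0 hq2 hF ht hx hε) (hG.integrable_ray hq0 hq2 hF ht hx le_rfl) ?_
  filter_upwards [weightedKernel_ae_eq (θ := β) (G := G) (w := rayWeight β 0 F) ht hx] with y hy
    using hy ▸ hK y

theorem tendsto_rayWave (ht : t ∈ timeInterval T) (hx : x ≠ 0) :
    Tendsto (fun ε => rayWave T β G F ε t x) (𝓝[>] 0) (𝓝 (rayWave T β G F 0 t x)) := by
  obtain ⟨K, -, hK⟩ := hG.exists_norm_weightedKernel_le hq0 hq2
    (hF.isWeight_ray (ε := 0) hG.angle_pos.le hG.angle_le le_rfl) ⟨hG.angle_pos.le, le_rfl⟩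
    (by linarith [hG.sin_two_mul_angle_pos]) ht (S := {x}) isCompact_singleton
    (by simpa using hx.symm)
  rw [tendsto_iff_norm_sub_tendsto_zero]
  have h := (tendsto_dampingError hG.angle_pos.le hG.angle_le).const_mul K
  rw [mul_zero] at h
  refine squeeze_zero' (Eventually.of_forall fun _ => norm_nonneg _) ?_ h
  filter_upwards [self_mem_nhdsWithin] with ε hε
  exact hG.norm_rayWave_sub_le hq0 hq2 hF ht hx (le_of_lt hε) (hK x rfl)

variable {G₀ : ℝ → ℝ → ℝ → ℂ}

theorem integrable_regularizedIntegrand (ht : t ∈ timeInterval T) (hx : x ≠ 0)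
    (hr : ∀ y : ℝ, y ≠ 0 → G t x (y : ℂ) = G₀ t x y) (hε : 0 < ε) :
    Integrable (regularizedIntegrand G₀ F t x ε) :=
  ((hG.isDominatedFamily_real hq0 hq2 hF hε).integrable t ht x hx).congr
    (regularizedIntegrand_ae_eq ht hx hr).symm

theorem tendsto_regularized (ht : t ∈ timeInterval T) (hx : x ≠ 0)
    (hr : ∀ y : ℝ, y ≠ 0 → G t x (y : ℂ) = G₀ t x y) :
    Tendsto (fun ε => ∫ y, regularizedIntegrand G₀ F t x ε y) (𝓝[>] 0)
      (𝓝 (rayWave T β G F 0 t x)) := by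
  refine (hG.tendsto_rayWave hq0 hq2 hF ht hx).congr' ?_
  filter_upwards [self_mem_nhdsWithin] with ε hε
  rw [← hG.rayWave_zero_angle_eq_rayWave hq0 hq2 hF ht hx hε, rayWave]
  exact (integral_congr_ae (regularizedIntegrand_ae_eq ht hx hr)).symm

theorem waveFunction_eq (ht : t ∈ timeInterval T) (hx : x ≠ 0)
    (hr : ∀ y : ℝ, y ≠ 0 → G t x (y : ℂ) = G₀ t x y) :
    waveFunction G₀ F t x = rayWave T β G F 0 t x :=
  (hG.tendsto_regularized hq0 hq2 hF ht hx hr).limUnder_eq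

end Ray

end IsSectorKernel

theorem exists_tendsto_of_uniform_approx {ι X E : Type*} [NormedAddCommGroup E] [CompleteSpace E]
    {m : Filter ι} [m.NeBot] {l : Filter X} [l.NeBot] {f : ι → X → E} {L : ι → E} {g : X → E}
    {η : ι → ℝ} (hf : ∀ᶠ i in m, Tendsto (f i) l (𝓝 (L i))) (hη : Tendsto η m (𝓝 0))
    (hu : ∀ᶠ i in m, ∀ᶠ x in l, ‖f i x - g x‖ ≤ η i) :
    ∃ L₀, Tendsto L m (𝓝 L₀) ∧ Tendsto g l (𝓝 L₀) := by
  have hcauchy : Cauchy (map g l) := by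
    refine Metric.cauchy_iff.2 ⟨inferInstance, fun e he => ?_⟩
    obtain ⟨i, hfi, hui, hηi⟩ :=
      (hf.and (hu.and (hη.eventually (gt_mem_nhds (show (0 : ℝ) < e / 4 by positivity))))).exists
    refine ⟨Metric.ball (L i) (e / 2), ?_, fun u hu v hv => ?_⟩
    · have hball := hfi.eventually (Metric.ball_mem_nhds (L i) (show 0 < e / 4 by positivity))
      refine mem_map.2 ?_
      filter_upwards [hui, hball] with x hx hx'
      rw [← dist_eq_norm, dist_comm] at hx
      rw [mem_preimage, Metric.mem_ball]
      linarith [dist_triangle (g x) (f i x) (L i)]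
    · linarith [dist_triangle_right u v (L i), Metric.mem_ball.1 hu, Metric.mem_ball.1 hv]
  obtain ⟨L₀, hg⟩ := cauchy_map_iff_exists_tendsto.1 hcauchy
  refine ⟨L₀, tendsto_iff_norm_sub_tendsto_zero.2 (squeeze_zero'
    (Eventually.of_forall fun _ => norm_nonneg _) ?_ hη), hg⟩
  filter_upwards [hf, hu] with i hfi hui using le_of_tendsto (hfi.sub hg).norm hui

theorem integrable_and_tendsto_integral_of_dominated {ι α E : Type*} [MeasurableSpace α]
    {μ : Measure α} [NormedAddCommGroup E] [NormedSpace ℝ E] {l : Filter ι} [l.NeBot]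
    [l.IsCountablyGenerated] {k : ι → α → E} {u : α → E} {b : α → ℝ}
    (hm : ∀ᶠ i in l, AEStronglyMeasurable (k i) μ) (hb : ∀ᶠ i in l, ∀ᵐ y ∂μ, ‖k i y‖ ≤ b y)
    (hbi : Integrable b μ) (hl : ∀ᵐ y ∂μ, Tendsto (fun i => k i y) l (𝓝 (u y))) :
    Integrable u μ ∧ Tendsto (fun i => ∫ y, k i y ∂μ) l (𝓝 (∫ y, u y ∂μ)) := by
  refine ⟨?_, tendsto_integral_filter_of_dominated_convergence b hm hb hbi hl⟩
  obtain ⟨s, hs, hsmb⟩ := exists_seq_forall_of_frequently (hm.and hb).frequently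
  have hlim : ∀ᵐ y ∂μ, Tendsto (fun n => k (s n) y) atTop (𝓝 (u y)) :=
    hl.mono fun y hy => hy.comp hs
  refine hbi.mono' (aestronglyMeasurable_of_tendsto_ae atTop (fun n => (hsmb n).1) hlim) ?_
  filter_upwards [hlim, ae_all_iff.2 fun n => (hsmb n).2] with y hy hle
  exact le_of_tendsto hy.norm (Eventually.of_forall hle)

/-- `L` is the Abel integral `lim_{ε → 0⁺} ∫ u(y) exp(-ε y²) F(y) dy` of `u F`. -/
def HasAbelIntegral (F : ℂ → ℂ) (u : ℝ → ℂ) (L : ℂ) : Prop :=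
  (∀ ε > 0, Integrable fun y : ℝ => u y * damped ε F y) ∧
    Tendsto (fun ε => ∫ y : ℝ, u y * damped ε F y) (𝓝[>] 0) (𝓝 L)

namespace HasAbelIntegral

variable {F : ℂ → ℂ} {u v : ℝ → ℂ} {L L' : ℂ}

theorem unique (h : HasAbelIntegral F u L) (h' : HasAbelIntegral F u L') : L = L' :=
  tendsto_nhds_unique h.2 h'.2

theorem congr_ae (h : HasAbelIntegral F u L) (huv : u =ᵐ[volume] v) : HasAbelIntegral F v L := by
  have hmul (ε : ℝ) : (fun y : ℝ => u y * damped ε F y) =ᵐ[volume] fun y => v y * damped ε F y :=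
    huv.mul EventuallyEq.rfl
  exact ⟨fun ε hε => (h.1 ε hε).congr (hmul ε), h.2.congr fun ε => integral_congr_ae (hmul ε)⟩

theorem zero : HasAbelIntegral F (fun _ => 0) 0 := by
  simp [HasAbelIntegral]

theorem const_mul (h : HasAbelIntegral F u L) (c : ℂ) :
    HasAbelIntegral F (fun y => c * u y) (c * L) := by
  simp only [HasAbelIntegral, mul_assoc, integral_const_mul]
  exact ⟨fun ε hε => (h.1 ε hε).const_mul c, h.2.const_mul c⟩

theorem add (h : HasAbelIntegral F u L) (h' : HasAbelIntegral F v L') :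
    HasAbelIntegral F (fun y => u y + v y) (L + L') := by
  simp only [HasAbelIntegral, add_mul]
  refine ⟨fun ε hε => (h.1 ε hε).add (h'.1 ε hε), (h.2.add h'.2).congr' ?_⟩
  filter_upwards [self_mem_nhdsWithin] with ε hε
  exact (integral_add (h.1 ε hε) (h'.1 ε hε)).symm

theorem mulVec_eq {M N : Matrix (Fin 2) (Fin 2) ℂ} {u₁ u₂ v₁ v₂ : ℝ → ℂ} {L₁ L₂ D₁ D₂ : ℂ}
    (h₁ : HasAbelIntegral F u₁ L₁) (h₂ : HasAbelIntegral F u₂ L₂) (h₃ : HasAbelIntegral F v₁ D₁)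
    (h₄ : HasAbelIntegral F v₂ D₂) (h : ∀ y, y ≠ 0 → M *ᵥ ![u₁ y, u₂ y] = N *ᵥ ![v₁ y, -v₂ y]) :
    M *ᵥ ![L₁, L₂] = N *ᵥ ![D₁, -D₂] := by
  funext i
  have hM := (h₁.const_mul (M i 0)).add (h₂.const_mul (M i 1))
  have hN := (h₃.const_mul (N i 0)).add (h₄.const_mul (-N i 1))
  have hMN : M i 0 * L₁ + M i 1 * L₂ = N i 0 * D₁ + -N i 1 * D₂ := by
    refine hM.unique (hN.congr_ae ?_)
    filter_upwards [Measure.ae_ne volume (0 : ℝ)] with y hy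
    simpa [Matrix.mulVec, dotProduct, Fin.sum_univ_two] using (congrFun (h y hy) i).symm
  simpa [Matrix.mulVec, dotProduct, Fin.sum_univ_two] using hMN

theorem exists_of_uniform_approx {l : Filter ℝ} [l.NeBot] {f : ℝ → ℝ → ℂ} {g : ℝ → ℂ} {η : ℝ → ℝ}
    (hf : ∀ ε > 0, Integrable (fun y : ℝ => u y * damped ε F y) ∧
      Tendsto (f ε) l (𝓝 (∫ y : ℝ, u y * damped ε F y)))
    (hη : Tendsto η (𝓝[>] 0) (𝓝 0)) (hu : ∀ ε > 0, ∀ᶠ x in l, ‖f ε x - g x‖ ≤ η ε) :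
    ∃ L, HasAbelIntegral F u L ∧ Tendsto g l (𝓝 L) := by
  obtain ⟨L, hL, hg⟩ := exists_tendsto_of_uniform_approx (m := 𝓝[>] (0 : ℝ))
    (eventually_of_mem self_mem_nhdsWithin fun ε hε => (hf ε hε).2) hη
    (eventually_of_mem self_mem_nhdsWithin hu)
  exact ⟨L, ⟨fun ε hε => (hf ε hε).1, hL⟩, hg⟩

end HasAbelIntegral

theorem IsDominatedFamily.integrable_deriv_space {T : EReal} {k : ℝ → ℝ → ℝ → ℂ}
    (hk : IsDominatedFamily T k) {t x : ℝ} (ht : t ∈ timeInterval T) (hx : x ≠ 0) :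
    Integrable fun y => deriv (fun x => k t x y) x := by
  obtain ⟨g, hg, hle⟩ := hk.bound_space t ht x x le_rfl fun h => hx (le_antisymm h.1 h.2)
  exact hg.mono' ((hk.stronglyMeasurable_deriv_space hx).comp_measurable
    (measurable_id.prodMk (measurable_const (a := t)))).aestronglyMeasurable
    (Eventually.of_forall fun y => (hle x ⟨le_rfl, le_rfl⟩ y).1)

theorem deriv_weightedKernel_space_ae_eq {T : EReal} {θ : ℝ} {G : ℝ → ℝ → ℂ → ℂ} {w : ℝ → ℂ}
    {t x : ℝ} (ht : t ∈ timeInterval T) (hx : x ≠ 0) :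
    (fun y => deriv (fun x => weightedKernel T θ G w t x y) x) =ᵐ[volume]
      fun y : ℝ => deriv (fun x => G t x (Complex.exp (θ * Complex.I) * y)) x * w y := by
  filter_upwards [Measure.ae_ne volume (0 : ℝ)] with y hy
    using deriv_weightedKernel_space ht hx hy

namespace IsSectorKernel

variable {T : EReal} {β : ℝ} {G : ℝ → ℝ → ℂ → ℂ} {a : ℝ → ℝ} {p : ℝ} {A B : Fin 3 → ℝ → ℝ → ℝ}
  {q C D : ℝ} {F : ℂ → ℂ} {t x ε θ K₀ : ℝ}

section NearOrigin

variable {w : ℝ → ℂ} (hG : IsSectorKernel T β G a p A B) (hq0 : 0 < q) (hq2 : q < 2)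
  (hw : IsWeight q C D ε w) (hθ : θ ∈ Icc 0 β) (hε : 0 < ε + Real.sin (2 * θ))
  (ht : t ∈ timeInterval T)
include hG hq0 hq2 hw hθ hε ht

theorem exists_norm_weightedKernel_le_near_zero
    (hK₀ : ∀ᶠ x in 𝓝[≠] (0 : ℝ), A 0 t x ≤ K₀ ∧ B 0 t x ≤ K₀) :
    ∃ K, ∀ᶠ x in 𝓝[≠] (0 : ℝ), ∀ y, ‖weightedKernel T θ G w t x y‖ ≤ K * Real.exp (-|y|) := by
  obtain ⟨K, hK0, hK⟩ := hG.exists_weighted_bound hq0 hq2 hw hθ hε |K₀| 1 (abs_nonneg K₀)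
    (hG.a_pos t ht) (a t)
  refine ⟨K, ?_⟩
  filter_upwards [hK₀, mem_nhdsWithin_of_mem_nhds (Metric.closedBall_mem_nhds 0 one_pos),
    self_mem_nhdsWithin] with x ⟨hA, hB⟩ hx1 hx y
  rcases eq_or_ne y 0 with rfl | hy
  · rw [weightedKernel_zero, norm_zero]
    positivity
  · rw [weightedKernel_apply ht hx hy]
    exact hK t ht x hx le_rfl le_rfl (by simpa using hx1) (hA.trans (le_abs_self _))
      (hB.trans (le_abs_self _)) y hy

theorem exists_norm_deriv_weightedKernel_le_near_zero (hK₀ : ∀ᶠ x in 𝓝[≠] (0 : ℝ),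
      A 0 t x ≤ K₀ ∧ A 1 t x ≤ K₀ ∧ B 0 t x ≤ K₀ ∧ B 1 t x ≤ K₀) :
    ∃ K, ∀ᶠ x in 𝓝[≠] (0 : ℝ), ∀ y,
      ‖deriv (fun x => weightedKernel T θ G w t x y) x‖ ≤ K * Real.exp (-|y|) := by
  obtain ⟨K, hK0, hK⟩ := hG.exists_weighted_bound_deriv_space hq0 hq2 hw hθ hε |K₀| 1
    (abs_nonneg K₀) (hG.a_pos t ht) (hG.a_pos t ht).le
  refine ⟨K, ?_⟩
  filter_upwards [hK₀, mem_nhdsWithin_of_mem_nhds (Metric.closedBall_mem_nhds 0 one_pos),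
    self_mem_nhdsWithin] with x ⟨hA, hA1, hB, hB1⟩ hx1 hx y
  rcases eq_or_ne y 0 with rfl | hy
  · simp only [weightedKernel_zero, deriv_const', norm_zero]
    positivity
  · rw [deriv_weightedKernel_space ht hx hy]
    exact hK t ht x hx le_rfl le_rfl (by simpa using hx1) (hA.trans (le_abs_self _))
      (hB.trans (le_abs_self _)) (hA1.trans (le_abs_self _)) (hB1.trans (le_abs_self _)) y hy

end NearOrigin

section Transmission

variable (hG : IsSectorKernel T β G a p A B) (hq0 : 0 < q) (hq2 : q < 2)
  (hF : HasExpGrowth q C D F) (ht : t ∈ timeInterval T)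
include hG hq0 hq2 hF ht

theorem norm_deriv_rayWave_sub_le (hx : x ≠ 0) (hε : 0 ≤ ε) {K : ℝ}
    (hK : ∀ y, ‖deriv (fun x => weightedKernel T β G (rayWeight β 0 F) t x y) x‖
      ≤ K * Real.exp (-|y|)) :
    ‖deriv (rayWave T β G F ε t) x - deriv (rayWave T β G F 0 t) x‖ ≤ K * dampingError β ε := by
  have hderiv : ∀ ε, 0 ≤ ε → Integrable (fun y : ℝ =>
        deriv (fun x => G t x (Complex.exp (β * Complex.I) * y)) x * rayWeight β ε F y) ∧
      deriv (rayWave T β G F ε t) x = ∫ y : ℝ,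
        deriv (fun x => G t x (Complex.exp (β * Complex.I) * y)) x * rayWeight β ε F y := by
    intro ε hε
    have hdom := hG.isDominatedFamily_ray hq0 hq2 hF hε
    have hae := deriv_weightedKernel_space_ae_eq (θ := β) (G := G) (w := rayWeight β ε F) ht hx
    exact ⟨(hdom.integrable_deriv_space ht hx).congr hae,
      (hdom.hasDerivAt_integral_space ht hx).deriv.trans (integral_congr_ae hae)⟩
  rw [(hderiv ε hε).2, (hderiv 0 le_rfl).2]
  refine norm_integral_damped_sub_le hG.angle_pos.le hG.angle_le hε (hderiv ε hε).1
    (hderiv 0 le_rfl).1 ?_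
  filter_upwards [deriv_weightedKernel_space_ae_eq (θ := β) (G := G) (w := rayWeight β 0 F) ht hx]
    with y hy using hy ▸ hK y

variable {l : Filter ℝ} [l.NeBot] [l.IsCountablyGenerated] {u : ℝ → ℂ}

theorem tendsto_rayWave_origin (hK₀ : ∀ᶠ x in 𝓝[≠] (0 : ℝ), A 0 t x ≤ K₀ ∧ B 0 t x ≤ K₀)
    (hl : l ≤ 𝓝[≠] 0) (hu : ∀ y : ℝ, y ≠ 0 → Tendsto (fun x => G t x y) l (𝓝 (u y)))
    (hε : 0 < ε) :
    Integrable (fun y : ℝ => u y * damped ε F y) ∧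
      Tendsto (rayWave T β G F ε t) l (𝓝 (∫ y : ℝ, u y * damped ε F y)) := by
  obtain ⟨K, hK⟩ := hG.exists_norm_weightedKernel_le_near_zero hq0 hq2 (hF.isWeight_real hε.le)
    ⟨le_rfl, hG.angle_pos.le⟩ (by simpa using hε) ht hK₀
  have hne : ∀ᶠ x in l, x ≠ 0 := hl self_mem_nhdsWithin
  have hlim : ∀ᵐ y : ℝ, Tendsto (fun x => weightedKernel T 0 G (rayWeight 0 ε F) t x y) l
      (𝓝 (u y * damped ε F y)) := by
    filter_upwards [Measure.ae_ne volume (0 : ℝ)] with y hy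
    refine ((hu y hy).mul_const _).congr' ?_
    filter_upwards [hne] with x hx
    simp [weightedKernel_apply ht hx hy, rayWeight_zero_angle]
  obtain ⟨hint, htendsto⟩ := integrable_and_tendsto_integral_of_dominated
    (Eventually.of_forall fun x => ((hG.isDominatedFamily_real hq0 hq2 hF hε
      ).stronglyMeasurable_param t x).aestronglyMeasurable)
    ((hK.filter_mono hl).mono fun x hx => Eventually.of_forall hx)
    (integrable_exp_neg_abs.const_mul K) hlim
  exact ⟨hint, htendsto.congr' (hne.mono fun x hx =>
    hG.rayWave_zero_angle_eq_rayWave hq0 hq2 hF ht hx hε)⟩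

theorem tendsto_deriv_rayWave_origin (hK₀ : ∀ᶠ x in 𝓝[≠] (0 : ℝ),
      A 0 t x ≤ K₀ ∧ A 1 t x ≤ K₀ ∧ B 0 t x ≤ K₀ ∧ B 1 t x ≤ K₀) (hl : l ≤ 𝓝[≠] 0)
    (hu : ∀ y : ℝ, y ≠ 0 → Tendsto (deriv fun x => G t x y) l (𝓝 (u y))) (hε : 0 < ε) :
    Integrable (fun y : ℝ => u y * damped ε F y) ∧
      Tendsto (deriv (rayWave T β G F ε t)) l (𝓝 (∫ y : ℝ, u y * damped ε F y)) := by
  obtain ⟨K, hK⟩ := hG.exists_norm_deriv_weightedKernel_le_near_zero hq0 hq2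
    (hF.isWeight_real hε.le) ⟨le_rfl, hG.angle_pos.le⟩ (by simpa using hε) ht hK₀
  have hdom := hG.isDominatedFamily_real hq0 hq2 hF hε
  have hne : ∀ᶠ x in l, x ≠ 0 := hl self_mem_nhdsWithin
  have hlim : ∀ᵐ y : ℝ, Tendsto
      (fun x => deriv (fun x => weightedKernel T 0 G (rayWeight 0 ε F) t x y) x) l
      (𝓝 (u y * damped ε F y)) := by
    filter_upwards [Measure.ae_ne volume (0 : ℝ)] with y hy
    refine ((hu y hy).mul_const _).congr' ?_
    filter_upwards [hne] with x hx
    simp [deriv_weightedKernel_space ht hx hy, rayWeight_zero_angle]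
  obtain ⟨hint, htendsto⟩ := integrable_and_tendsto_integral_of_dominated
    (hne.mono fun x hx => (hdom.integrable_deriv_space ht hx).aestronglyMeasurable)
    ((hK.filter_mono hl).mono fun x hx => Eventually.of_forall hx)
    (integrable_exp_neg_abs.const_mul K) hlim
  refine ⟨hint, htendsto.congr' (hne.mono fun x hx => ?_)⟩
  rw [← deriv_eq_of_forall_ne_zero
    (fun x hx => hG.rayWave_zero_angle_eq_rayWave hq0 hq2 hF ht hx hε) hx]
  exact (hdom.hasDerivAt_integral_space ht hx).deriv.symm

theorem exists_hasAbelIntegral_tendsto_rayWave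
    (hK₀ : ∀ᶠ x in 𝓝[≠] (0 : ℝ), A 0 t x ≤ K₀ ∧ B 0 t x ≤ K₀) (hl : l ≤ 𝓝[≠] 0)
    (hu : ∀ y : ℝ, y ≠ 0 → Tendsto (fun x => G t x y) l (𝓝 (u y))) :
    ∃ L, HasAbelIntegral F u L ∧ Tendsto (rayWave T β G F 0 t) l (𝓝 L) := by
  obtain ⟨K, hK⟩ := hG.exists_norm_weightedKernel_le_near_zero hq0 hq2
    (hF.isWeight_ray (ε := 0) hG.angle_pos.le hG.angle_le le_rfl) ⟨hG.angle_pos.le, le_rfl⟩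
    (by linarith [hG.sin_two_mul_angle_pos]) ht hK₀
  refine HasAbelIntegral.exists_of_uniform_approx
    (fun ε hε => hG.tendsto_rayWave_origin hq0 hq2 hF ht hK₀ hl hu hε)
    (by simpa using (tendsto_dampingError hG.angle_pos.le hG.angle_le).const_mul K)
    fun ε hε => ?_
  filter_upwards [hl hK, hl self_mem_nhdsWithin] with x hx hx0
  exact hG.norm_rayWave_sub_le hq0 hq2 hF ht hx0 (le_of_lt hε) hx

theorem exists_hasAbelIntegral_tendsto_deriv_rayWave (hK₀ : ∀ᶠ x in 𝓝[≠] (0 : ℝ),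
      A 0 t x ≤ K₀ ∧ A 1 t x ≤ K₀ ∧ B 0 t x ≤ K₀ ∧ B 1 t x ≤ K₀) (hl : l ≤ 𝓝[≠] 0)
    (hu : ∀ y : ℝ, y ≠ 0 → Tendsto (deriv fun x => G t x y) l (𝓝 (u y))) :
    ∃ L, HasAbelIntegral F u L ∧ Tendsto (deriv (rayWave T β G F 0 t)) l (𝓝 L) := by
  obtain ⟨K, hK⟩ := hG.exists_norm_deriv_weightedKernel_le_near_zero hq0 hq2
    (hF.isWeight_ray (ε := 0) hG.angle_pos.le hG.angle_le le_rfl) ⟨hG.angle_pos.le, le_rfl⟩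
    (by linarith [hG.sin_two_mul_angle_pos]) ht hK₀
  refine HasAbelIntegral.exists_of_uniform_approx
    (fun ε hε => hG.tendsto_deriv_rayWave_origin hq0 hq2 hF ht hK₀ hl hu hε)
    (by simpa using (tendsto_dampingError hG.angle_pos.le hG.angle_le).const_mul K)
    fun ε hε => ?_
  filter_upwards [hl hK, hl self_mem_nhdsWithin] with x hx hx0
  exact hG.norm_deriv_rayWave_sub_le hq0 hq2 hF ht hx0 (le_of_lt hε) hx

theorem satisfiesTransmission_rayWave {M N : Matrix (Fin 2) (Fin 2) ℂ}
    (hM : M ≠ 0 → N = 0 → ∃ K : ℝ, ∀ᶠ x in 𝓝[≠] (0 : ℝ), A 0 t x ≤ K ∧ B 0 t x ≤ K)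
    (hN : N ≠ 0 → ∃ K : ℝ, ∀ᶠ x in 𝓝[≠] (0 : ℝ),
      A 0 t x ≤ K ∧ A 1 t x ≤ K ∧ B 0 t x ≤ K ∧ B 1 t x ≤ K)
    (htr : ∀ y : ℝ, y ≠ 0 → SatisfiesTransmission M N fun x => G t x y) :
    SatisfiesTransmission M N (rayWave T β G F 0 t) := by
  have hgt : 𝓝[>] (0 : ℝ) ≤ 𝓝[≠] 0 := nhdsWithin_mono _ fun x hx => ne_of_gt hx
  have hlt : 𝓝[<] (0 : ℝ) ≤ 𝓝[≠] 0 := nhdsWithin_mono _ fun x hx => ne_of_lt hx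
  have hval {K₀ : ℝ} (hK₀ : ∀ᶠ x in 𝓝[≠] (0 : ℝ), A 0 t x ≤ K₀ ∧ B 0 t x ≤ K₀) (l : Filter ℝ)
      [l.NeBot] [l.IsCountablyGenerated] (hl : l ≤ 𝓝[≠] 0) (u : ℝ → ℂ) :=
    hG.exists_hasAbelIntegral_tendsto_rayWave hq0 hq2 hF ht hK₀ hl (u := u)
  refine ⟨fun hN0 hM0 => ?_, fun hN0 => ?_⟩
  · obtain ⟨K₀, hK₀⟩ := hM hM0 hN0
    choose! up um hup hum hMu using fun y hy => (htr y hy).1 hN0 hM0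
    obtain ⟨Lp, hLp, hp⟩ := hval hK₀ _ hgt up hup
    obtain ⟨Lm, hLm, hm⟩ := hval hK₀ _ hlt um hum
    refine ⟨Lp, Lm, hp, hm, ?_⟩
    rw [hLp.mulVec_eq (N := 0) hLm .zero .zero fun y hy => ?_, Matrix.zero_mulVec]
    rw [hMu y hy, Matrix.zero_mulVec]
  · obtain ⟨K₀, hK₀⟩ := hN hN0
    have hK₀' : ∀ᶠ x in 𝓝[≠] (0 : ℝ), A 0 t x ≤ K₀ ∧ B 0 t x ≤ K₀ :=
      hK₀.mono fun x hx => ⟨hx.1, hx.2.2.1⟩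
    choose! up um dp dm hup hum hdp hdm hMN using fun y hy => (htr y hy).2 hN0
    obtain ⟨Lp, hLp, hp⟩ := hval hK₀' _ hgt up hup
    obtain ⟨Lm, hLm, hm⟩ := hval hK₀' _ hlt um hum
    obtain ⟨Dp, hDp, hp'⟩ :=
      hG.exists_hasAbelIntegral_tendsto_deriv_rayWave hq0 hq2 hF ht hK₀ hgt hdp
    obtain ⟨Dm, hDm, hm'⟩ :=
      hG.exists_hasAbelIntegral_tendsto_deriv_rayWave hq0 hq2 hF ht hK₀ hlt hdm
    exact ⟨Lp, Lm, Dp, Dm, hp, hm, hp', hm', hLp.mulVec_eq hLm hDp hDm hMN⟩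

end Transmission

end IsSectorKernel

theorem eventually_mem_timeInterval {T : EReal} (hT : 0 < T) :
    ∀ᶠ t in 𝓝[>] (0 : ℝ), t ∈ timeInterval T := by
  have hlt : ∀ᶠ t : ℝ in 𝓝 0, (t : EReal) < T :=
    (continuous_coe_real_ereal.tendsto (0 : ℝ)).eventually (gt_mem_nhds (by simpa using hT))
  filter_upwards [self_mem_nhdsWithin, nhdsWithin_le_nhds hlt] with t h₀ hT using ⟨h₀, hT⟩

section TailRay

variable {β x σ x₀ s : ℝ}

theorem sub_sign_mul_pos (hσ : σ = 1 ∨ σ = -1) (hxx₀ : |x| < x₀) : 0 < x₀ - σ * x :=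
  sub_pos.2 ((sign_mul_le_abs hσ x).trans_lt hxx₀)

theorem sign_mul_add_exp_mul_mem (hβ0 : 0 ≤ β) (hβ : β < Real.pi / 2) (hσ : σ = 1 ∨ σ = -1)
    (hx₀ : 0 ≤ x₀) (hs : 0 < s) :
    (σ : ℂ) * (x₀ + Complex.exp (β * Complex.I) * s) ∈ doubleSector β := by
  have h := sign_mul_add_exp_mem hβ hσ hx₀ (w := Real.log s + β * Complex.I)
    (by simpa using hβ0)
  rwa [Complex.exp_add, ← Complex.ofReal_exp, Real.exp_log hs, mul_comm (s : ℂ)] at h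

theorem norm_phase_tail (hσ : σ = 1 ∨ σ = -1) (a β x x₀ s : ℝ) :
    ‖phase a x (σ * (x₀ + Complex.exp (β * Complex.I) * s))‖ =
      Real.exp (-(a * Real.sin (2 * β) * s ^ 2)) *
        Real.exp (-(2 * Real.sin β * (x₀ - σ * x) * a * s)) := by
  rw [norm_phase, mul_assoc 2, phase_exponent_sign_mul hσ, Complex.re_mul_ofReal,
    Complex.im_mul_ofReal, Complex.exp_ofReal_mul_I_re, Complex.exp_ofReal_mul_I_im,
    Real.sin_two_mul, ← Real.exp_add]
  ring_nf

end TailRay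

namespace IsSectorKernel

variable {T : EReal} {β : ℝ} {G : ℝ → ℝ → ℂ → ℂ} {a : ℝ → ℝ} {p : ℝ} {A B : Fin 3 → ℝ → ℝ → ℝ}
  {q C D : ℝ} {F : ℂ → ℂ} {t x σ x₀ : ℝ}

theorem sin_angle_pos (hG : IsSectorKernel T β G a p A B) : 0 < Real.sin β :=
  Real.sin_pos_of_pos_of_lt_pi hG.angle_pos (by linarith [hG.angle_le, Real.pi_pos])

theorem tail_mem_doubleSector (hG : IsSectorKernel T β G a p A B) (hσ : σ = 1 ∨ σ = -1)
    (hx₀ : 0 ≤ x₀) {s : ℝ} (hs : 0 < s) :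
    (σ : ℂ) * (x₀ + Complex.exp (β * Complex.I) * s) ∈ doubleSector β :=
  sign_mul_add_exp_mul_mem hG.angle_pos.le hG.angle_lt hσ hx₀ hs

-- The linear exponent `-2 a sin β (x₀ - σ x) s` comes from starting the tail beyond `x`; it is what
-- makes the tail vanish as `a(t) → ∞`.
theorem exists_norm_tail_le (hG : IsSectorKernel T β G a p A B) (hq0 : 0 < q) (hq2 : q < 2)
    (hF : HasExpGrowth q C D F) (hσ : σ = 1 ∨ σ = -1) (hx₀ : 0 ≤ x₀) (B' : ℝ) {a₀ : ℝ}
    (ha₀ : 0 < a₀) :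
    ∃ K : ℝ, 0 ≤ K ∧ ∀ t ∈ timeInterval T, ∀ x : ℝ, x ≠ 0 → a₀ ≤ a t → B 0 t x ≤ B' →
      ∀ ε s : ℝ, 0 ≤ ε → 0 < s →
      ‖G t x (σ * (x₀ + Complex.exp (β * Complex.I) * s)) *
        damped ε F (σ * (x₀ + Complex.exp (β * Complex.I) * s))‖ ≤
      A 0 t x * K * (Real.exp (-s) * Real.exp (-(2 * Real.sin β * (x₀ - σ * x) * a t * s))) := by
  have hC := hF.const_nonneg
  obtain ⟨K, hK⟩ := exists_rpow_add_rpow_sub_sq_le hG.p_pos hG.p_lt hq0 hq2 B' D x₀ 0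
    (mul_pos ha₀ hG.sin_two_mul_angle_pos)
  refine ⟨C * Real.exp K, by positivity, fun t ht x hx ha hB ε s hε hs => ?_⟩
  have hA := (hG.nonneg 0 t ht x hx).1
  have hz := hG.tail_mem_doubleSector hσ hx₀ hs
  have hnorm := norm_sign_mul_add_le hσ hx₀ (Complex.exp (β * Complex.I) * s)
  rw [norm_exp_mul_I_mul, abs_of_pos hs] at hnorm
  have hphase := norm_phase_tail hσ (a t) β x x₀ s
  generalize (σ : ℂ) * (x₀ + Complex.exp (β * Complex.I) * s) = z at *
  have hexp := hK s ‖z‖ hs.le (norm_nonneg z) hnorm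
  have hquad : a₀ * Real.sin (2 * β) * s ^ 2 ≤ a t * Real.sin (2 * β) * s ^ 2 :=
    mul_le_mul_of_nonneg_right (mul_le_mul_of_nonneg_right ha hG.sin_two_mul_angle_pos.le)
      (sq_nonneg s)
  rw [norm_mul]
  set E := Real.exp (-(2 * Real.sin β * (x₀ - σ * x) * a t * s))
  calc ‖G t x z‖ * ‖damped ε F z‖
      ≤ A 0 t x * (Real.exp (B' * ‖z‖ ^ p) * ‖phase (a t) x z‖) *
          (C * Real.exp (D * ‖z‖ ^ q)) := by
        gcongr
        · exact hG.norm_le ht hx hz le_rfl hB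
        · exact hF.norm_damped_le hε (re_sq_nonneg_of_mem_doubleSector hG.angle_le hz)
    _ = A 0 t x * C * Real.exp (B' * ‖z‖ ^ p + D * ‖z‖ ^ q +
          -(a t * Real.sin (2 * β) * s ^ 2)) * E := by
        rw [hphase, Real.exp_add, Real.exp_add]
        ring
    _ ≤ A 0 t x * C * Real.exp (K - s) * E := by
        gcongr
        linarith
    _ = A 0 t x * (C * Real.exp K) * (Real.exp (-s) * E) := by
        rw [sub_eq_add_neg, Real.exp_add]
        ring

theorem continuousOn_tail (hG : IsSectorKernel T β G a p A B) (hF : HasExpGrowth q C D F)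
    (ht : t ∈ timeInterval T) (hx : x ≠ 0) (hσ : σ = 1 ∨ σ = -1) (hx₀ : 0 ≤ x₀) (ε : ℝ) :
    ContinuousOn (fun s : ℝ => G t x (σ * (x₀ + Complex.exp (β * Complex.I) * s)) *
      damped ε F (σ * (x₀ + Complex.exp (β * Complex.I) * s))) (Ioi 0) :=
  ((hG.cont t ht x hx).comp (by fun_prop) fun _ hs => hG.tail_mem_doubleSector hσ hx₀ hs).mul
    ((differentiable_damped hF.differentiable ε).continuous.comp (by fun_prop)).continuousOn

theorem tendsto_tailIntegral (hG : IsSectorKernel T β G a p A B) (hq0 : 0 < q) (hq2 : q < 2)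
    (hF : HasExpGrowth q C D F) (ht : t ∈ timeInterval T) (hx : x ≠ 0) (hσ : σ = 1 ∨ σ = -1)
    (hxx₀ : |x| < x₀) :
    Tendsto (fun ε => tailIntegral β G F σ x₀ ε t x) (𝓝[>] 0)
      (𝓝 (tailIntegral β G F σ x₀ 0 t x)) := by
  have hx₀ : 0 ≤ x₀ := (abs_nonneg x).trans hxx₀.le
  have hat := hG.a_pos t ht
  have hA := (hG.nonneg 0 t ht x hx).1
  have hsin := hG.sin_angle_pos
  have hgap := sub_sign_mul_pos hσ hxx₀
  obtain ⟨K, hK0, hK⟩ := hG.exists_norm_tail_le hq0 hq2 hF hσ hx₀ (B 0 t x) hat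
  refine Tendsto.const_mul _ (tendsto_integral_filter_of_dominated_convergence
    (fun s => A 0 t x * K * Real.exp (-s)) ?_ ?_ ((integrableOn_exp_neg_Ioi 0).const_mul _) ?_)
  · exact Eventually.of_forall fun ε =>
      (hG.continuousOn_tail hF ht hx hσ hx₀ ε).aestronglyMeasurable measurableSet_Ioi
  · filter_upwards [self_mem_nhdsWithin] with ε hε
    refine (ae_restrict_iff' measurableSet_Ioi).2 (Eventually.of_forall fun s (hs : 0 < s) => ?_)
    refine (hK t ht x hx le_rfl le_rfl ε s (le_of_lt hε) hs).trans ?_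
    have hdecay : Real.exp (-(2 * Real.sin β * (x₀ - σ * x) * a t * s)) ≤ 1 :=
      Real.exp_le_one_iff.2 (neg_nonpos.2 (by positivity))
    exact mul_le_mul_of_nonneg_left (mul_le_of_le_one_right (Real.exp_pos _).le hdecay)
      (by positivity)
  · rw [damped_zero]
    exact Eventually.of_forall fun s => (tendsto_damped F _).const_mul _

theorem norm_mul_damped_real_le (hG : IsSectorKernel T β G a p A B) (hF : HasExpGrowth q C D F)
    (ht : t ∈ timeInterval T) (hx : x ≠ 0) {ε y : ℝ} (hε : 0 ≤ ε) (hy : y ≠ 0) :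
    ‖G t x y * damped ε F y‖ ≤
      A 0 t x * Real.exp (B 0 t x * |y| ^ p) * (C * Real.exp (D * |y| ^ q)) := by
  have hA := (hG.nonneg 0 t ht x hx).1
  have hyβ := real_mem_doubleSector hG.angle_pos.le hG.angle_lt hy
  have hphase : ‖phase (a t) x y‖ = 1 := by simp [norm_phase]
  have hGy := hG.norm_le ht hx hyβ le_rfl le_rfl
  have hFy := hF.norm_damped_le hε (re_sq_nonneg_of_mem_doubleSector hG.angle_le hyβ)
  rw [hphase, mul_one] at hGy
  rw [Complex.norm_real, Real.norm_eq_abs] at hGy hFy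
  rw [norm_mul]
  gcongr

theorem tendsto_intervalIntegral_damped (hG : IsSectorKernel T β G a p A B) (hq0 : 0 ≤ q)
    (hF : HasExpGrowth q C D F) (ht : t ∈ timeInterval T) (hx : x ≠ 0) (x₀ : ℝ) :
    Tendsto (fun ε : ℝ => ∫ y in (-x₀)..x₀, G t x y * damped ε F y) (𝓝[>] 0)
      (𝓝 (∫ y in (-x₀)..x₀, G t x y * F y)) := by
  have hcont (ε : ℝ) : ContinuousOn (fun y : ℝ => G t x y * damped ε F y) {0}ᶜ :=
    ((hG.cont t ht x hx).comp (by fun_prop) fun y hy =>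
      real_mem_doubleSector hG.angle_pos.le hG.angle_lt hy).mul
      ((differentiable_damped hF.differentiable ε).continuous.comp
        Complex.continuous_ofReal).continuousOn
  have hrpow {r : ℝ} (hr : 0 ≤ r) : Continuous fun y : ℝ => |y| ^ r :=
    continuous_abs.rpow_const fun y => Or.inr hr
  have hbound : Continuous fun y : ℝ =>
      A 0 t x * Real.exp (B 0 t x * |y| ^ p) * (C * Real.exp (D * |y| ^ q)) :=
    (((hrpow hG.p_pos.le).const_mul _).rexp.const_mul _).mul
      (((hrpow hq0).const_mul _).rexp.const_mul _)
  refine intervalIntegral.tendsto_integral_filter_of_dominated_convergence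
    _ ?_ ?_ (hbound.intervalIntegrable _ _)
    (Eventually.of_forall fun y _ => (tendsto_damped F y).const_mul _)
  · exact Eventually.of_forall fun ε =>
      (measurable_of_continuousOn_compl_singleton 0 (hcont ε)).aestronglyMeasurable
  · filter_upwards [self_mem_nhdsWithin] with ε hε
    filter_upwards [Measure.ae_ne volume (0 : ℝ)] with y hy _
      using hG.norm_mul_damped_real_le hF ht hx (le_of_lt hε) hy

theorem rayWave_eq_intervalIntegral_add (hG : IsSectorKernel T β G a p A B) (hq0 : 0 < q)
    (hq2 : q < 2) (hF : HasExpGrowth q C D F) (ht : t ∈ timeInterval T) (hx : x ≠ 0)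
    (hxx₀ : |x| < x₀) :
    rayWave T β G F 0 t x = (∫ y in (-x₀)..x₀, G t x y * F y) +
      tailIntegral β G F 1 x₀ 0 t x + tailIntegral β G F (-1) x₀ 0 t x := by
  refine tendsto_nhds_unique (hG.tendsto_rayWave hq0 hq2 hF ht hx) ?_
  refine (((hG.tendsto_intervalIntegral_damped hq0.le hF ht hx x₀).add
    (hG.tendsto_tailIntegral hq0 hq2 hF ht hx (Or.inl rfl) hxx₀)).add
    (hG.tendsto_tailIntegral hq0 hq2 hF ht hx (Or.inr rfl) hxx₀)).congr' ?_
  filter_upwards [self_mem_nhdsWithin] with ε hε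
  rw [← hG.rayWave_zero_angle_eq_rayWave hq0 hq2 hF ht hx hε]
  exact (hG.rayWave_zero_angle_eq hq0 hq2 hF ht hx hε ((abs_nonneg x).trans hxx₀.le)).symm

theorem exists_norm_tailIntegral_le (hG : IsSectorKernel T β G a p A B) (hq0 : 0 < q) (hq2 : q < 2)
    (hF : HasExpGrowth q C D F) (hx : x ≠ 0) (hσ : σ = 1 ∨ σ = -1) (hxx₀ : |x| < x₀) (B' : ℝ)
    {a₀ : ℝ} (ha₀ : 0 < a₀) :
    ∃ K : ℝ, 0 ≤ K ∧ ∀ t ∈ timeInterval T, a₀ ≤ a t → B 0 t x ≤ B' →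
      ‖tailIntegral β G F σ x₀ 0 t x‖ ≤ K * (A 0 t x / a t) := by
  obtain ⟨K, hK0, hK⟩ := hG.exists_norm_tail_le hq0 hq2 hF hσ ((abs_nonneg x).trans hxx₀.le) B' ha₀
  set c := 2 * Real.sin β * (x₀ - σ * x)
  have hc : 0 < c := mul_pos (mul_pos two_pos hG.sin_angle_pos) (sub_sign_mul_pos hσ hxx₀)
  refine ⟨K / c, by positivity, fun t ht ha hB => ?_⟩
  have hA := (hG.nonneg 0 t ht x hx).1
  have hca : -(c * a t) < 0 := neg_neg_of_pos (mul_pos hc (hG.a_pos t ht))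
  rw [tailIntegral, norm_mul, Complex.norm_exp_ofReal_mul_I, one_mul]
  calc _ ≤ ∫ s in Ioi (0 : ℝ), A 0 t x * K * Real.exp (-(c * a t) * s) := by
        refine norm_integral_le_of_norm_le ((integrableOn_exp_mul_Ioi hca 0).const_mul _)
          ((ae_restrict_iff' measurableSet_Ioi).2 (Eventually.of_forall fun s (hs : 0 < s) => ?_))
        refine (hK t ht x hx ha hB 0 s le_rfl hs).trans ?_
        rw [neg_mul]
        exact mul_le_mul_of_nonneg_left (mul_le_of_le_one_left (Real.exp_pos _).le
          (Real.exp_le_one_iff.2 (neg_nonpos.2 hs.le))) (by positivity)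
    _ = K / c * (A 0 t x / a t) := by
        rw [integral_const_mul, integral_exp_mul_Ioi hca, mul_zero, Real.exp_zero]
        field_simp

theorem tendsto_tailIntegral_time (hG : IsSectorKernel T β G a p A B) (hT : 0 < T) (hq0 : 0 < q)
    (hq2 : q < 2) (hF : HasExpGrowth q C D F) (hx : x ≠ 0) (hσ : σ = 1 ∨ σ = -1) (hxx₀ : |x| < x₀)
    (ha : Tendsto a (𝓝[>] 0) atTop)
    (hAB : ∃ K : ℝ, ∀ᶠ t in 𝓝[>] (0 : ℝ), A 0 t x / √(a t) ≤ K ∧ B 0 t x ≤ K) :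
    Tendsto (fun t => tailIntegral β G F σ x₀ 0 t x) (𝓝[>] 0) (𝓝 0) := by
  obtain ⟨K₀, hK₀⟩ := hAB
  obtain ⟨K, hK0, hK⟩ := hG.exists_norm_tailIntegral_le hq0 hq2 hF hx hσ hxx₀ K₀ one_pos
  have hlim : Tendsto (fun t => K * (K₀ * (√(a t))⁻¹)) (𝓝[>] 0) (𝓝 0) := by
    simpa using ((tendsto_inv_atTop_zero.comp
      (Real.tendsto_sqrt_atTop.comp ha)).const_mul K₀).const_mul K
  refine squeeze_zero_norm' ?_ hlim
  filter_upwards [hK₀, eventually_mem_timeInterval hT, ha.eventually_ge_atTop 1]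
    with t ⟨hA, hB⟩ ht hat
  refine (hK t ht hat hB).trans (mul_le_mul_of_nonneg_left ?_ hK0)
  calc A 0 t x / a t = A 0 t x / √(a t) * (√(a t))⁻¹ := by
        rw [← div_eq_mul_inv, div_div, Real.mul_self_sqrt (hG.a_pos t ht).le]
    _ ≤ K₀ * (√(a t))⁻¹ := by gcongr

theorem tendsto_rayWave_time (hG : IsSectorKernel T β G a p A B) (hT : 0 < T) (hq0 : 0 < q)
    (hq2 : q < 2) (hF : HasExpGrowth q C D F) (hx : x ≠ 0) (ha : Tendsto a (𝓝[>] 0) atTop)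
    (hAB : ∃ K : ℝ, ∀ᶠ t in 𝓝[>] (0 : ℝ), A 0 t x / √(a t) ≤ K ∧ B 0 t x ≤ K)
    (hxx₀ : |x| < x₀) {c : ℂ}
    (hi : Tendsto (fun t => ∫ y in (-x₀)..x₀, G t x y * F y) (𝓝[>] 0) (𝓝 c)) :
    Tendsto (rayWave T β G F 0 · x) (𝓝[>] 0) (𝓝 c) := by
  have h := (hi.add (hG.tendsto_tailIntegral_time hT hq0 hq2 hF hx (Or.inl rfl) hxx₀ ha hAB)).add
    (hG.tendsto_tailIntegral_time hT hq0 hq2 hF hx (Or.inr rfl) hxx₀ ha hAB)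
  rw [add_zero, add_zero] at h
  refine h.congr' ?_
  filter_upwards [eventually_mem_timeInterval hT] with t ht
  exact (hG.rayWave_eq_intervalIntegral_add hq0 hq2 hF ht hx hxx₀).symm

end IsSectorKernel

theorem mem_expGrowth_iff {q : ℝ} {F : ℂ → ℂ} :
    F ∈ expGrowth q ↔ ∃ C D, HasExpGrowth q C D F := by
  refine ⟨fun ⟨hd, C, D, _, _, hb⟩ => ⟨C, D, hd, hb⟩, fun ⟨C, D, hF⟩ =>
    ⟨hF.differentiable, C, max D 0, hF.const_nonneg, le_max_right _ _, fun z => ?_⟩⟩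
  have hC := hF.const_nonneg
  refine (hF.bound z).trans ?_
  gcongr
  exact le_max_left _ _

theorem exists_eventually_hasExpGrowth_sub {q : ℝ} {F : ℕ → ℂ → ℂ} {F₀ : ℂ → ℂ}
    (h : TendstoExpGrowth q F F₀) :
    ∃ D : ℝ, ∀ δ > 0, ∀ᶠ n in atTop, HasExpGrowth q δ D fun z => F n z - F₀ z := by
  obtain ⟨hF, hF₀, D, -, hlim⟩ := h
  refine ⟨D, fun δ hδ => ?_⟩
  filter_upwards [hlim.eventually (gt_mem_nhds (ENNReal.ofReal_pos.2 hδ))] with n hn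
  refine ⟨(hF n).1.sub hF₀.1, fun z => ?_⟩
  have hz := (ENNReal.ofReal_le_ofReal_iff hδ.le).1 ((le_iSup (fun z : ℂ =>
    ENNReal.ofReal (‖F n z - F₀ z‖ * Real.exp (-(D * ‖z‖ ^ q)))) z).trans hn.le)
  rwa [Real.exp_neg, ← div_eq_mul_inv, div_le_iff₀ (Real.exp_pos _)] at hz

theorem isWeight_exp_mul_abs_rpow {q : ℝ} (hq0 : 0 ≤ q) (D : ℝ) :
    IsWeight q 1 D 0 fun y => (Real.exp (D * |y| ^ q) : ℂ) where
  continuous := by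
    have := continuous_abs.rpow_const (p := q) fun _ => Or.inr hq0
    fun_prop
  gauss_nonneg := le_rfl
  bound y := by simp [-Complex.ofReal_exp]

/-- `K` is the continuation, to a double sector of opening `β ≤ π / 4`, of a Green's function `G`
for the potential `V` and the transmission matrices `M`, `N`. -/
structure IsGreensContinuation (T : EReal) (V : ℝ → ℝ → ℂ) (M N : Matrix (Fin 2) (Fin 2) ℂ)
    (G : ℝ → ℝ → ℝ → ℂ) (β : ℝ) (K : ℝ → ℝ → ℂ → ℂ) (a : ℝ → ℝ) (p : ℝ)
    (A B : Fin 3 → ℝ → ℝ → ℝ) : Prop extends IsSectorKernel T β K a p A B where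
  apply_real : ∀ t ∈ timeInterval T, ∀ x : ℝ, x ≠ 0 → ∀ y : ℝ, y ≠ 0 → K t x y = G t x y
  schroedinger : ∀ z ∈ doubleSector β, SolvesSchroedinger T V fun t x => K t x z
  transmission : ∀ y : ℝ, y ≠ 0 → ∀ t ∈ timeInterval T, SatisfiesTransmission M N fun x => G t x y
  tendsto_delta : ∀ x : ℝ, x ≠ 0 → ∃ x₀ : ℝ, |x| < x₀ ∧
    ∀ f : ℝ → ℂ, ContDiffOn ℝ ∞ f (Icc (-x₀) x₀) →
      Tendsto (fun t => ∫ y in (-x₀)..x₀, G t x y * f y) (𝓝[>] 0) (𝓝 (f x))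
  tendsto_atTop : Tendsto a (𝓝[>] 0) atTop
  bounded_time : ∀ x : ℝ, x ≠ 0 →
    ∃ C : ℝ, ∀ᶠ t in 𝓝[>] (0 : ℝ), A 0 t x / √(a t) ≤ C ∧ B 0 t x ≤ C
  bounded_origin : ∀ t ∈ timeInterval T,
    (M ≠ 0 → N = 0 → ∃ C : ℝ, ∀ᶠ x in 𝓝[≠] (0 : ℝ), A 0 t x ≤ C ∧ B 0 t x ≤ C) ∧
    (N ≠ 0 → ∃ C : ℝ, ∀ᶠ x in 𝓝[≠] (0 : ℝ),
      A 0 t x ≤ C ∧ A 1 t x ≤ C ∧ B 0 t x ≤ C ∧ B 1 t x ≤ C)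

theorem IsGreensFunction.exists_isGreensContinuation {T : EReal} {V : ℝ → ℝ → ℂ}
    {M N : Matrix (Fin 2) (Fin 2) ℂ} {G : ℝ → ℝ → ℝ → ℂ} (hG : IsGreensFunction T V M N G) :
    ∃ β K a p A B, IsGreensContinuation T V M N G β K a p A B := by
  obtain ⟨α, hα0, -, K, hK, hKz, htr, hdelta, a, ha, ha0, hat, p, hp0, hp2, A, B, hA, hB, hAB, hb,
    hbt, hbx⟩ := hG
  have hsub : doubleSector (min α (Real.pi / 4)) ⊆ doubleSector α :=
    doubleSector_mono (min_le_left _ _)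
  exact ⟨min α (Real.pi / 4), K, a, p, A, B,
    { angle_pos := lt_min hα0 (by linarith [Real.pi_pos])
      angle_le := min_le_right _ _
      cont := fun t ht x hx => (hK t ht x hx).2.1.mono hsub
      holo := fun t ht x hx => (hK t ht x hx).2.2.mono (interior_mono hsub)
      ac12 := fun z hz => (hKz z (hsub hz)).1
      a_ac := ha
      a_pos := ha0
      p_pos := hp0
      p_lt := hp2
      A_cont := hA
      B_cont := hB
      nonneg := hAB
      bound := fun t ht x hx z hz => hb t ht x hx z (hsub hz)
      apply_real := fun t ht x hx => (hK t ht x hx).1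
      schroedinger := fun z hz => (hKz z (hsub hz)).2
      transmission := htr
      tendsto_delta := hdelta
      tendsto_atTop := hat
      bounded_time := hbt
      bounded_origin := hbx }⟩

namespace IsGreensContinuation

variable {T : EReal} {V : ℝ → ℝ → ℂ} {M N : Matrix (Fin 2) (Fin 2) ℂ} {G : ℝ → ℝ → ℝ → ℂ}
  {β : ℝ} {K : ℝ → ℝ → ℂ → ℂ} {a : ℝ → ℝ} {p : ℝ} {A B : Fin 3 → ℝ → ℝ → ℝ} {q C D t x : ℝ}
  {F : ℂ → ℂ}

theorem tendsto_intervalIntegral_time (hK : IsGreensContinuation T V M N G β K a p A B)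
    (hT : 0 < T) (hF : Differentiable ℂ F) (hx : x ≠ 0) :
    ∃ x₀, |x| < x₀ ∧ Tendsto (fun t => ∫ y in (-x₀)..x₀, K t x y * F y) (𝓝[>] 0) (𝓝 (F x)) := by
  obtain ⟨x₀, hxx₀, hδ⟩ := hK.tendsto_delta x hx
  have hsmooth : ContDiff ℝ ∞ fun y : ℝ => F y :=
    (hF.contDiff.restrict_scalars ℝ).comp Complex.ofRealCLM.contDiff
  refine ⟨x₀, hxx₀, (hδ _ hsmooth.contDiffOn).congr' ?_⟩
  filter_upwards [eventually_mem_timeInterval hT] with t ht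
  refine intervalIntegral.integral_congr_ae ?_
  filter_upwards [Measure.ae_ne volume (0 : ℝ)] with y hy _
  rw [hK.apply_real t ht x hx y hy]

theorem tendsto_waveFunction_time (hK : IsGreensContinuation T V M N G β K a p A B) (hT : 0 < T)
    (hq0 : 0 < q) (hq2 : q < 2) (hF : HasExpGrowth q C D F) (hx : x ≠ 0) :
    Tendsto (waveFunction G F · x) (𝓝[>] 0) (𝓝 (F x)) := by
  obtain ⟨x₀, hxx₀, hi⟩ := hK.tendsto_intervalIntegral_time hT hF.differentiable hx
  refine (hK.tendsto_rayWave_time hT hq0 hq2 hF hx hK.tendsto_atTop (hK.bounded_time x hx)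
    hxx₀ hi).congr' ?_
  filter_upwards [eventually_mem_timeInterval hT] with t ht
  exact (hK.waveFunction_eq hq0 hq2 hF ht hx (hK.apply_real t ht x hx)).symm

theorem waveFunctionSolves (hK : IsGreensContinuation T V M N G β K a p A B) (hT : 0 < T)
    (hq0 : 0 < q) (hq2 : q < 2) (hF : F ∈ expGrowth q) : WaveFunctionSolves T V M N G F := by
  obtain ⟨C, D, hF⟩ := mem_expGrowth_iff.1 hF
  have hwave : ∀ t ∈ timeInterval T, ∀ x, x ≠ 0 → rayWave T β K F 0 t x = waveFunction G F t x :=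
    fun t ht x hx => (hK.waveFunction_eq hq0 hq2 hF ht hx (hK.apply_real t ht x hx)).symm
  have hdom := hK.isDominatedFamily_ray (ε := 0) hq0 hq2 hF le_rfl
  refine ⟨fun t ht x hx => ⟨fun ε hε =>
      hK.integrable_regularizedIntegrand hq0 hq2 hF ht hx (hK.apply_real t ht x hx) hε, ?_⟩,
    hdom.isAC12_integral.congr hwave,
    (hdom.solvesSchroedinger_integral (hK.solvesSchroedinger_weightedKernel
      ⟨hK.angle_pos.le, le_rfl⟩ hK.schroedinger)).congr hwave,
    fun t ht => ?_, fun x hx => hK.tendsto_waveFunction_time hT hq0 hq2 hF hx⟩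
  · rw [← hwave t ht x hx]
    exact hK.tendsto_regularized hq0 hq2 hF ht hx (hK.apply_real t ht x hx)
  · exact (hK.satisfiesTransmission_rayWave hq0 hq2 hF ht (hK.bounded_origin t ht).1
      (hK.bounded_origin t ht).2 fun y hy => (hK.transmission y hy t ht).congr
        fun x hx => (hK.apply_real t ht x hx y hy).symm).congr (hwave t ht)

theorem waveFunction_eq_integral (hK : IsGreensContinuation T V M N G β K a p A B) (hq0 : 0 < q)
    (hq2 : q < 2) (hF : HasExpGrowth q C D F) (ht : t ∈ timeInterval T) (hx : x ≠ 0) :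
    waveFunction G F t x =
      ∫ y : ℝ, K t x (Complex.exp (β * Complex.I) * y) * rayWeight β 0 F y :=
  (hK.waveFunction_eq hq0 hq2 hF ht hx (hK.apply_real t ht x hx)).trans
    (rayWave_eq_integral ht hx F β 0)

theorem waveFunction_sum (hK : IsGreensContinuation T V M N G β K a p A B) (hq0 : 0 < q)
    (hq2 : q < 2) {ι : Type*} {s : Finset ι} {c : ι → ℂ} {f : ι → ℂ → ℂ}
    (hf : ∀ i ∈ s, f i ∈ expGrowth q) (hF : F ∈ expGrowth q)
    (hsum : ∀ z, F z = ∑ i ∈ s, c i * f i z) (ht : t ∈ timeInterval T) (hx : x ≠ 0) :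
    waveFunction G F t x = ∑ i ∈ s, c i * waveFunction G (f i) t x := by
  have hint : ∀ f ∈ expGrowth q,
      Integrable (fun y : ℝ => K t x (Complex.exp (β * Complex.I) * y) * rayWeight β 0 f y) ∧
      waveFunction G f t x =
        ∫ y : ℝ, K t x (Complex.exp (β * Complex.I) * y) * rayWeight β 0 f y := by
    intro f hf
    obtain ⟨C, D, hf⟩ := mem_expGrowth_iff.1 hf
    exact ⟨hK.integrable_ray hq0 hq2 hf ht hx le_rfl, hK.waveFunction_eq_integral hq0 hq2 hf ht hx⟩
  calc waveFunction G F t x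
      = ∫ y : ℝ, ∑ i ∈ s,
          c i * (K t x (Complex.exp (β * Complex.I) * y) * rayWeight β 0 (f i) y) := by
        rw [(hint F hF).2]
        congr 1 with y
        simp only [rayWeight, damped_zero, hsum, Finset.mul_sum]
        exact Finset.sum_congr rfl fun i _ => by ring
    _ = ∑ i ∈ s, c i * waveFunction G (f i) t x := by
        rw [integral_finsetSum s fun i hi => (hint (f i) (hf i hi)).1.const_mul _]
        exact Finset.sum_congr rfl fun i hi => by
          rw [integral_const_mul, (hint (f i) (hf i hi)).2]

theorem exists_norm_waveFunction_le (hK : IsGreensContinuation T V M N G β K a p A B) (hq0 : 0 < q)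
    (hq2 : q < 2) (ht : t ∈ timeInterval T) {S : Set ℝ} (hS : IsCompact S) (hS0 : S ⊆ {0}ᶜ)
    (D : ℝ) :
    ∃ L, 0 ≤ L ∧ ∀ δ F, HasExpGrowth q δ D F → ∀ x ∈ S, ‖waveFunction G F t x‖ ≤ δ * L := by
  obtain ⟨L, hL0, hL⟩ := hK.exists_norm_weightedKernel_le hq0 hq2
    (isWeight_exp_mul_abs_rpow hq0.le D) (θ := β) ⟨hK.angle_pos.le, le_rfl⟩
    (by simpa using hK.sin_two_mul_angle_pos) ht hS hS0
  refine ⟨L * ∫ y : ℝ, Real.exp (-|y|),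
    mul_nonneg hL0 (integral_nonneg fun y => (Real.exp_pos _).le), fun δ F hF x hxS => ?_⟩
  have hx : x ≠ 0 := hS0 hxS
  rw [hK.waveFunction_eq_integral hq0 hq2 hF ht hx, ← integral_const_mul, ← integral_const_mul]
  refine norm_integral_le_of_norm_le ((integrable_exp_neg_abs.const_mul L).const_mul δ) ?_
  filter_upwards [Measure.ae_ne volume (0 : ℝ)] with y hy
  have hy_le := hL x hxS y
  have hF_le := (hF.isWeight_ray hK.angle_pos.le hK.angle_le (le_refl 0)).bound y
  rw [weightedKernel_apply ht hx hy, norm_mul, Complex.norm_real,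
    Real.norm_of_nonneg (Real.exp_pos _).le] at hy_le
  rw [zero_mul, sub_zero] at hF_le
  calc ‖K t x (Complex.exp (β * Complex.I) * y) * rayWeight β 0 F y‖
      ≤ ‖K t x (Complex.exp (β * Complex.I) * y)‖ * (δ * Real.exp (D * |y| ^ q)) := by
        rw [norm_mul]
        gcongr
    _ = δ * (‖K t x (Complex.exp (β * Complex.I) * y)‖ * Real.exp (D * |y| ^ q)) :=
        mul_left_comm ..
    _ ≤ δ * (L * Real.exp (-|y|)) := mul_le_mul_of_nonneg_left hy_le hF.const_nonneg

theorem waveFunction_sub (hK : IsGreensContinuation T V M N G β K a p A B) (hq0 : 0 < q)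
    (hq2 : q < 2) {F₁ F₂ : ℂ → ℂ} (hF₁ : F₁ ∈ expGrowth q) (hF₂ : F₂ ∈ expGrowth q)
    (hF : (fun z => F₁ z - F₂ z) ∈ expGrowth q) (ht : t ∈ timeInterval T) (hx : x ≠ 0) :
    waveFunction G (fun z => F₁ z - F₂ z) t x = waveFunction G F₁ t x - waveFunction G F₂ t x := by
  have h := hK.waveFunction_sum hq0 hq2 (s := Finset.univ) (c := ![1, -1]) (f := ![F₁, F₂])
    (by simp [Fin.forall_fin_two, hF₁, hF₂]) hF (fun z => by simp [sub_eq_add_neg]) ht hx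
  simpa [sub_eq_add_neg] using h

theorem tendstoUniformlyOn_waveFunction (hK : IsGreensContinuation T V M N G β K a p A B)
    (hq0 : 0 < q) (hq2 : q < 2) {F : ℕ → ℂ → ℂ} {F₀ : ℂ → ℂ} (hF : TendstoExpGrowth q F F₀)
    (ht : t ∈ timeInterval T) {S : Set ℝ} (hS : IsCompact S) (hS0 : S ⊆ {0}ᶜ) :
    TendstoUniformlyOn (fun n => waveFunction G (F n) t) (waveFunction G F₀ t) atTop S := by
  obtain ⟨D, hD⟩ := exists_eventually_hasExpGrowth_sub hF
  obtain ⟨L, hL0, hL⟩ := hK.exists_norm_waveFunction_le hq0 hq2 ht hS hS0 D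
  refine Metric.tendstoUniformlyOn_iff.2 fun e he => ?_
  filter_upwards [hD (e / (L + 1)) (by positivity)] with n hn x hx
  rw [dist_comm, dist_eq_norm, ← hK.waveFunction_sub hq0 hq2 (hF.1 n) hF.2.1
    (mem_expGrowth_iff.2 ⟨_, _, hn⟩) ht (hS0 hx)]
  calc _ ≤ e / (L + 1) * L := hL _ _ hn x hx
    _ < e := by
      rw [div_mul_eq_mul_div, div_lt_iff₀ (by positivity)]
      linarith

end IsGreensContinuation

end

end Supershift

theorem theorem4p3
    (T : EReal) (hT : 0 < T) (V : ℝ → ℝ → ℂ) (M N : Matrix (Fin 2) (Fin 2) ℂ)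
    (G : ℝ → ℝ → ℝ → ℂ) (hG : Supershift.IsGreensFunction T V M N G)
    (O U : Set ℂ) (hUO : U ⊂ O) (q : ℝ) (hq0 : 0 < q) (hq2 : q < 2)
    (φ : ℂ → ℂ → ℂ) (hφ : ∀ κ ∈ O, φ κ ∈ Supershift.expGrowth q)
    (C : ℕ → ℕ → ℂ) (k : ℕ → ℕ → ℂ) (hk : ∀ n, ∀ l ≤ n, k n l ∈ U)
    (F : ℕ → ℂ → ℂ)
    (hF : ∀ n z, F n z = ∑ l ∈ Finset.range (n + 1), C n l * φ (k n l) z)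
    (κ : ℂ) (hκ : κ ∈ O \ U) (hconv : Supershift.TendstoExpGrowth q F (φ κ)) :
    (∀ κ' ∈ O, Supershift.WaveFunctionSolves T V M N G (φ κ')) ∧
    (∀ n, Supershift.WaveFunctionSolves T V M N G (F n)) ∧
    (∀ t ∈ Supershift.timeInterval T,
      (∀ x : ℝ, x ≠ 0 → ∀ n, Supershift.waveFunction G (F n) t x =
        ∑ l ∈ Finset.range (n + 1), C n l * Supershift.waveFunction G (φ (k n l)) t x) ∧
      (∀ K : Set ℝ, IsCompact K → K ⊆ {0}ᶜ →
        TendstoUniformlyOn (fun n x => Supershift.waveFunction G (F n) t x)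
          (fun x => Supershift.waveFunction G (φ κ) t x) atTop K ∧
        TendstoUniformlyOn
          (fun n x => ∑ l ∈ Finset.range (n + 1),
            C n l * Supershift.waveFunction G (φ (k n l)) t x)
          (fun x => Supershift.waveFunction G (φ κ) t x) atTop K) ∧
      Supershift.AdmitsSupershift (X := {x : ℝ // x ≠ 0}) O U
        (fun κ' x => Supershift.waveFunction G (φ κ') t x)
        (fun n x => Supershift.waveFunction G (F n) t x)) := by
  obtain ⟨β, Gc, a, p, A, B, hK⟩ := hG.exists_isGreensContinuation
  have hsum : ∀ t ∈ Supershift.timeInterval T, ∀ x : ℝ, x ≠ 0 → ∀ n,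
      Supershift.waveFunction G (F n) t x =
        ∑ l ∈ Finset.range (n + 1), C n l * Supershift.waveFunction G (φ (k n l)) t x :=
    fun t ht x hx n => hK.waveFunction_sum hq0 hq2
      (fun l hl => hφ _ (hUO.1 (hk n l (Finset.mem_range_succ_iff.1 hl)))) (hconv.1 n) (hF n) ht hx
  have hunif : ∀ t ∈ Supershift.timeInterval T, ∀ S : Set ℝ, IsCompact S → S ⊆ {0}ᶜ →
      TendstoUniformlyOn (fun n x => Supershift.waveFunction G (F n) t x)
        (fun x => Supershift.waveFunction G (φ κ) t x) atTop S :=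
    fun t ht S hS hS0 => hK.tendstoUniformlyOn_waveFunction hq0 hq2 hconv ht hS hS0
  refine ⟨fun κ' hκ' => hK.waveFunctionSolves hT hq0 hq2 (hφ κ' hκ'),
    fun n => hK.waveFunctionSolves hT hq0 hq2 (hconv.1 n), fun t ht => ⟨hsum t ht,
      fun S hS hS0 => ⟨hunif t ht S hS hS0, (hunif t ht S hS hS0).congr (Eventually.of_forall
        fun n x hx => hsum t ht x (hS0 hx) n)⟩,
      hUO, ⟨C, k, hk, fun n s => hsum t ht s s.2 n⟩, κ, hκ, fun S hS => ?_⟩⟩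
  have himage : Subtype.val '' S ⊆ ({0}ᶜ : Set ℝ) := image_subset_iff.2 fun s _ => s.2
  exact ((hunif t ht _ (hS.image continuous_subtype_val) himage).comp Subtype.val).mono
    (subset_preimage_image _ _)
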